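/- Let $p,q\in[0,1]$ and put $\alpha=2p-1$. Let $(X_k)_{k\ge1}$ be the steps of the elephant random walk: $P(X_1=1)=q=1-P(X_1=-1)$ and, for $n\ge1$, $X_{n+1}=\xi_nX_{U_n}$, where $U_n$ is uniformly distributed on $\{1,\dots,n\}$, $P(\xi_n=1)=p=1-P(\xi_n=-1)$, and the random variables $X_1,U_1,\xi_1,U_2,\xi_2,\dots$ are independent. Let $\mathcal F_n$ be the $\sigma$-algebra generated by $X_1,\dots,X_n$ ($\mathcal F_0$ is trivial). For $\gamma>0$ let $S_n=\sum_{k=1}^n k^{-\gamma}X_k$ be the elephant random walk with polynomially decaying steps and let $$M_n=\sum_{k=1}^n\frac{X_k-E[X_k\mid\mathcal F_{k-1}]}{k^\gamma}$$ be the martingale part of its Doob decomposition. Write $\xrightarrow{d}$ for convergence in distribution, $N(0,\sigma^2)$ for the centred normal law with variance $\sigma^2$; a statement with $\pm$ is claimed for both signs. Suppose that $\alpha\in[-1,1)$. (i) If $\gamma<1/2$, then $$\frac{M_n}{n^{1/2-\gamma}}\xrightarrow{d}N\Bigl(0,\frac1{1-2\gamma}\Bigr)\quad\text{and}\quad \limsup_{n\to\infty}\pm\frac{M_n}{\sqrt{2n^{1-2\gamma}\log\log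 n}}=\frac1{\sqrt{1-2\gamma}}\ \text{ a.s.}$$ (ii) If $\gamma=1/2$, then $$\frac{M_n}{\sqrt{\log n}}\xrightarrow{d}N(0,1)\quad\text{and}\quad \limsup_{n\to\infty}\pm\frac{M_n}{\sqrt{2\log n\,\log\log\log n}}=1\ \text{ a.s.}$$ (iii) If $\gamma>1/2$, then $M_n$ converges almost surely and in $L^2$ to a random variable $M_\infty$ with positive variance, and $$\frac{M_n-M_\infty}{n^{1/2-\gamma}}\xrightarrow{d}N\Bigl(0,\frac1{2\gamma-1}\Bigr)\quad\text{and}\quad \limsup_{n\to\infty}\pm\frac{M_n-M_\infty}{\sqrt{2n^{1-2\gamma}\log\log n}}=\frac1{\sqrt{2\gamma-1}}\ \text{ a.s.}$$ -/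

import Mathlib

open MeasureTheory ProbabilityTheory Filter Topology

namespace ERW

/-- `X 1, X 2, …` are the steps of the elephant random walk with memory parameter `p` and
first-step parameter `q`, driven by the choices `U n` (uniform on `{1, …, n}`) and the signs
`ξ n` (`+1` with probability `p`, `-1` with probability `1 - p`), `n ≥ 1`.  The first step, the
choices and the signs are all independent.  The values at index `0` play no role. -/
structure IsElephantRandomWalk {Ω : Type*} [MeasurableSpace Ω] (μ : Measure Ω) (p q : ℝ)
    (X : ℕ → Ω → ℝ) (U : ℕ → Ω → ℕ) (ξ : ℕ → Ω → ℝ) : Prop where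
  measurable_step : ∀ n, 1 ≤ n → Measurable (X n)
  measurable_choice : ∀ n, 1 ≤ n → Measurable (U n)
  measurable_sign : ∀ n, 1 ≤ n → Measurable (ξ n)
  first_pos : μ.real {ω | X 1 ω = 1} = q
  first_neg : μ.real {ω | X 1 ω = -1} = 1 - q
  choice_uniform : ∀ n, 1 ≤ n → ∀ j, 1 ≤ j → j ≤ n → μ.real {ω | U n ω = j} = 1 / (n : ℝ)
  sign_pos : ∀ n, 1 ≤ n → μ.real {ω | ξ n ω = 1} = p
  sign_neg : ∀ n, 1 ≤ n → μ.real {ω | ξ n ω = -1} = 1 - p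
  indep_choice_sign : ∀ n, 1 ≤ n → IndepFun (U n) (ξ n) μ
  indep_times : iIndepFun (fun (n : ℕ) (ω : Ω) => (U (n + 1) ω, ξ (n + 1) ω)) μ
  indep_first : IndepFun (X 1) (fun (ω : Ω) (n : ℕ) => (U (n + 1) ω, ξ (n + 1) ω)) μ
  step : ∀ n, 1 ≤ n → ∀ᵐ ω ∂μ, X (n + 1) ω = ξ n ω * X (U n ω) ω

/-- The σ-algebra `F_n` generated by `X 1, …, X n`; `F_0` is trivial. -/
@[reducible] def history {Ω : Type*} (X : ℕ → Ω → ℝ) (n : ℕ) : MeasurableSpace Ω :=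
  ⨆ k ∈ Finset.Icc 1 n, MeasurableSpace.comap (X k) inferInstance

/-- The walk with polynomially decaying steps, `S_n = ∑_{k=1}^n X_k / k^γ`. -/
noncomputable def position {Ω : Type*} (γ : ℝ) (X : ℕ → Ω → ℝ) (n : ℕ) (ω : Ω) : ℝ :=
  ∑ k ∈ Finset.Icc 1 n, X k ω / (k : ℝ) ^ γ

/-- The martingale part of the Doob decomposition of `S_n`,
`M_n = ∑_{k=1}^n (X_k - E[X_k | F_{k-1}]) / k^γ`. -/
noncomputable def martPart {Ω : Type*} [MeasurableSpace Ω] (μ : Measure Ω) (γ : ℝ)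
    (X : ℕ → Ω → ℝ) (n : ℕ) (ω : Ω) : ℝ :=
  ∑ k ∈ Finset.Icc 1 n, (X k ω - (μ[X k | history X (k - 1)]) ω) / (k : ℝ) ^ γ

/-- The predictable part of the Doob decomposition of `S_n`,
`A_n = ∑_{k=1}^n E[X_k | F_{k-1}] / k^γ`. -/
noncomputable def predPart {Ω : Type*} [MeasurableSpace Ω] (μ : Measure Ω) (γ : ℝ)
    (X : ℕ → Ω → ℝ) (n : ℕ) (ω : Ω) : ℝ :=
  ∑ k ∈ Finset.Icc 1 n, (μ[X k | history X (k - 1)]) ω / (k : ℝ) ^ γ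

/-- The decomposition `S_n = M_n + A_n`. -/
theorem position_eq {Ω : Type*} [MeasurableSpace Ω] (μ : Measure Ω) (γ : ℝ)
    (X : ℕ → Ω → ℝ) (n : ℕ) (ω : Ω) :
    position γ X n ω = martPart μ γ X n ω + predPart μ γ X n ω := by
  simp only [position, martPart, predPart, ← Finset.sum_add_distrib]
  exact Finset.sum_congr rfl fun k _ => by ring

/-- `Y n` converges in distribution to the normal law with mean `0` and variance `v` (used for
`v ≥ 0` only). -/
def CLT {Ω : Type*} [MeasurableSpace Ω] (μ : Measure Ω) [IsProbabilityMeasure μ]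
    (Y : ℕ → Ω → ℝ) (v : ℝ) : Prop :=
  TendstoInDistribution Y atTop (id : ℝ → ℝ) (fun _ => μ) (gaussianReal 0 v.toNNReal)

/-- `limsup ± y n = c` (both signs), the upper limits being taken in the extended reals. -/
def LimsupPM (y : ℕ → ℝ) (c : ℝ) : Prop :=
  limsup (fun n => ((y n : ℝ) : EReal)) atTop = (c : EReal) ∧
    limsup (fun n => ((-y n : ℝ) : EReal)) atTop = (c : EReal)

end ERW

/-!
The innovations `X (k + 1) - E[X (k + 1) | F_k]` are bounded martingale differences which, by
Hoeffding's lemma, are conditionally subgaussian with variance proxy `1`. Their conditional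
variance is `1 - m ^ 2` with `m = α * (X 1 + ⋯ + X k) / k`, and `E[m ^ 2]` decays polynomially
because `α < 1`. So weighted sums of the innovations behave like weighted sums of independent
standard Gaussian variables. Replacing one innovation after the other by a Gaussian variable in
the characteristic function gives the central limit theorem. The upper half of the law of the
iterated logarithm is the exponential maximal inequality on geometric blocks. For the lower half,
an almost Gaussian lower bound for the exponential moments of a block sum on an arbitrary past
event yields a lower bound for its tail given the past, and the conditional Borel–Cantelli lemma
applies. If `γ > 1 / 2`, the same estimates are applied to the remainder `M_∞ - M_n`.
-/

namespace ERW

/-! ### Conditionally subgaussian martingale differences -/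

theorem integral_condExp_smul {Ω E : Type*} {m mΩ : MeasurableSpace Ω} {μ : Measure Ω}
    [NormedAddCommGroup E] [NormedSpace ℝ E] [CompleteSpace E] (hm : m ≤ mΩ)
    [SigmaFinite (μ.trim hm)] {f : Ω → ℝ} {g : Ω → E} (hf : Integrable f μ)
    (hfg : Integrable (f • g) μ) (hg : AEStronglyMeasurable[m] g μ) :
    ∫ ω, (μ[f | m]) ω • g ω ∂μ = ∫ ω, f ω • g ω ∂μ :=
  (integral_congr_ae (condExp_smul_of_aestronglyMeasurable_right hf hfg hg)).symm.trans
    (integral_condExp hm)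

theorem one_add_sq_div_two_le_cosh (x : ℝ) : 1 + x ^ 2 / 2 ≤ Real.cosh x := by
  have hsinh : (x / 2) ^ 2 ≤ Real.sinh (x / 2) ^ 2 := by
    rw [sq_le_sq, Real.abs_sinh]
    exact Real.self_le_sinh_iff.2 (abs_nonneg _)
  have hcosh : Real.cosh x = 1 + 2 * Real.sinh (x / 2) ^ 2 := by
    rw [show x = 2 * (x / 2) by ring, Real.cosh_two_mul, Real.cosh_sq]
    ring_nf
  linarith

/-- The martingale difference sequences for which the limit theorems are proved: `d k` is revealed
at time `k + 1`, bounded by `K`, centred given the past, and conditionally subgaussian with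
variance proxy `1`. Mathlib's `HasCondSubgaussianMGF` is not used since it requires a standard
Borel space. -/
structure IsSubgaussianDifference {Ω : Type*} {mΩ : MeasurableSpace Ω} (μ : Measure Ω)
    (ℱ : Filtration ℕ mΩ) (d : ℕ → Ω → ℝ) (K : ℝ) : Prop where
  measurable_succ : ∀ k, Measurable[ℱ (k + 1)] (d k)
  ae_abs_le : ∀ k, ∀ᵐ ω ∂μ, |d k ω| ≤ K
  condExp_eq_zero : ∀ k, μ[d k | ℱ k] =ᵐ[μ] 0
  condExp_exp_le : ∀ k (θ : ℝ),
    μ[fun ω => Real.exp (θ * d k ω) | ℱ k] ≤ᵐ[μ] fun _ => Real.exp (θ ^ 2 / 2)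

/-- The weighted sum `∑_{N ≤ k < n} b k * d k` of a sequence of random variables. -/
def weightedSum {Ω : Type*} (d : ℕ → Ω → ℝ) (b : ℕ → ℝ) (N n : ℕ) (ω : Ω) : ℝ :=
  ∑ k ∈ Finset.Ico N n, b k * d k ω

section WeightedSum

variable {Ω : Type*} {d : ℕ → Ω → ℝ}

@[simp]
theorem weightedSum_self (b : ℕ → ℝ) (N : ℕ) (ω : Ω) : weightedSum d b N N ω = 0 := by
  simp [weightedSum]

theorem weightedSum_eq_zero_of_le (b : ℕ → ℝ) {N n : ℕ} (hn : n ≤ N) (ω : Ω) :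
    weightedSum d b N n ω = 0 := by
  simp [weightedSum, Finset.Ico_eq_empty_of_le hn]

theorem weightedSum_succ (b : ℕ → ℝ) {N n : ℕ} (hn : N ≤ n) (ω : Ω) :
    weightedSum d b N (n + 1) ω = weightedSum d b N n ω + b n * d n ω :=
  Finset.sum_Ico_succ_top hn _

theorem weightedSum_add (b : ℕ → ℝ) {N n l : ℕ} (hNn : N ≤ n) (hnl : n ≤ l) (ω : Ω) :
    weightedSum d b N n ω + weightedSum d b n l ω = weightedSum d b N l ω :=
  Finset.sum_Ico_consecutive _ hNn hnl

theorem weightedSum_const_mul (c : ℝ) (b : ℕ → ℝ) (N n : ℕ) (ω : Ω) :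
    weightedSum d (fun k => c * b k) N n ω = c * weightedSum d b N n ω := by
  simp only [weightedSum, Finset.mul_sum, mul_assoc]

end WeightedSum

namespace IsSubgaussianDifference

variable {Ω : Type*} {mΩ : MeasurableSpace Ω} {μ : Measure Ω} {ℱ : Filtration ℕ mΩ}
  {d : ℕ → Ω → ℝ} {K : ℝ}

protected theorem measurable (h : IsSubgaussianDifference μ ℱ d K) (k : ℕ) : Measurable (d k) :=
  (h.measurable_succ k).mono (ℱ.le _) le_rfl

theorem measurable_weightedSum_adapted (h : IsSubgaussianDifference μ ℱ d K) (b : ℕ → ℝ)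
    (N n : ℕ) : Measurable[ℱ n] (weightedSum d b N n) :=
  Finset.measurable_fun_sum _ fun k hk =>
    ((h.measurable_succ k).mono (ℱ.mono (Finset.mem_Ico.1 hk).2) le_rfl).const_mul _

theorem measurable_weightedSum (h : IsSubgaussianDifference μ ℱ d K) (b : ℕ → ℝ) (N n : ℕ) :
    Measurable (weightedSum d b N n) :=
  (h.measurable_weightedSum_adapted b N n).mono (ℱ.le _) le_rfl

theorem ae_abs_weightedSum_le (h : IsSubgaussianDifference μ ℱ d K) (b : ℕ → ℝ) (N n : ℕ) :
    ∀ᵐ ω ∂μ, |weightedSum d b N n ω| ≤ ∑ k ∈ Finset.Ico N n, |b k| * K := by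
  filter_upwards [ae_all_iff.2 h.ae_abs_le] with ω hω
  refine (Finset.abs_sum_le_sum_abs _ _).trans (Finset.sum_le_sum fun k _ => ?_)
  rw [abs_mul]
  gcongr
  exact hω k

theorem integrable_exp_mul_smul {E : Type*} [NormedAddCommGroup E] [NormedSpace ℝ E]
    (h : IsSubgaussianDifference μ ℱ d K) (k : ℕ) (θ : ℝ) {H : Ω → E} (hH : Integrable H μ) :
    Integrable (fun ω => Real.exp (θ * d k ω) • H ω) μ := by
  have := h.measurable k
  refine hH.bdd_smul (Real.exp (|θ| * K)) (by fun_prop) ?_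
  filter_upwards [h.ae_abs_le k] with ω hω
  rw [Real.norm_eq_abs, Real.abs_exp, Real.exp_le_exp]
  exact (le_abs_self _).trans (by rw [abs_mul]; gcongr)

variable [IsProbabilityMeasure μ]

theorem bound_nonneg (h : IsSubgaussianDifference μ ℱ d K) : 0 ≤ K :=
  let ⟨_, hω⟩ := (h.ae_abs_le 0).exists
  (abs_nonneg _).trans hω

protected theorem memLp (h : IsSubgaussianDifference μ ℱ d K) (k : ℕ) (p : ENNReal) :
    MemLp (d k) p μ :=
  .of_bound (h.measurable k).aestronglyMeasurable K (h.ae_abs_le k)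

protected theorem integrable (h : IsSubgaussianDifference μ ℱ d K) (k : ℕ) :
    Integrable (d k) μ :=
  memLp_one_iff_integrable.1 (h.memLp k 1)

theorem memLp_weightedSum (h : IsSubgaussianDifference μ ℱ d K) (b : ℕ → ℝ) (N n : ℕ)
    (p : ENNReal) : MemLp (weightedSum d b N n) p μ :=
  .of_bound (h.measurable_weightedSum b N n).aestronglyMeasurable _ (h.ae_abs_weightedSum_le b N n)

theorem integrable_weightedSum (h : IsSubgaussianDifference μ ℱ d K) (b : ℕ → ℝ) (N n : ℕ) :
    Integrable (weightedSum d b N n) μ :=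
  memLp_one_iff_integrable.1 (h.memLp_weightedSum b N n 1)

/-! ### One-step estimates -/

theorem integrable_exp_mul (h : IsSubgaussianDifference μ ℱ d K) (k : ℕ) (θ : ℝ) :
    Integrable (fun ω => Real.exp (θ * d k ω)) μ := by
  simpa using h.integrable_exp_mul_smul k θ (integrable_const (1 : ℝ))

theorem integral_smul_eq_zero {E : Type*} [NormedAddCommGroup E] [NormedSpace ℝ E]
    [CompleteSpace E] (h : IsSubgaussianDifference μ ℱ d K) (k : ℕ) {H : Ω → E}
    (hH : StronglyMeasurable[ℱ k] H) (hHi : Integrable H μ) : ∫ ω, d k ω • H ω ∂μ = 0 := by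
  have hi : Integrable (d k • H) μ :=
    hHi.bdd_smul K (h.measurable k).aestronglyMeasurable (h.ae_abs_le k)
  rw [← integral_condExp_smul (ℱ.le k) (h.integrable k) hi hH.aestronglyMeasurable]
  exact integral_eq_zero_of_ae (by filter_upwards [h.condExp_eq_zero k] with ω hω; simp [hω])

theorem condExp_sq_le_div (h : IsSubgaussianDifference μ ℱ d K) (k : ℕ) {θ : ℝ} (hθ : θ ≠ 0) :
    μ[fun ω => d k ω ^ 2 | ℱ k] ≤ᵐ[μ] fun _ => (Real.exp (θ ^ 2 / 2) - 1) / (θ ^ 2 / 2) := by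
  have hsum := (integrable_exp_mul h k θ).add (integrable_exp_mul h k (-θ))
  have hmono : (fun ω => 2 + θ ^ 2 * d k ω ^ 2) ≤ fun ω => Real.exp (θ * d k ω) +
      Real.exp (-θ * d k ω) := fun ω => by
    have := one_add_sq_div_two_le_cosh (θ * d k ω)
    rw [Real.cosh_eq, mul_pow, ← neg_mul] at this
    dsimp only
    linarith
  have hsq := (h.memLp k 2).integrable_sq
  have hle := condExp_mono (m := ℱ k) ((integrable_const (2 : ℝ)).add (hsq.const_mul (θ ^ 2))) hsum
    (ae_of_all _ hmono)
  have hadd := condExp_add (integrable_const (2 : ℝ)) (hsq.const_mul (θ ^ 2)) (ℱ k)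
  have hmul := condExp_smul (μ := μ) (θ ^ 2) (fun ω => d k ω ^ 2) (ℱ k)
  have hexp := condExp_add (integrable_exp_mul h k θ) (integrable_exp_mul h k (-θ)) (ℱ k)
  filter_upwards [hle, hadd, hmul, hexp, h.condExp_exp_le k θ, h.condExp_exp_le k (-θ)]
    with ω hle hadd hmul hexp h₁ h₂
  rw [hadd, hexp, Pi.add_apply, Pi.add_apply, condExp_const (ℱ.le k)] at hle
  have hmul' : (μ[fun ω => θ ^ 2 * d k ω ^ 2 | ℱ k]) ω = θ ^ 2 * (μ[fun ω => d k ω ^ 2 | ℱ k]) ω :=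
    hmul
  rw [neg_sq] at h₂
  rw [le_div_iff₀ (by positivity)]
  linarith

theorem condExp_sq_le_one (h : IsSubgaussianDifference μ ℱ d K) (k : ℕ) :
    μ[fun ω => d k ω ^ 2 | ℱ k] ≤ᵐ[μ] 1 := by
  have hlim : Tendsto (fun n : ℕ => (Real.exp ((1 / ((n : ℝ) + 1)) ^ 2 / 2) - 1) /
      ((1 / ((n : ℝ) + 1)) ^ 2 / 2)) atTop (𝓝 1) := by
    have hslope := (hasDerivAt_iff_tendsto_slope_zero.1 (Real.hasDerivAt_exp 0))
    simp only [zero_add, Real.exp_zero, smul_eq_mul, inv_mul_eq_div] at hslope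
    refine hslope.comp (tendsto_nhdsWithin_iff.2 ⟨?_, Eventually.of_forall fun n => ?_⟩)
    · simpa using (tendsto_one_div_add_atTop_nhds_zero_nat (𝕜 := ℝ)).pow 2 |>.div_const 2
    · exact ne_of_gt (by positivity)
  filter_upwards [ae_all_iff.2 fun n : ℕ => h.condExp_sq_le_div k
    (θ := 1 / ((n : ℝ) + 1)) (by positivity)] with ω hω
  exact ge_of_tendsto' hlim hω

end IsSubgaussianDifference

theorem integrable_one_sub_condExp {Ω : Type*} {m _ : MeasurableSpace Ω} {μ : Measure Ω}
    [IsFiniteMeasure μ] {f : Ω → ℝ} : Integrable (fun ω => 1 - (μ[f | m]) ω) μ :=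
  (integrable_const 1).sub integrable_condExp

theorem norm_cexp_sub_quadratic_le (u : ℂ) :
    ‖Complex.exp u - (1 + u + u ^ 2 / 2)‖ ≤ ‖u‖ ^ 3 * Real.exp ‖u‖ := by
  simpa [Finset.sum_range_succ, Nat.factorial] using Complex.norm_exp_sub_sum_le_norm_mul_exp u 3

theorem norm_cexp_sq_div_two_sub_le {z : ℂ} (hz : ‖z‖ ≤ 1) :
    ‖Complex.exp (z ^ 2 / 2) - 1 - z ^ 2 / 2‖ ≤ ‖z‖ ^ 3 := by
  have hnorm : ‖z ^ 2 / 2‖ = ‖z‖ ^ 2 / 2 := by simp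
  have hsq : ‖z‖ ^ 2 ≤ 1 := pow_le_one₀ (norm_nonneg z) hz
  calc ‖Complex.exp (z ^ 2 / 2) - 1 - z ^ 2 / 2‖ ≤ ‖z ^ 2 / 2‖ ^ 2 :=
        Complex.norm_exp_sub_one_sub_id_le (by rw [hnorm]; linarith)
    _ = ‖z‖ ^ 4 / 4 := by rw [hnorm]; ring
    _ ≤ ‖z‖ ^ 4 := by linarith [pow_nonneg (norm_nonneg z) 4]
    _ ≤ ‖z‖ ^ 3 := pow_le_pow_of_le_one (norm_nonneg z) hz (by norm_num)

/-- A constant `C` such that, up to `C * ‖z‖ ^ 3`, the exponential moment `E exp (z * d)` of a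
centred random variable with `|d| ≤ K` and unit variance is `exp (z ^ 2 / 2)` for `‖z‖ ≤ 1`. -/
noncomputable def taylorConst (K : ℝ) : ℝ := K ^ 3 * Real.exp K + 1

theorem taylorConst_pos {K : ℝ} (hK : 0 ≤ K) : 0 < taylorConst K := by
  unfold taylorConst; positivity

namespace IsSubgaussianDifference

variable {Ω : Type*} {mΩ : MeasurableSpace Ω} {μ : Measure Ω}
  {ℱ : Filtration ℕ mΩ} {d : ℕ → Ω → ℝ} {K : ℝ}

theorem integrable_sq_smul {E : Type*} [NormedAddCommGroup E] [NormedSpace ℝ E]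
    (h : IsSubgaussianDifference μ ℱ d K) (k : ℕ) {H : Ω → E} (hH : Integrable H μ) :
    Integrable (fun ω => d k ω ^ 2 • H ω) μ := by
  refine hH.bdd_smul (K ^ 2) ((h.measurable k).pow_const 2).aestronglyMeasurable ?_
  filter_upwards [h.ae_abs_le k] with ω hω
  rw [Real.norm_eq_abs, abs_pow]
  gcongr

variable [IsProbabilityMeasure μ]

theorem variance_eq_integral_sq (h : IsSubgaussianDifference μ ℱ d K) (k : ℕ) :
    Var[d k; μ] = ∫ ω, d k ω ^ 2 ∂μ := by
  refine variance_of_integral_eq_zero (h.measurable k).aemeasurable ?_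
  rw [← integral_condExp (ℱ.le k), integral_congr_ae (h.condExp_eq_zero k)]
  simp

theorem integral_one_sub_condExp_sq (h : IsSubgaussianDifference μ ℱ d K) (k : ℕ) :
    ∫ ω, (1 - (μ[fun ω => d k ω ^ 2 | ℱ k]) ω) ∂μ = 1 - Var[d k; μ] := by
  rw [integral_sub (integrable_const 1) integrable_condExp, integral_condExp (ℱ.le k),
    h.variance_eq_integral_sq]
  simp

theorem variance_le_one (h : IsSubgaussianDifference μ ℱ d K) (k : ℕ) : Var[d k; μ] ≤ 1 := by
  have hnonneg : 0 ≤ ∫ ω, (1 - (μ[fun ω => d k ω ^ 2 | ℱ k]) ω) ∂μ :=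
    integral_nonneg_of_ae ((h.condExp_sq_le_one k).mono fun _ => sub_nonneg.2)
  rw [h.integral_one_sub_condExp_sq] at hnonneg
  linarith

theorem integral_sq_smul_eq {E : Type*} [NormedAddCommGroup E] [NormedSpace ℝ E]
    [CompleteSpace E] (h : IsSubgaussianDifference μ ℱ d K) (k : ℕ) {H : Ω → E}
    (hH : StronglyMeasurable[ℱ k] H) (hHi : Integrable H μ) :
    ∫ ω, d k ω ^ 2 • H ω ∂μ = ∫ ω, (μ[fun ω => d k ω ^ 2 | ℱ k]) ω • H ω ∂μ :=
  (integral_condExp_smul (ℱ.le k) (h.memLp k 2).integrable_sq (h.integrable_sq_smul k hHi)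
    hH.aestronglyMeasurable).symm

theorem norm_integral_mul_exp_sub_quadratic_le (h : IsSubgaussianDifference μ ℱ d K) (k : ℕ)
    {z : ℂ} (hz : ‖z‖ ≤ 1) {H : Ω → ℂ} (hHi : Integrable H μ) :
    ‖∫ ω, (Complex.exp (z * d k ω) - (1 + z * d k ω + (z * d k ω) ^ 2 / 2)) * H ω ∂μ‖ ≤
      K ^ 3 * Real.exp K * ‖z‖ ^ 3 * ∫ ω, ‖H ω‖ ∂μ := by
  rw [← integral_const_mul]
  refine norm_integral_le_of_norm_le (hHi.norm.const_mul _) ?_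
  filter_upwards [h.ae_abs_le k] with ω hω
  have hu : ‖z * d k ω‖ ≤ ‖z‖ * K := by
    rw [norm_mul, Complex.norm_real]
    gcongr
    exact hω
  have hu' : ‖z * d k ω‖ ≤ K := hu.trans (mul_le_of_le_one_left h.bound_nonneg hz)
  rw [norm_mul]
  gcongr
  have hK := h.bound_nonneg
  calc _ ≤ ‖z * d k ω‖ ^ 3 * Real.exp ‖z * d k ω‖ := norm_cexp_sub_quadratic_le _
    _ ≤ (‖z‖ * K) ^ 3 * Real.exp K := by gcongr
    _ = K ^ 3 * Real.exp K * ‖z‖ ^ 3 := by ring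

theorem integral_quadratic_mul_eq (h : IsSubgaussianDifference μ ℱ d K) (k : ℕ) (z : ℂ)
    {H : Ω → ℂ} (hH : StronglyMeasurable[ℱ k] H) (hHi : Integrable H μ) :
    ∫ ω, (1 + z * d k ω + (z * d k ω) ^ 2 / 2) * H ω ∂μ =
      (1 + z ^ 2 / 2) * (∫ ω, H ω ∂μ) -
        z ^ 2 / 2 * ∫ ω, (1 - (μ[fun ω => d k ω ^ 2 | ℱ k]) ω) • H ω ∂μ := by
  have hm := h.measurable k
  have hi₁ : Integrable (fun ω => d k ω • H ω) μ :=
    hHi.bdd_smul K hm.aestronglyMeasurable (h.ae_abs_le k)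
  have hi₂ := h.integrable_sq_smul k hHi
  have hv : AEStronglyMeasurable (μ[fun ω => d k ω ^ 2 | ℱ k]) μ :=
    integrable_condExp.aestronglyMeasurable
  have hiv : Integrable (fun ω => (μ[fun ω => d k ω ^ 2 | ℱ k]) ω • H ω) μ := by
    refine hHi.bdd_smul 1 hv ?_
    filter_upwards [h.condExp_sq_le_one k,
      condExp_nonneg (m := ℱ k) (ae_of_all μ fun ω => sq_nonneg (d k ω))] with ω h₁ h₀
    rw [Real.norm_of_nonneg h₀]
    exact h₁
  have hexpand : ∀ ω, (1 + z * d k ω + (z * d k ω) ^ 2 / 2) * H ω =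
      H ω + z * (d k ω • H ω) + z ^ 2 / 2 * (d k ω ^ 2 • H ω) := fun ω => by
    simp only [Complex.real_smul]
    push_cast
    ring
  have hdefect : ∀ ω, (1 - (μ[fun ω => d k ω ^ 2 | ℱ k]) ω) • H ω =
      H ω - (μ[fun ω => d k ω ^ 2 | ℱ k]) ω • H ω := fun ω => by rw [sub_smul, one_smul]
  have hi₃ : Integrable (fun ω => H ω + z * (d k ω • H ω)) μ := hHi.add (hi₁.const_mul z)
  simp_rw [hexpand, hdefect]
  rw [integral_add hi₃ (hi₂.const_mul _),
    integral_add hHi (hi₁.const_mul z), integral_const_mul, integral_const_mul,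
    h.integral_smul_eq_zero k hH hHi, h.integral_sq_smul_eq k hH hHi, integral_sub hHi hiv]
  ring

theorem norm_integral_cexp_mul_sub_le (h : IsSubgaussianDifference μ ℱ d K) (k : ℕ) {z : ℂ}
    (hz : ‖z‖ ≤ 1) {H : Ω → ℂ} (hH : StronglyMeasurable[ℱ k] H) (hHi : Integrable H μ) :
    ‖∫ ω, Complex.exp (z * d k ω) * H ω ∂μ - Complex.exp (z ^ 2 / 2) * ∫ ω, H ω ∂μ‖ ≤
      taylorConst K * ‖z‖ ^ 3 * ∫ ω, ‖H ω‖ ∂μ +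
        ‖z‖ ^ 2 / 2 * ∫ ω, (1 - (μ[fun ω => d k ω ^ 2 | ℱ k]) ω) * ‖H ω‖ ∂μ := by
  set R : Ω → ℂ := fun ω => Complex.exp (z * d k ω) - (1 + z * d k ω + (z * d k ω) ^ 2 / 2)
  set D : ℂ := ∫ ω, (1 - (μ[fun ω => d k ω ^ 2 | ℱ k]) ω) • H ω ∂μ
  have hm := h.measurable k
  have bounded {f : ℝ → ℂ} (hf : Continuous f) :
      Integrable (fun ω => f (d k ω) * H ω) μ := by
    obtain ⟨C, hC⟩ := (isCompact_Icc (a := -K) (b := K)).exists_bound_of_continuousOn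
      hf.continuousOn
    refine hHi.bdd_mul (c := C) (hf.measurable.comp hm).aestronglyMeasurable ?_
    filter_upwards [h.ae_abs_le k] with ω hω using hC _ (abs_le.1 hω)
  have hsplit : ∫ ω, Complex.exp (z * d k ω) * H ω ∂μ =
      ∫ ω, R ω * H ω ∂μ + ∫ ω, (1 + z * d k ω + (z * d k ω) ^ 2 / 2) * H ω ∂μ := by
    rw [← integral_add
      (bounded (f := fun x : ℝ => Complex.exp (z * x) - (1 + z * x + (z * x) ^ 2 / 2))
        (by fun_prop))
      (bounded (f := fun x : ℝ => 1 + z * x + (z * x) ^ 2 / 2) (by fun_prop))]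
    exact integral_congr_ae (ae_of_all _ fun ω => by ring)
  have hD : ‖D‖ ≤ ∫ ω, (1 - (μ[fun ω => d k ω ^ 2 | ℱ k]) ω) * ‖H ω‖ ∂μ := by
    refine (norm_integral_le_integral_norm _).trans_eq (integral_congr_ae ?_)
    filter_upwards [h.condExp_sq_le_one k] with ω hω
    rw [norm_smul, Real.norm_of_nonneg (sub_nonneg.2 (by simpa using hω))]
  have hR := h.norm_integral_mul_exp_sub_quadratic_le k hz hHi
  have hE := norm_cexp_sq_div_two_sub_le hz
  have hH₁ := norm_integral_le_integral_norm (μ := μ) H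
  have hkey : ∫ ω, Complex.exp (z * d k ω) * H ω ∂μ - Complex.exp (z ^ 2 / 2) * ∫ ω, H ω ∂μ =
      ∫ ω, R ω * H ω ∂μ - (Complex.exp (z ^ 2 / 2) - 1 - z ^ 2 / 2) * (∫ ω, H ω ∂μ) -
        z ^ 2 / 2 * D := by
    rw [hsplit, h.integral_quadratic_mul_eq k z hH hHi]
    ring
  calc _ ≤ ‖∫ ω, R ω * H ω ∂μ‖ + ‖Complex.exp (z ^ 2 / 2) - 1 - z ^ 2 / 2‖ * ‖∫ ω, H ω ∂μ‖ +
        ‖z‖ ^ 2 / 2 * ‖D‖ := by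
        rw [hkey, ← norm_mul]
        refine (norm_sub_le _ _).trans (add_le_add (norm_sub_le _ _) (le_of_eq ?_))
        simp
    _ ≤ K ^ 3 * Real.exp K * ‖z‖ ^ 3 * (∫ ω, ‖H ω‖ ∂μ) + ‖z‖ ^ 3 * (∫ ω, ‖H ω‖ ∂μ) +
        ‖z‖ ^ 2 / 2 * ∫ ω, (1 - (μ[fun ω => d k ω ^ 2 | ℱ k]) ω) * ‖H ω‖ ∂μ := by gcongr
    _ = _ := by unfold taylorConst; ring

end IsSubgaussianDifference

/-! ### Exponential moments and the maximal inequality -/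

namespace IsSubgaussianDifference

variable {Ω : Type*} {mΩ : MeasurableSpace Ω} {μ : Measure Ω} {ℱ : Filtration ℕ mΩ}
  {d : ℕ → Ω → ℝ} {K : ℝ}

theorem integrable_exp_weightedSum_mul (h : IsSubgaussianDifference μ ℱ d K) (b : ℕ → ℝ)
    (N n : ℕ) {H : Ω → ℝ} (hH : Integrable H μ) :
    Integrable (fun ω => Real.exp (weightedSum d b N n ω) * H ω) μ := by
  have := h.measurable_weightedSum b N n
  refine hH.bdd_mul (c := Real.exp (∑ k ∈ Finset.Ico N n, |b k| * K)) (by fun_prop) ?_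
  filter_upwards [h.ae_abs_weightedSum_le b N n] with ω hω
  rw [Real.norm_eq_abs, Real.abs_exp]
  gcongr
  exact (le_abs_self _).trans hω

theorem measurable_exp_weightedSum_adapted (h : IsSubgaussianDifference μ ℱ d K) (b : ℕ → ℝ)
    (N n : ℕ) : Measurable[ℱ n] fun ω => Real.exp (weightedSum d b N n ω) :=
  Real.measurable_exp.comp (h.measurable_weightedSum_adapted b N n)

variable [IsProbabilityMeasure μ]

theorem integrable_exp_weightedSum (h : IsSubgaussianDifference μ ℱ d K) (b : ℕ → ℝ)
    (N n : ℕ) : Integrable (fun ω => Real.exp (weightedSum d b N n ω)) μ := by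
  simpa using h.integrable_exp_weightedSum_mul b N n (integrable_const (1 : ℝ))

theorem integral_exp_mul_mul_le (h : IsSubgaussianDifference μ ℱ d K) (k : ℕ) (θ : ℝ) {H : Ω → ℝ}
    (hH : StronglyMeasurable[ℱ k] H) (hHi : Integrable H μ) (hH₀ : ∀ ω, 0 ≤ H ω) :
    ∫ ω, Real.exp (θ * d k ω) * H ω ∂μ ≤ Real.exp (θ ^ 2 / 2) * ∫ ω, H ω ∂μ := by
  rw [← integral_const_mul]
  refine (integral_condExp_smul (ℱ.le k) (h.integrable_exp_mul k θ)
    (h.integrable_exp_mul_smul k θ hHi) hH.aestronglyMeasurable).symm.trans_le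
      (integral_mono_of_nonneg ?_ (hHi.const_mul _) ?_)
  · filter_upwards [condExp_nonneg (m := ℱ k) (ae_of_all μ fun ω => Real.exp_nonneg (θ * d k ω))]
      with ω hω using mul_nonneg hω (hH₀ ω)
  · filter_upwards [h.condExp_exp_le k θ] with ω hω using mul_le_mul_of_nonneg_right hω (hH₀ ω)

theorem integral_exp_weightedSum_mul_le (h : IsSubgaussianDifference μ ℱ d K) (b : ℕ → ℝ)
    {N n : ℕ} (hNn : N ≤ n) {H : Ω → ℝ} (hH : StronglyMeasurable[ℱ N] H) (hHi : Integrable H μ)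
    (hH₀ : ∀ ω, 0 ≤ H ω) :
    ∫ ω, Real.exp (weightedSum d b N n ω) * H ω ∂μ ≤
      Real.exp ((∑ k ∈ Finset.Ico N n, b k ^ 2) / 2) * ∫ ω, H ω ∂μ := by
  induction n, hNn using Nat.le_induction with
  | base => simp
  | succ n hNn ih =>
    calc ∫ ω, Real.exp (weightedSum d b N (n + 1) ω) * H ω ∂μ
        = ∫ ω, Real.exp (b n * d n ω) * (Real.exp (weightedSum d b N n ω) * H ω) ∂μ := by
          simp_rw [weightedSum_succ b hNn, Real.exp_add]
          congr 1 with ω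
          ring
      _ ≤ Real.exp (b n ^ 2 / 2) * ∫ ω, Real.exp (weightedSum d b N n ω) * H ω ∂μ :=
          h.integral_exp_mul_mul_le n (b n)
            ((h.measurable_exp_weightedSum_adapted b N n).stronglyMeasurable.mul
              (hH.mono (ℱ.mono hNn)))
            (h.integrable_exp_weightedSum_mul b N n hHi)
            fun ω => mul_nonneg (Real.exp_nonneg _) (hH₀ ω)
      _ ≤ Real.exp (b n ^ 2 / 2) *
            (Real.exp ((∑ k ∈ Finset.Ico N n, b k ^ 2) / 2) * ∫ ω, H ω ∂μ) := by gcongr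
      _ = _ := by
          rw [Finset.sum_Ico_succ_top hNn, add_div, Real.exp_add]
          ring

theorem integral_exp_weightedSum_le (h : IsSubgaussianDifference μ ℱ d K) (b : ℕ → ℝ) {N n : ℕ}
    (hNn : N ≤ n) : ∫ ω, Real.exp (weightedSum d b N n ω) ∂μ ≤
      Real.exp ((∑ k ∈ Finset.Ico N n, b k ^ 2) / 2) := by
  simpa using h.integral_exp_weightedSum_mul_le b hNn (H := fun _ => 1) stronglyMeasurable_const
    (integrable_const 1) (by simp)

theorem martingale_weightedSum (h : IsSubgaussianDifference μ ℱ d K) (b : ℕ → ℝ) (N : ℕ) :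
    Martingale (weightedSum d b N) ℱ μ := by
  refine martingale_nat (fun n => (h.measurable_weightedSum_adapted b N n).stronglyMeasurable)
    (h.integrable_weightedSum b N) fun n => ?_
  have hself : μ[weightedSum d b N n | ℱ n] = weightedSum d b N n :=
    condExp_of_stronglyMeasurable (ℱ.le n)
      (h.measurable_weightedSum_adapted b N n).stronglyMeasurable (h.integrable_weightedSum b N n)
  rcases lt_or_ge n N with hn | hn
  · rw [show weightedSum d b N (n + 1) = weightedSum d b N n from funext fun ω => by
      rw [weightedSum_eq_zero_of_le b hn, weightedSum_eq_zero_of_le b hn.le], hself]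
  · rw [show weightedSum d b N (n + 1) = weightedSum d b N n + b n • d n from
      funext (weightedSum_succ b hn)]
    filter_upwards [condExp_add (h.integrable_weightedSum b N n) ((h.integrable n).smul (b n))
        (ℱ n),
      condExp_smul (b n) (d n) (ℱ n), h.condExp_eq_zero n] with ω hadd hmul hzero
    rw [hadd, Pi.add_apply, hmul, hself, Pi.smul_apply, hzero]
    simp

theorem submartingale_exp_weightedSum (h : IsSubgaussianDifference μ ℱ d K) (b : ℕ → ℝ) (N : ℕ) :
    Submartingale (fun n ω => Real.exp (weightedSum d b N n ω)) ℱ μ := by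
  refine submartingale_nat
    (fun n => (h.measurable_exp_weightedSum_adapted b N n).stronglyMeasurable)
    (h.integrable_exp_weightedSum b N) fun n => ?_
  filter_upwards [(h.martingale_weightedSum b N).2 n (n + 1) n.le_succ,
    convexOn_exp.map_condExp_le_univ (ℱ.le n) Real.continuous_exp.lowerSemicontinuous
      (h.integrable_weightedSum b N (n + 1)) (h.integrable_exp_weightedSum b N (n + 1))]
    with ω hmart hjensen
  rw [← hmart]
  exact hjensen

theorem measure_exists_le_weightedSum_le (h : IsSubgaussianDifference μ ℱ d K) (b : ℕ → ℝ)
    {N n : ℕ} (hNn : N ≤ n) (y : ℝ) :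
    μ.real {ω | ∃ l ≤ n, y ≤ weightedSum d b N l ω} ≤
      Real.exp (-y + (∑ k ∈ Finset.Ico N n, b k ^ 2) / 2) := by
  have hmax := maximal_ineq (h.submartingale_exp_weightedSum b N) (fun _ _ => (Real.exp_pos _).le)
    (ε := (Real.exp y).toNNReal) n
  simp only [Finset.le_sup'_iff, Finset.mem_range, Real.coe_toNNReal _ (Real.exp_pos y).le,
    Real.exp_le_exp, Nat.lt_succ_iff] at hmax
  set s := {ω | ∃ l ≤ n, y ≤ weightedSum d b N l ω}
  have hintegral : ∫ ω in s, Real.exp (weightedSum d b N n ω) ∂μ ≤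
      Real.exp ((∑ k ∈ Finset.Ico N n, b k ^ 2) / 2) :=
    (setIntegral_le_integral (h.integrable_exp_weightedSum b N n)
      (ae_of_all _ fun _ => (Real.exp_pos _).le)).trans (h.integral_exp_weightedSum_le b hNn)
  have hreal : Real.exp y * μ.real s ≤ Real.exp ((∑ k ∈ Finset.Ico N n, b k ^ 2) / 2) := by
    simpa [ENNReal.toReal_ofReal, Real.exp_nonneg, Measure.real] using
      ENNReal.toReal_mono ENNReal.ofReal_ne_top (hmax.trans (ENNReal.ofReal_le_ofReal hintegral))
  rwa [Real.exp_add, Real.exp_neg, inv_mul_eq_div, le_div_iff₀' (Real.exp_pos _)]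

theorem measure_exists_le_weightedSum_le_exp (h : IsSubgaussianDifference μ ℱ d K) (b : ℕ → ℝ)
    {N n : ℕ} (hNn : N ≤ n) {y v : ℝ} (hy : 0 ≤ y) (hv : 0 < v)
    (hbv : ∑ k ∈ Finset.Ico N n, b k ^ 2 ≤ v) :
    μ.real {ω | ∃ l ≤ n, y ≤ weightedSum d b N l ω} ≤ Real.exp (-(y ^ 2 / (2 * v))) := by
  have htilt := h.measure_exists_le_weightedSum_le (fun k => y / v * b k) hNn (y / v * y)
  simp_rw [weightedSum_const_mul, mul_pow, ← Finset.mul_sum] at htilt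
  refine (measureReal_mono ?_).trans (htilt.trans (Real.exp_le_exp.2 ?_))
  · rintro ω ⟨l, hl, hyl⟩
    exact ⟨l, hl, by gcongr⟩
  · calc _ ≤ -(y / v * y) + (y / v) ^ 2 * v / 2 := by gcongr
      _ = _ := by field_simp; ring

end IsSubgaussianDifference

/-! ### Characteristic functions and large deviations -/

theorem exp_le_window {t X δ : ℝ} (hδ : 0 ≤ δ) :
    Real.exp t ≤ Real.exp ((1 + δ) * X) * (Set.Ici ((1 - δ) * X)).indicator 1 t +
      Real.exp (δ * (1 - δ) * X) * Real.exp ((1 - δ) * t) +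
      Real.exp (-(δ * (1 + δ) * X)) * Real.exp ((1 + δ) * t) := by
  rw [← Real.exp_add, ← Real.exp_add]
  rcases lt_or_ge t ((1 - δ) * X) with hlow | hlow
  · have : Real.exp t ≤ Real.exp (δ * (1 - δ) * X + (1 - δ) * t) :=
      Real.exp_le_exp.2 (by nlinarith)
    rw [Set.indicator_of_notMem (by simpa using hlow)]
    linarith [Real.exp_pos (-(δ * (1 + δ) * X) + (1 + δ) * t)]
  · rw [Set.indicator_of_mem (by simpa using hlow), Pi.one_apply, mul_one]
    have h₁ := Real.exp_pos (δ * (1 - δ) * X + (1 - δ) * t)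
    rcases le_or_gt t ((1 + δ) * X) with hup | hup
    · linarith [Real.exp_le_exp.2 hup, Real.exp_pos (-(δ * (1 + δ) * X) + (1 + δ) * t)]
    · have : Real.exp t ≤ Real.exp (-(δ * (1 + δ) * X) + (1 + δ) * t) :=
        Real.exp_le_exp.2 (by nlinarith)
      linarith [Real.exp_pos ((1 + δ) * X)]

theorem mul_le_add_of_le_one {κ u : ℝ} (hκ : 0 < κ) (hu₀ : 0 ≤ u) (hu₁ : u ≤ 1) (x : ℝ) :
    u * x ≤ κ / 2 * x ^ 2 + 1 / (2 * κ) * u := by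
  rw [← mul_le_mul_iff_right₀ (by positivity : 0 < 2 * κ)]
  calc 2 * κ * (u * x) ≤ (κ * x) ^ 2 + u ^ 2 := by linarith [two_mul_le_add_sq (κ * x) u]
    _ ≤ (κ * x) ^ 2 + u := by gcongr; nlinarith
    _ = _ := by field_simp

namespace IsSubgaussianDifference

variable {Ω : Type*} {mΩ : MeasurableSpace Ω} {μ : Measure Ω} [IsProbabilityMeasure μ]
  {ℱ : Filtration ℕ mΩ} {d : ℕ → Ω → ℝ} {K : ℝ}

theorem norm_integral_cexp_weightedSum_succ_sub_le (h : IsSubgaussianDifference μ ℱ d K)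
    (b : ℕ → ℝ) {N n : ℕ} (hNn : N ≤ n) (hb : |b n| ≤ 1) :
    ‖∫ ω, Complex.exp (Complex.I * weightedSum d b N (n + 1) ω) ∂μ -
        Complex.exp ((-(b n ^ 2 / 2) : ℝ)) *
          ∫ ω, Complex.exp (Complex.I * weightedSum d b N n ω) ∂μ‖ ≤
      taylorConst K * |b n| ^ 3 + b n ^ 2 / 2 * (1 - Var[d n; μ]) := by
  have hz : ‖(b n * Complex.I : ℂ)‖ = |b n| := by simp
  have hsq : (b n * Complex.I : ℂ) ^ 2 / 2 = ((-(b n ^ 2 / 2) : ℝ) : ℂ) := by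
    rw [mul_pow, Complex.I_sq]
    push_cast
    ring
  have hnorm (ω : Ω) : ‖Complex.exp (Complex.I * weightedSum d b N n ω)‖ = 1 := by
    rw [mul_comm, Complex.norm_exp_ofReal_mul_I]
  have hE : StronglyMeasurable[ℱ n] fun ω => Complex.exp (Complex.I * weightedSum d b N n ω) :=
    (Complex.measurable_exp.comp ((Complex.measurable_ofReal.comp
      (h.measurable_weightedSum_adapted b N n)).const_mul _)).stronglyMeasurable
  have hone := h.norm_integral_cexp_mul_sub_le n (z := b n * Complex.I) (by rwa [hz]) hE
    (.of_bound (hE.mono (ℱ.le n)).aestronglyMeasurable 1 (ae_of_all _ fun ω => (hnorm ω).le))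
  simp only [hnorm, mul_one, h.integral_one_sub_condExp_sq, hz, hsq, sq_abs, integral_const,
    probReal_univ, one_smul, ← Complex.exp_add] at hone
  convert hone using 6 with ω
  rw [weightedSum_succ b hNn]
  push_cast
  ring

theorem norm_integral_cexp_weightedSum_sub_le (h : IsSubgaussianDifference μ ℱ d K) (b : ℕ → ℝ)
    {N n : ℕ} (hNn : N ≤ n) (hb : ∀ k ∈ Finset.Ico N n, |b k| ≤ 1) :
    ‖∫ ω, Complex.exp (Complex.I * weightedSum d b N n ω) ∂μ -
        Complex.exp ((-((∑ k ∈ Finset.Ico N n, b k ^ 2) / 2) : ℝ))‖ ≤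
      ∑ k ∈ Finset.Ico N n, (taylorConst K * |b k| ^ 3 + b k ^ 2 / 2 * (1 - Var[d k; μ])) := by
  induction n, hNn using Nat.le_induction with
  | base => simp
  | succ n hNn ih =>
    have ih := ih fun k hk => hb k (Finset.Ico_subset_Ico_right (Nat.le_succ n) hk)
    have hstep := h.norm_integral_cexp_weightedSum_succ_sub_le b hNn (hb n (by simp [hNn]))
    have hcontr : ‖Complex.exp ((-(b n ^ 2 / 2) : ℝ))‖ ≤ 1 := by
      rw [Complex.norm_exp_ofReal]
      exact Real.exp_le_one_iff.2 (by linarith [sq_nonneg (b n)])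
    rw [Finset.sum_Ico_succ_top hNn, Finset.sum_Ico_succ_top hNn, add_div, neg_add, add_comm (-_),
      Complex.ofReal_add, Complex.exp_add, add_comm (∑ _ ∈ _, _)]
    refine (norm_sub_le_norm_sub_add_norm_sub _ _ _).trans (add_le_add hstep ?_)
    rw [← mul_sub, norm_mul]
    exact (mul_le_of_le_one_left (norm_nonneg _) hcontr).trans ih

theorem le_integral_exp_mul_mul (h : IsSubgaussianDifference μ ℱ d K) (k : ℕ) {θ : ℝ}
    (hθ : |θ| ≤ 1) {H : Ω → ℝ} (hH : StronglyMeasurable[ℱ k] H) (hHi : Integrable H μ)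
    (hH₀ : ∀ ω, 0 ≤ H ω) :
    (Real.exp (θ ^ 2 / 2) - taylorConst K * |θ| ^ 3) * (∫ ω, H ω ∂μ) -
        θ ^ 2 / 2 * ∫ ω, (1 - (μ[fun ω => d k ω ^ 2 | ℱ k]) ω) * H ω ∂μ ≤
      ∫ ω, Real.exp (θ * d k ω) * H ω ∂μ := by
  have hcomplex := h.norm_integral_cexp_mul_sub_le k (z := θ) (by simpa using hθ)
    (H := fun ω => (H ω : ℂ)) (Complex.continuous_ofReal.comp_stronglyMeasurable hH) hHi.ofReal
  have hcast : ∀ ω, Complex.exp (θ * d k ω) * H ω = ((Real.exp (θ * d k ω) * H ω : ℝ) : ℂ) :=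
    fun ω => by push_cast; rfl
  have hcast' : Complex.exp ((θ : ℂ) ^ 2 / 2) = (Real.exp (θ ^ 2 / 2) : ℝ) := by push_cast; rfl
  simp_rw [hcast, hcast', integral_complex_ofReal, ← Complex.ofReal_mul, ← Complex.ofReal_sub,
    Complex.norm_real, Real.norm_eq_abs, sq_abs, abs_of_nonneg (hH₀ _)] at hcomplex
  linarith [(abs_le.1 hcomplex).1]

theorem integral_one_sub_condExp_sq_mul_exp_le (h : IsSubgaussianDifference μ ℱ d K) (b : ℕ → ℝ)
    {N n : ℕ} (hNn : N ≤ n) {κ : ℝ} (hκ : 0 < κ) (hVar : 1 - Var[d n; μ] ≤ κ ^ 2) {T : ℝ}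
    (hT : ∑ k ∈ Finset.Ico N n, b k ^ 2 ≤ T) :
    ∫ ω, (1 - (μ[fun ω => d n ω ^ 2 | ℱ n]) ω) * Real.exp (weightedSum d b N n ω) ∂μ ≤
      κ * Real.exp (2 * T) := by
  have hT₀ : 0 ≤ T := (Finset.sum_nonneg fun k _ => sq_nonneg (b k)).trans hT
  have hi₂ : Integrable (fun ω => Real.exp (2 * weightedSum d b N n ω)) μ := by
    simpa only [weightedSum_const_mul] using h.integrable_exp_weightedSum (fun k => 2 * b k) N n
  have hexp₂ : ∫ ω, Real.exp (2 * weightedSum d b N n ω) ∂μ ≤ Real.exp (2 * T) := by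
    have := h.integral_exp_weightedSum_le (fun k => 2 * b k) hNn
    simp_rw [weightedSum_const_mul, mul_pow, ← Finset.mul_sum] at this
    exact this.trans (Real.exp_le_exp.2 (by linarith))
  have hv : Integrable (fun ω => 1 - (μ[fun ω => d n ω ^ 2 | ℱ n]) ω) μ :=
    integrable_one_sub_condExp
  calc ∫ ω, (1 - (μ[fun ω => d n ω ^ 2 | ℱ n]) ω) * Real.exp (weightedSum d b N n ω) ∂μ
      ≤ ∫ ω, (κ / 2 * Real.exp (2 * weightedSum d b N n ω) +
          1 / (2 * κ) * (1 - (μ[fun ω => d n ω ^ 2 | ℱ n]) ω)) ∂μ := by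
        refine integral_mono_of_nonneg ?_ ((hi₂.const_mul _).add (hv.const_mul _)) ?_
        · filter_upwards [h.condExp_sq_le_one n] with ω hω
          exact mul_nonneg (sub_nonneg.2 hω) (Real.exp_nonneg _)
        filter_upwards [h.condExp_sq_le_one n,
          condExp_nonneg (m := ℱ n) (ae_of_all μ fun ω => sq_nonneg (d n ω))] with ω h₁ h₀
        rw [show 2 * weightedSum d b N n ω = weightedSum d b N n ω + weightedSum d b N n ω by ring,
          Real.exp_add, ← sq]
        exact mul_le_add_of_le_one hκ (sub_nonneg.2 h₁) (sub_le_self _ h₀) _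
    _ = κ / 2 * (∫ ω, Real.exp (2 * weightedSum d b N n ω) ∂μ) +
        1 / (2 * κ) * (1 - Var[d n; μ]) := by
        rw [integral_add (hi₂.const_mul _) (hv.const_mul _), integral_const_mul,
          integral_const_mul, h.integral_one_sub_condExp_sq]
    _ ≤ κ / 2 * Real.exp (2 * T) + 1 / (2 * κ) * κ ^ 2 := by gcongr
    _ = κ / 2 * Real.exp (2 * T) + κ / 2 * 1 := by field_simp
    _ ≤ κ / 2 * Real.exp (2 * T) + κ / 2 * Real.exp (2 * T) := by
        gcongr
        exact Real.one_le_exp (by linarith)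
    _ = κ * Real.exp (2 * T) := by ring

theorem le_integral_exp_weightedSum_succ_mul (h : IsSubgaussianDifference μ ℱ d K) (b : ℕ → ℝ)
    {N n : ℕ} (hNn : N ≤ n) (hb : |b n| ≤ 1) {κ : ℝ} (hκ : 0 < κ)
    (hVar : 1 - Var[d n; μ] ≤ κ ^ 2) {T : ℝ} (hT : ∑ k ∈ Finset.Ico N n, b k ^ 2 ≤ T) {H : Ω → ℝ}
    (hH : StronglyMeasurable[ℱ N] H) (hH₀ : ∀ ω, 0 ≤ H ω) (hH₁ : ∀ ω, H ω ≤ 1) :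
    (Real.exp (b n ^ 2 / 2) - taylorConst K * |b n| ^ 3) *
        (∫ ω, Real.exp (weightedSum d b N n ω) * H ω ∂μ) -
        b n ^ 2 / 2 * (κ * Real.exp (2 * T)) ≤
      ∫ ω, Real.exp (weightedSum d b N (n + 1) ω) * H ω ∂μ := by
  have hHi : Integrable H μ := .of_bound (hH.mono (ℱ.le N)).aestronglyMeasurable 1
    (ae_of_all _ fun ω => (Real.norm_of_nonneg (hH₀ ω)).trans_le (hH₁ ω))
  have hdefect : ∫ ω, (1 - (μ[fun ω => d n ω ^ 2 | ℱ n]) ω) *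
      (Real.exp (weightedSum d b N n ω) * H ω) ∂μ ≤ κ * Real.exp (2 * T) := by
    refine (integral_mono_of_nonneg ?_ ?_ ?_).trans
      (h.integral_one_sub_condExp_sq_mul_exp_le b hNn hκ hVar hT)
    · filter_upwards [h.condExp_sq_le_one n] with ω hω
      exact mul_nonneg (sub_nonneg.2 hω) (mul_nonneg (Real.exp_nonneg _) (hH₀ ω))
    · simpa only [mul_comm] using h.integrable_exp_weightedSum_mul b N n
        (integrable_one_sub_condExp (m := ℱ n))
    · filter_upwards [h.condExp_sq_le_one n] with ω hω
      exact mul_le_mul_of_nonneg_left (mul_le_of_le_one_right (Real.exp_nonneg _) (hH₁ ω))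
        (sub_nonneg.2 hω)
  have hone := h.le_integral_exp_mul_mul n hb
    ((h.measurable_exp_weightedSum_adapted b N n).stronglyMeasurable.mul (hH.mono (ℱ.mono hNn)))
    (h.integrable_exp_weightedSum_mul b N n hHi) fun ω => mul_nonneg (Real.exp_nonneg _) (hH₀ ω)
  simp only [Pi.mul_apply] at hone
  calc _ ≤ _ := by gcongr
    _ ≤ _ := hone
    _ = _ := by
      congr 1 with ω
      rw [weightedSum_succ b hNn, Real.exp_add]
      ring

theorem integral_exp_weightedSum_mul_sub_le_succ (h : IsSubgaussianDifference μ ℱ d K) (b : ℕ → ℝ)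
    {N n : ℕ} (hNn : N ≤ n) (hb : |b n| ≤ 1) {κ : ℝ} (hκ : 0 < κ)
    (hVar : 1 - Var[d n; μ] ≤ κ ^ 2) {T : ℝ} (hT : ∑ k ∈ Finset.Ico N n, b k ^ 2 ≤ T) {H : Ω → ℝ}
    (hH : StronglyMeasurable[ℱ N] H) (hH₀ : ∀ ω, 0 ≤ H ω) (hH₁ : ∀ ω, H ω ≤ 1) :
    Real.exp (b n ^ 2 / 2) * (∫ ω, Real.exp (weightedSum d b N n ω) * H ω ∂μ) -
        Real.exp ((∑ k ∈ Finset.Ico N (n + 1), b k ^ 2) / 2) *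
          (taylorConst K * |b n| ^ 3 * (∫ ω, H ω ∂μ) + b n ^ 2 * (κ * Real.exp (2 * T))) ≤
      ∫ ω, Real.exp (weightedSum d b N (n + 1) ω) * H ω ∂μ := by
  refine le_trans ?_ (h.le_integral_exp_weightedSum_succ_mul b hNn hb hκ hVar hT hH hH₀ hH₁)
  have hC := taylorConst_pos h.bound_nonneg
  have hP : 0 ≤ ∫ ω, H ω ∂μ := integral_nonneg hH₀
  have hHi : Integrable H μ := .of_bound (hH.mono (ℱ.le N)).aestronglyMeasurable 1
    (ae_of_all _ fun ω => (Real.norm_of_nonneg (hH₀ ω)).trans_le (hH₁ ω))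
  have hI : ∫ ω, Real.exp (weightedSum d b N n ω) * H ω ∂μ ≤
      Real.exp ((∑ k ∈ Finset.Ico N (n + 1), b k ^ 2) / 2) * ∫ ω, H ω ∂μ := by
    refine (h.integral_exp_weightedSum_mul_le b hNn hH hHi hH₀).trans ?_
    gcongr
    exact n.le_succ
  have hcube := mul_le_mul_of_nonneg_left hI (by positivity : 0 ≤ taylorConst K * |b n| ^ 3)
  have hsq : b n ^ 2 / 2 * (κ * Real.exp (2 * T)) ≤
      Real.exp ((∑ k ∈ Finset.Ico N (n + 1), b k ^ 2) / 2) *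
        (b n ^ 2 * (κ * Real.exp (2 * T))) :=
    calc _ ≤ 1 * (b n ^ 2 * (κ * Real.exp (2 * T))) := by
          rw [one_mul]
          gcongr
          exact half_le_self (sq_nonneg _)
      _ ≤ _ := by
          gcongr
          exact Real.one_le_exp (by positivity)
  linarith

theorem le_integral_exp_weightedSum_mul (h : IsSubgaussianDifference μ ℱ d K) (b : ℕ → ℝ)
    {N n : ℕ} (hNn : N ≤ n) (hb : ∀ k ∈ Finset.Ico N n, |b k| ≤ 1) {κ : ℝ} (hκ : 0 < κ)
    (hVar : ∀ k ∈ Finset.Ico N n, 1 - Var[d k; μ] ≤ κ ^ 2) {T : ℝ}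
    (hT : ∑ k ∈ Finset.Ico N n, b k ^ 2 ≤ T) {H : Ω → ℝ}
    (hH : StronglyMeasurable[ℱ N] H) (hH₀ : ∀ ω, 0 ≤ H ω) (hH₁ : ∀ ω, H ω ≤ 1) :
    Real.exp ((∑ k ∈ Finset.Ico N n, b k ^ 2) / 2) *
        ((1 - taylorConst K * ∑ k ∈ Finset.Ico N n, |b k| ^ 3) * (∫ ω, H ω ∂μ) -
          (∑ k ∈ Finset.Ico N n, b k ^ 2) * (κ * Real.exp (2 * T))) ≤
      ∫ ω, Real.exp (weightedSum d b N n ω) * H ω ∂μ := by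
  induction n, hNn using Nat.le_induction with
  | base => simp
  | succ n hNn ih =>
    have hsub : Finset.Ico N n ⊆ Finset.Ico N (n + 1) := Finset.Ico_subset_Ico_right n.le_succ
    have hn : n ∈ Finset.Ico N (n + 1) := by simp [hNn]
    have hT' : ∑ k ∈ Finset.Ico N n, b k ^ 2 ≤ T :=
      (Finset.sum_le_sum_of_subset_of_nonneg hsub fun _ _ _ => sq_nonneg _).trans hT
    have ih := ih (fun k hk => hb k (hsub hk)) (fun k hk => hVar k (hsub hk)) hT'
    refine le_trans ?_
      (h.integral_exp_weightedSum_mul_sub_le_succ b hNn (hb n hn) hκ (hVar n hn) hT' hH hH₀ hH₁)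
    rw [Finset.sum_Ico_succ_top hNn, Finset.sum_Ico_succ_top hNn, add_div, Real.exp_add]
    linarith [mul_le_mul_of_nonneg_left ih (Real.exp_nonneg (b n ^ 2 / 2))]

end IsSubgaussianDifference

theorem exp_mul_sub_le_of_exp_mul_le {X δ P Q R : ℝ} (hX : 0 ≤ X) (hδ : 0 ≤ δ) (hR : 0 ≤ R)
    (h : Real.exp (X / 2) * (P / 2 - R) ≤ Real.exp ((1 + δ) * X) * Q) :
    Real.exp (-((1 / 2 + δ) * X)) / 2 * P - R ≤ Q := by
  have hexp : Real.exp (-((1 / 2 + δ) * X)) ≤ 1 := Real.exp_le_one_iff.2 (by nlinarith)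
  calc _ ≤ Real.exp (-((1 / 2 + δ) * X)) * (P / 2 - R) := by
        linarith [mul_le_mul_of_nonneg_right hexp hR]
    _ = Real.exp (-((1 + δ) * X)) * (Real.exp (X / 2) * (P / 2 - R)) := by
        rw [← mul_assoc, ← Real.exp_add]
        ring_nf
    _ ≤ Real.exp (-((1 + δ) * X)) * (Real.exp ((1 + δ) * X) * Q) := by gcongr
    _ = Q := by rw [← mul_assoc, ← Real.exp_add, neg_add_cancel, Real.exp_zero, one_mul]

namespace IsSubgaussianDifference

variable {Ω : Type*} {mΩ : MeasurableSpace Ω} {μ : Measure Ω} [IsProbabilityMeasure μ]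
  {ℱ : Filtration ℕ mΩ} {d : ℕ → Ω → ℝ} {K : ℝ}

theorem exp_mul_integral_exp_const_mul_weightedSum_mul_le (h : IsSubgaussianDifference μ ℱ d K)
    (b : ℕ → ℝ) {N n : ℕ} (hNn : N ≤ n) {X : ℝ} (hX : ∑ k ∈ Finset.Ico N n, b k ^ 2 = X) (c : ℝ)
    {H : Ω → ℝ} (hH : StronglyMeasurable[ℱ N] H) (hHi : Integrable H μ) (hH₀ : ∀ ω, 0 ≤ H ω) :
    Real.exp (c * (1 - c) * X) * ∫ ω, Real.exp (c * weightedSum d b N n ω) * H ω ∂μ ≤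
      Real.exp (c * (2 - c) * X / 2) * ∫ ω, H ω ∂μ := by
  have hc := h.integral_exp_weightedSum_mul_le (fun k => c * b k) hNn hH hHi hH₀
  simp_rw [weightedSum_const_mul, mul_pow, ← Finset.mul_sum, hX] at hc
  calc _ ≤ Real.exp (c * (1 - c) * X) * (Real.exp (c ^ 2 * X / 2) * ∫ ω, H ω ∂μ) := by gcongr
    _ = _ := by
        rw [← mul_assoc, ← Real.exp_add]
        ring_nf

theorem integral_exp_weightedSum_mul_le_setIntegral (h : IsSubgaussianDifference μ ℱ d K)
    (b : ℕ → ℝ) {N n : ℕ} (hNn : N ≤ n) {X δ : ℝ} (hX : ∑ k ∈ Finset.Ico N n, b k ^ 2 = X)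
    (hδ : 0 ≤ δ) {H : Ω → ℝ} (hH : StronglyMeasurable[ℱ N] H) (hHi : Integrable H μ)
    (hH₀ : ∀ ω, 0 ≤ H ω) :
    ∫ ω, Real.exp (weightedSum d b N n ω) * H ω ∂μ ≤
      Real.exp ((1 + δ) * X) * (∫ ω in {ω | (1 - δ) * X ≤ weightedSum d b N n ω}, H ω ∂μ) +
        2 * Real.exp ((1 - δ ^ 2) * X / 2) * ∫ ω, H ω ∂μ := by
  have hB : MeasurableSet {ω | (1 - δ) * X ≤ weightedSum d b N n ω} :=
    measurableSet_le measurable_const (h.measurable_weightedSum b N n)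
  have hi (c : ℝ) : Integrable (fun ω => Real.exp (c * weightedSum d b N n ω) * H ω) μ := by
    simpa only [weightedSum_const_mul] using
      h.integrable_exp_weightedSum_mul (fun k => c * b k) N n hHi
  have htilt (c : ℝ) := h.exp_mul_integral_exp_const_mul_weightedSum_mul_le b hNn hX c hH hHi hH₀
  have hlow := htilt (1 - δ)
  have hup := htilt (1 + δ)
  rw [show (1 - δ) * (1 - (1 - δ)) * X = δ * (1 - δ) * X by ring,
    show (1 - δ) * (2 - (1 - δ)) * X / 2 = (1 - δ ^ 2) * X / 2 by ring] at hlow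
  rw [show (1 + δ) * (1 - (1 + δ)) * X = -(δ * (1 + δ) * X) by ring,
    show (1 + δ) * (2 - (1 + δ)) * X / 2 = (1 - δ ^ 2) * X / 2 by ring] at hup
  have hiB := (hHi.indicator hB).const_mul (Real.exp ((1 + δ) * X))
  have hiB' : Integrable (fun ω => Real.exp ((1 + δ) * X) *
      {ω | (1 - δ) * X ≤ weightedSum d b N n ω}.indicator H ω +
        Real.exp (δ * (1 - δ) * X) * (Real.exp ((1 - δ) * weightedSum d b N n ω) * H ω)) μ :=
    hiB.add ((hi (1 - δ)).const_mul (Real.exp (δ * (1 - δ) * X)))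
  have hwindow : ∫ ω, Real.exp (weightedSum d b N n ω) * H ω ∂μ ≤
      Real.exp ((1 + δ) * X) * (∫ ω in {ω | (1 - δ) * X ≤ weightedSum d b N n ω}, H ω ∂μ) +
        Real.exp (δ * (1 - δ) * X) *
          (∫ ω, Real.exp ((1 - δ) * weightedSum d b N n ω) * H ω ∂μ) +
        Real.exp (-(δ * (1 + δ) * X)) *
          ∫ ω, Real.exp ((1 + δ) * weightedSum d b N n ω) * H ω ∂μ := by
    rw [← integral_indicator hB, ← integral_const_mul, ← integral_const_mul, ← integral_const_mul,
      ← integral_add hiB ((hi _).const_mul _), ← integral_add hiB' ((hi _).const_mul _)]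
    refine integral_mono (by simpa using hi 1) (hiB'.add ((hi _).const_mul _)) fun ω => ?_
    refine (mul_le_mul_of_nonneg_right
      (exp_le_window (t := weightedSum d b N n ω) (X := X) hδ) (hH₀ ω)).trans_eq ?_
    by_cases hω : (1 - δ) * X ≤ weightedSum d b N n ω <;> simp [hω] <;> ring
  linarith

theorem le_measureReal_inter_le_weightedSum (h : IsSubgaussianDifference μ ℱ d K) (b : ℕ → ℝ)
    {N n : ℕ} (hNn : N ≤ n) (hb : ∀ k ∈ Finset.Ico N n, |b k| ≤ 1) {κ : ℝ} (hκ : 0 < κ)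
    (hVar : ∀ k ∈ Finset.Ico N n, 1 - Var[d k; μ] ≤ κ ^ 2) {X δ : ℝ}
    (hX : ∑ k ∈ Finset.Ico N n, b k ^ 2 = X) (hδ : 0 ≤ δ)
    (hcube : taylorConst K * ∑ k ∈ Finset.Ico N n, |b k| ^ 3 ≤ 1 / 4)
    (hXδ : 2 * Real.exp (-(X * δ ^ 2 / 2)) ≤ 1 / 4) {A : Set Ω} (hA : MeasurableSet[ℱ N] A) :
    Real.exp (-((1 / 2 + δ) * X)) / 2 * μ.real A - X * (κ * Real.exp (2 * X)) ≤
      μ.real (A ∩ {ω | (1 - δ) * X ≤ weightedSum d b N n ω}) := by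
  have hX₀ : 0 ≤ X := hX ▸ Finset.sum_nonneg fun k _ => sq_nonneg _
  have hA' := ℱ.le _ _ hA
  have hH : StronglyMeasurable[ℱ N] (A.indicator (1 : Ω → ℝ)) :=
    stronglyMeasurable_one.indicator hA
  have hH₀ : ∀ ω, 0 ≤ A.indicator (1 : Ω → ℝ) ω := Set.indicator_nonneg (by simp)
  have hH₁ : ∀ ω, A.indicator (1 : Ω → ℝ) ω ≤ 1 := fun ω =>
    Set.indicator_le_self' (by simp) ω
  have hlow := h.le_integral_exp_weightedSum_mul b hNn hb hκ hVar hX.le hH hH₀ hH₁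
  have hup := h.integral_exp_weightedSum_mul_le_setIntegral b hNn hX hδ hH
    ((integrable_const 1).indicator hA') hH₀
  rw [setIntegral_indicator hA', Set.inter_comm] at hup
  simp only [integral_indicator_one hA', hX, Pi.one_apply, setIntegral_const, smul_eq_mul,
    mul_one] at hlow hup
  set P := μ.real A
  set Q := μ.real (A ∩ {ω | (1 - δ) * X ≤ weightedSum d b N n ω})
  set R := X * (κ * Real.exp (2 * X))
  have hP : 0 ≤ P := measureReal_nonneg
  have hR : 0 ≤ R := by positivity
  have hwin : 2 * Real.exp ((1 - δ ^ 2) * X / 2) ≤ Real.exp (X / 2) / 4 := by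
    calc _ = Real.exp (X / 2) * (2 * Real.exp (-(X * δ ^ 2 / 2))) := by
          rw [mul_left_comm, ← Real.exp_add]
          ring_nf
      _ ≤ Real.exp (X / 2) * (1 / 4) := by gcongr
      _ = _ := by ring
  refine exp_mul_sub_le_of_exp_mul_le hX₀ hδ hR ?_
  have := mul_le_mul_of_nonneg_right hwin hP
  have := mul_le_mul_of_nonneg_left (mul_le_mul_of_nonneg_right hcube hP)
    (Real.exp_nonneg (X / 2))
  linarith

end IsSubgaussianDifference

section BorelCantelli

variable {Ω : Type*} {mΩ : MeasurableSpace Ω} {μ : Measure Ω}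

theorem ae_eventually_notMem_of_summable [IsFiniteMeasure μ] {s : ℕ → Set Ω} {f : ℕ → ℝ}
    (hf : Summable f) (hs : ∀ᶠ j in atTop, μ.real (s j) ≤ f j) :
    ∀ᵐ ω ∂μ, ∀ᶠ j in atTop, ω ∉ s j := by
  have hsum : Summable fun j => μ.real (s j) := hf.of_norm_bounded_eventually_nat <| hs.mono
    fun j hj => by rwa [Real.norm_of_nonneg measureReal_nonneg]
  refine ae_eventually_notMem ?_
  simpa only [ofReal_measureReal (measure_ne_top μ _)] using hsum.tsum_ofReal_ne_top

theorem ae_summable_of_summable_integral {g : ℕ → Ω → ℝ} (hg : ∀ j, Integrable (g j) μ)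
    (hg₀ : ∀ j ω, 0 ≤ g j ω) (hsum : Summable fun j => ∫ ω, g j ω ∂μ) :
    ∀ᵐ ω ∂μ, Summable fun j => g j ω := by
  have hnorm (j : ℕ) : eLpNorm (g j) 1 μ = ENNReal.ofReal (∫ ω, g j ω ∂μ) := by
    rw [eLpNorm_one_eq_lintegral_enorm, ofReal_integral_eq_lintegral_ofReal (hg j)
      (ae_of_all _ (hg₀ j))]
    simp only [Real.enorm_eq_ofReal (hg₀ j _)]
  have := summable_norm_of_tsum_eLpNorm_ne_top le_rfl (fun j => (hg j).aestronglyMeasurable)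
    (by simpa only [hnorm] using hsum.tsum_ofReal_ne_top)
  simpa only [Real.norm_of_nonneg (hg₀ _ _)] using this

theorem integral_max_sub_condExp_le [IsFiniteMeasure μ] {m : MeasurableSpace Ω} (hm : m ≤ mΩ)
    {A : Set Ω} (hA : MeasurableSet[mΩ] A) {c b : ℝ}
    (hAc : ∀ B, MeasurableSet[m] B → c * μ.real B - b ≤ μ.real (B ∩ A)) :
    ∫ ω, max (c - μ[A.indicator (1 : Ω → ℝ) | m] ω) 0 ∂μ ≤ b := by
  set P := μ[A.indicator (1 : Ω → ℝ) | m]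
  have hB : MeasurableSet[m] {ω | P ω < c} :=
    (stronglyMeasurable_condExp (f := A.indicator (1 : Ω → ℝ))).measurable measurableSet_Iio
  have hind : Integrable (A.indicator (1 : Ω → ℝ)) μ := (integrable_const 1).indicator hA
  have hmax :
      (fun ω => max (c - P ω) 0) = {ω | P ω < c}.indicator fun ω => c - P ω := by
    ext ω
    rcases lt_or_ge (P ω) c with hω | hω
    · rw [Set.indicator_of_mem (s := {ω | P ω < c}) hω, max_eq_left (sub_nonneg.2 hω.le)]
    · rw [Set.indicator_of_notMem (s := {ω | P ω < c}) (not_lt.2 hω),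
        max_eq_right (sub_nonpos.2 hω)]
  rw [hmax, integral_indicator (hm _ hB), integral_sub (integrable_const c)
    integrable_condExp.integrableOn, setIntegral_condExp hm hind hB,
    setIntegral_indicator hA]
  simp only [Pi.one_apply, setIntegral_const, smul_eq_mul, mul_one]
  linarith [hAc _ hB]

theorem ae_frequently_of_le_measureReal_inter [IsFiniteMeasure μ] {ℱ : Filtration ℕ mΩ}
    {A : ℕ → Set Ω} (hA : ∀ j, MeasurableSet[ℱ (j + 1)] (A j)) {c b : ℕ → ℝ}
    (hc : Tendsto (fun n => ∑ j ∈ Finset.range n, c j) atTop atTop) (hb : Summable b)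
    (hAc : ∀ᶠ j in atTop, ∀ B, MeasurableSet[ℱ j] B → c j * μ.real B - b j ≤ μ.real (B ∩ A j)) :
    ∀ᵐ ω ∂μ, ∃ᶠ j in atTop, ω ∈ A j := by
  set P : ℕ → Ω → ℝ := fun j => μ[(A j).indicator (1 : Ω → ℝ) | ℱ j]
  have hdef : ∀ᵐ ω ∂μ, Summable fun j => max (c j - P j ω) 0 := by
    refine ae_summable_of_summable_integral
      (fun j => ((integrable_const _).sub integrable_condExp).pos_part)
      (fun _ _ => le_max_right _ _) (hb.of_norm_bounded_eventually_nat ?_)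
    filter_upwards [hAc] with j hj
    rw [Real.norm_of_nonneg (integral_nonneg fun ω => le_max_right (c j - P j ω) 0)]
    exact integral_max_sub_condExp_le (ℱ.le j) (ℱ.le _ _ (hA j)) hj
  have hs : ∀ n, MeasurableSet[ℱ n] (n.casesOn ∅ A : Set Ω)
    | 0 => @MeasurableSet.empty _ (ℱ 0)
    | j + 1 => hA j
  filter_upwards [hdef, ae_mem_limsup_atTop_iff μ hs] with ω hω hiff
  have hsum : Tendsto (fun n => ∑ j ∈ Finset.range n, P j ω) atTop atTop := by
    refine tendsto_atTop_mono (fun n => ?_) (hc.atTop_add hω.tendsto_sum_tsum_nat.neg)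
    rw [← sub_eq_add_neg, ← Finset.sum_sub_distrib]
    exact Finset.sum_le_sum fun j _ => by linarith [le_max_left (c j - P j ω) 0]
  refine frequently_atTop.2 fun i => ?_
  obtain ⟨n, hn, hnω⟩ := frequently_atTop.1 (mem_limsup_iff_frequently_mem.1 (hiff.2 hsum)) (i + 1)
  obtain ⟨j, rfl⟩ := Nat.exists_eq_add_of_le' (Nat.succ_le_of_lt (Nat.zero_lt_of_lt hn))
  exact ⟨j, Nat.le_of_succ_le_succ hn, hnω⟩

end BorelCantelli

/-! ### Time scales and geometric blocks -/

/-- A clock `φ` running to infinity at most at unit speed and without macroscopic jumps. -/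
structure IsClock (φ : ℕ → ℝ) : Prop where
  mono : Monotone φ
  tendsto : Tendsto φ atTop atTop
  le_self : ∀ n, φ n ≤ n
  ratio : Tendsto (fun n => φ (n + 1) / φ n) atTop (𝓝 1)

/-- The first time at which the clock `φ` reaches `ρ ^ j`. -/
noncomputable def hitTime (φ : ℕ → ℝ) (ρ : ℝ) (j : ℕ) : ℕ := sInf {n | ρ ^ j ≤ φ n}

/-- The normalisation `√(2 φ^β log log φ)` of the law of the iterated logarithm. -/
noncomputable def lilNorm (φ : ℕ → ℝ) (β : ℝ) (n : ℕ) : ℝ :=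
  √(2 * φ n ^ β * Real.log (Real.log (φ n)))

/-- The approximate value of `lilNorm` at the first time the clock reaches `ρ ^ j`. -/
noncomputable def blockNorm (ρ β : ℝ) (j : ℕ) : ℝ := √(2 * (ρ ^ j) ^ β * Real.log j)

theorem tendsto_log_natCast_atTop : Tendsto (fun j : ℕ => Real.log j) atTop atTop :=
  Real.tendsto_log_atTop.comp tendsto_natCast_atTop_atTop

theorem blockNorm_sq {ρ β : ℝ} (hρ : 0 < ρ) (j : ℕ) :
    blockNorm ρ β j ^ 2 = 2 * (ρ ^ j) ^ β * Real.log j := by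
  rw [blockNorm, Real.sq_sqrt]
  have := Real.log_natCast_nonneg j
  positivity

theorem blockNorm_nonneg (ρ β : ℝ) (j : ℕ) : 0 ≤ blockNorm ρ β j := Real.sqrt_nonneg _

theorem eventually_blockNorm_pos {ρ : ℝ} (hρ : 0 < ρ) (β : ℝ) :
    ∀ᶠ j in atTop, 0 < blockNorm ρ β j := by
  filter_upwards [tendsto_log_natCast_atTop.eventually_gt_atTop 0] with j hj
  exact Real.sqrt_pos.2 (by positivity)

theorem tendsto_log_natCast_succ_div :
    Tendsto (fun j : ℕ => Real.log (j + 1 : ℕ) / Real.log j) atTop (𝓝 1) := by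
  have hsub : Tendsto (fun j : ℕ => Real.log (1 + 1 / (j : ℝ))) atTop (𝓝 0) := by
    simpa using (tendsto_one_div_atTop_nhds_zero_nat.const_add (1 : ℝ)).log (by simp)
  have hlim := (hsub.div_atTop tendsto_log_natCast_atTop).const_add 1
  rw [add_zero] at hlim
  refine hlim.congr' ?_
  filter_upwards [tendsto_log_natCast_atTop.eventually_gt_atTop 0, eventually_gt_atTop 0]
    with j hlog hj
  have hj' : (0 : ℝ) < j := by exact_mod_cast hj
  rw [show ((j + 1 : ℕ) : ℝ) = j * (1 + 1 / (j : ℝ)) by push_cast; field_simp,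
    Real.log_mul hj'.ne' (by positivity)]
  field_simp

theorem tendsto_blockNorm_succ_div {ρ : ℝ} (hρ : 0 < ρ) (β : ℝ) :
    Tendsto (fun j => blockNorm ρ β (j + 1) / blockNorm ρ β j) atTop (𝓝 √(ρ ^ β)) := by
  have hlim := (tendsto_log_natCast_succ_div.const_mul (ρ ^ β)).sqrt
  rw [mul_one] at hlim
  refine hlim.congr' ?_
  filter_upwards [tendsto_log_natCast_atTop.eventually_gt_atTop 0] with j hj
  have := Real.log_natCast_nonneg (j + 1)
  have : 0 < (ρ ^ j) ^ β := by positivity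
  rw [blockNorm, blockNorm, ← Real.sqrt_div (by positivity), pow_succ,
    Real.mul_rpow (by positivity) hρ.le]
  congr 1
  field_simp

theorem tendsto_pow_div_pow_atTop_zero (k : ℕ) {ρ : ℝ} (hρ : 1 < ρ) :
    Tendsto (fun j : ℕ => (j : ℝ) ^ k / ρ ^ j) atTop (𝓝 0) := by
  have h := tendsto_pow_const_mul_const_pow_of_abs_lt_one k (r := ρ⁻¹)
    (by rw [abs_of_pos (by positivity)]; exact inv_lt_one_of_one_lt₀ hρ)
  simpa [div_eq_mul_inv] using h

theorem summable_exp_neg_blockNorm {ρ : ℝ} (hρ : 0 < ρ) (β : ℝ) {A D : ℝ} (hD : 0 < D)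
    (hA : D < A ^ 2) :
    Summable fun j : ℕ =>
      Real.exp (-((A * blockNorm ρ β j) ^ 2 / (2 * (D * (ρ ^ j) ^ β)))) := by
  have hs : Summable fun j : ℕ => (j : ℝ) ^ (-(A ^ 2 / D)) :=
    Real.summable_nat_rpow.2 (neg_lt_neg ((one_lt_div hD).2 hA))
  refine (summable_nat_add_iff 1).1 (((summable_nat_add_iff 1).2 hs).congr fun j => ?_)
  have hj : (0 : ℝ) < (j + 1 : ℕ) := by positivity
  rw [mul_pow, blockNorm_sq hρ, Real.rpow_def_of_pos hj]
  have : 0 < (ρ ^ (j + 1)) ^ β := by positivity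
  congr 1
  field_simp

theorem min_one_rpow_mul_le {ρ : ℝ} (hρ : 1 ≤ ρ) (β : ℝ) {j : ℕ} {y : ℝ} (hy : ρ ^ j ≤ y)
    (hy' : y ≤ ρ ^ (j + 1)) : min 1 (ρ ^ β) * (ρ ^ j) ^ β ≤ y ^ β := by
  have hp : 0 < ρ ^ j := by positivity
  rcases le_total 0 β with hβ | hβ
  · calc min 1 (ρ ^ β) * (ρ ^ j) ^ β ≤ 1 * (ρ ^ j) ^ β := by gcongr; exact min_le_left _ _
      _ = (ρ ^ j) ^ β := one_mul _
      _ ≤ y ^ β := Real.rpow_le_rpow hp.le hy hβ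
  · calc min 1 (ρ ^ β) * (ρ ^ j) ^ β ≤ ρ ^ β * (ρ ^ j) ^ β := by gcongr; exact min_le_right _ _
      _ = (ρ ^ (j + 1)) ^ β := by
        rw [pow_succ', Real.mul_rpow (by positivity) hp.le]
      _ ≤ y ^ β := Real.rpow_le_rpow_of_nonpos (hp.trans_le hy) hy' hβ

theorem eventually_mul_log_le_log_log {ρ η : ℝ} (hρ : 1 < ρ) (hη : η < 1) :
    ∀ᶠ j : ℕ in atTop, ∀ y, ρ ^ j ≤ y → η * Real.log j ≤ Real.log (Real.log y) := by
  have hlogρ := Real.log_pos hρ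
  have hlim := ((tendsto_const_nhds (x := Real.log (Real.log ρ))).div_atTop
    tendsto_log_natCast_atTop).const_add 1
  rw [add_zero] at hlim
  filter_upwards [tendsto_log_natCast_atTop.eventually_gt_atTop 0, eventually_gt_atTop 0,
    hlim.eventually_const_lt hη] with j hlogj hj hηj y hy
  have hj' : (0 : ℝ) < j := by exact_mod_cast hj
  calc η * Real.log j ≤ (1 + Real.log (Real.log ρ) / Real.log j) * Real.log j := by gcongr
    _ = Real.log (j * Real.log ρ) := by
        rw [Real.log_mul hj'.ne' hlogρ.ne']
        field_simp
    _ ≤ Real.log (Real.log y) := by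
        refine Real.log_le_log (by positivity) ?_
        rw [← Real.log_pow]
        exact Real.log_le_log (by positivity) hy

namespace IsClock

variable {φ : ℕ → ℝ} {ρ : ℝ}

theorem le_hitTime (hφ : IsClock φ) (ρ : ℝ) (j : ℕ) : ρ ^ j ≤ φ (hitTime φ ρ j) :=
  Nat.sInf_mem (s := {n | ρ ^ j ≤ φ n}) (hφ.tendsto.eventually_ge_atTop _).exists

theorem lt_of_lt_hitTime {j n : ℕ} (hn : n < hitTime φ ρ j) : φ n < ρ ^ j := by
  simpa using Nat.notMem_of_lt_sInf hn

theorem hitTime_le {j n : ℕ} (hn : ρ ^ j ≤ φ n) : hitTime φ ρ j ≤ n := Nat.sInf_le hn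

theorem lt_hitTime (hφ : IsClock φ) {j n : ℕ} (hn : φ n < ρ ^ j) : n < hitTime φ ρ j := by
  by_contra h
  exact absurd (hφ.le_hitTime ρ j) (not_le.2 ((hφ.mono (not_lt.1 h)).trans_lt hn))

theorem monotone_hitTime (hφ : IsClock φ) (hρ : 1 ≤ ρ) : Monotone (hitTime φ ρ) :=
  fun _ _ hij => hitTime_le ((pow_le_pow_right₀ hρ hij).trans (hφ.le_hitTime ρ _))

theorem pow_le_natCast_hitTime (hφ : IsClock φ) (ρ : ℝ) (j : ℕ) : ρ ^ j ≤ hitTime φ ρ j :=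
  (hφ.le_hitTime ρ j).trans (hφ.le_self _)

theorem tendsto_hitTime (hφ : IsClock φ) (hρ : 1 < ρ) : Tendsto (hitTime φ ρ) atTop atTop :=
  (tendsto_natCast_atTop_iff (R := ℝ)).1
    (tendsto_atTop_mono (hφ.pow_le_natCast_hitTime ρ) (tendsto_pow_atTop_atTop_of_one_lt hρ))

theorem tendsto_hitTime_div (hφ : IsClock φ) (hρ : 1 < ρ) :
    Tendsto (fun j => φ (hitTime φ ρ j) / ρ ^ j) atTop (𝓝 1) := by
  have hN := hφ.tendsto_hitTime hρ
  have hpred : Tendsto (fun j => hitTime φ ρ j - 1) atTop atTop :=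
    (tendsto_sub_atTop_nat 1).comp hN
  refine tendsto_of_tendsto_of_tendsto_of_le_of_le' tendsto_const_nhds (hφ.ratio.comp hpred)
    (Eventually.of_forall fun j => (one_le_div (by positivity)).2 (hφ.le_hitTime ρ j)) ?_
  filter_upwards [hN.eventually_gt_atTop 0, (hφ.tendsto.comp hpred).eventually_gt_atTop 0]
    with j hj hpos
  simp only [Function.comp, Nat.sub_add_cancel hj] at hpos ⊢
  have hnonneg : 0 ≤ φ (hitTime φ ρ j) := hpos.le.trans (hφ.mono (Nat.sub_le _ _))
  exact div_le_div_of_nonneg_left hnonneg hpos (lt_of_lt_hitTime (Nat.sub_lt hj one_pos)).le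

theorem tendsto_log_log_hitTime_div (hφ : IsClock φ) (hρ : 1 < ρ) :
    Tendsto (fun j => Real.log (Real.log (φ (hitTime φ ρ j))) / Real.log j) atTop (𝓝 1) := by
  have hlogρ := Real.log_pos hρ
  have hslope : Tendsto (fun j : ℕ => Real.log ρ + Real.log (φ (hitTime φ ρ j) / ρ ^ j) / j) atTop
      (𝓝 (Real.log ρ + 0)) := by
    refine tendsto_const_nhds.add (Tendsto.div_atTop (a := 0) ?_ tendsto_natCast_atTop_atTop)
    simpa using (hφ.tendsto_hitTime_div hρ).log one_ne_zero
  rw [add_zero] at hslope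
  have hlim := ((hslope.log hlogρ.ne').div_atTop tendsto_log_natCast_atTop).const_add 1
  rw [add_zero] at hlim
  refine hlim.congr' ?_
  filter_upwards [tendsto_log_natCast_atTop.eventually_gt_atTop 0, eventually_gt_atTop 0,
    hslope.eventually_const_lt hlogρ] with j hlogj hj hpos
  have hj' : (0 : ℝ) < j := by exact_mod_cast hj
  have hp : 0 < ρ ^ j := by positivity
  have hφ₀ : 0 < φ (hitTime φ ρ j) := hp.trans_le (hφ.le_hitTime ρ j)
  have hlogφ : Real.log (φ (hitTime φ ρ j)) =
      j * (Real.log ρ + Real.log (φ (hitTime φ ρ j) / ρ ^ j) / j) := by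
    rw [Real.log_div hφ₀.ne' hp.ne', Real.log_pow]
    field_simp
    ring
  rw [hlogφ, Real.log_mul hj'.ne' hpos.ne']
  field_simp

theorem tendsto_lilNorm_hitTime_div (hφ : IsClock φ) (hρ : 1 < ρ) (β : ℝ) :
    Tendsto (fun j => lilNorm φ β (hitTime φ ρ j) / blockNorm ρ β j) atTop (𝓝 1) := by
  have hlim := (((hφ.tendsto_hitTime_div hρ).rpow_const (p := β) (Or.inl one_ne_zero)).mul
    (hφ.tendsto_log_log_hitTime_div hρ)).sqrt
  rw [Real.one_rpow, mul_one, Real.sqrt_one] at hlim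
  refine hlim.congr' ?_
  filter_upwards [tendsto_log_natCast_atTop.eventually_gt_atTop 0] with j hj
  have hp : 0 < ρ ^ j := by positivity
  have hφ₀ : 0 < φ (hitTime φ ρ j) := hp.trans_le (hφ.le_hitTime ρ j)
  have : 0 < (ρ ^ j) ^ β := by positivity
  rw [lilNorm, blockNorm, ← Real.sqrt_div' _ (by positivity), Real.div_rpow hφ₀.le hp.le]
  congr 1
  field_simp

theorem eventually_blockNorm_le_lilNorm (hρ : 1 < ρ) (β : ℝ) {η : ℝ} (hη₀ : 0 ≤ η)
    (hη : η < 1) :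
    ∀ᶠ j in atTop, ∀ n, ρ ^ j ≤ φ n → φ n < ρ ^ (j + 1) →
      √(min 1 (ρ ^ β) * η) * blockNorm ρ β j ≤ lilNorm φ β n := by
  filter_upwards [eventually_mul_log_le_log_log hρ hη] with j hlog n hn hn'
  have hpow := min_one_rpow_mul_le hρ.le β hn hn'.le
  have := Real.log_natCast_nonneg j
  have : 0 ≤ φ n := (by positivity : 0 ≤ ρ ^ j).trans hn
  rw [blockNorm, lilNorm, ← Real.sqrt_mul (by positivity)]
  apply Real.sqrt_le_sqrt
  calc min 1 (ρ ^ β) * η * (2 * (ρ ^ j) ^ β * Real.log j) =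
      2 * (min 1 (ρ ^ β) * (ρ ^ j) ^ β) * (η * Real.log j) := by ring
    _ ≤ 2 * φ n ^ β * Real.log (Real.log (φ n)) := by
        have := hlog _ hn
        gcongr

theorem tendsto_scale_hitTime (hφ : IsClock φ) (hρ : 1 < ρ) {β c : ℝ} {w : ℕ → ℝ}
    (hw : Tendsto (fun n => w n / φ n ^ β) atTop (𝓝 c)) :
    Tendsto (fun j => w (hitTime φ ρ j) / (ρ ^ j) ^ β) atTop (𝓝 c) := by
  have hlim := (hw.comp (hφ.tendsto_hitTime hρ)).mul
    ((hφ.tendsto_hitTime_div hρ).rpow_const (p := β) (Or.inl one_ne_zero))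
  rw [Real.one_rpow, mul_one] at hlim
  refine hlim.congr fun j => ?_
  have hp : 0 < ρ ^ j := by positivity
  have hφ₀ : 0 < φ (hitTime φ ρ j) := hp.trans_le (hφ.le_hitTime ρ j)
  rw [Function.comp, Real.div_rpow hφ₀.le hp.le]
  have : 0 < (ρ ^ j) ^ β := by positivity
  have : 0 < φ (hitTime φ ρ j) ^ β := by positivity
  field_simp

theorem tendsto_scale_hitTime_succ (hφ : IsClock φ) (hρ : 1 < ρ) {β c : ℝ} {w : ℕ → ℝ}
    (hw : Tendsto (fun n => w n / φ n ^ β) atTop (𝓝 c)) :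
    Tendsto (fun j => w (hitTime φ ρ (j + 1)) / (ρ ^ j) ^ β) atTop (𝓝 (c * ρ ^ β)) := by
  have hlim := ((hφ.tendsto_scale_hitTime hρ hw).comp (tendsto_add_atTop_nat 1)).mul_const (ρ ^ β)
  refine hlim.congr fun j => ?_
  have : 0 < (ρ ^ j) ^ β := by positivity
  have : 0 < ρ ^ β := by positivity
  rw [Function.comp, pow_succ, Real.mul_rpow (by positivity) (by positivity)]
  field_simp

end IsClock

/-! ### The law of the iterated logarithm: upper half -/

namespace IsClock

variable {φ : ℕ → ℝ} {ρ : ℝ}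

theorem eventually_le_lilNorm_of_blocks (hφ : IsClock φ) (hρ : 1 < ρ) {β η A A' L : ℝ}
    {y : ℕ → ℝ} (hη₀ : 0 ≤ η) (hη : η < 1) (hL₀ : 0 ≤ L)
    (hL : A + A' ≤ L * √(min 1 (ρ ^ β) * η))
    (hstart : ∀ᶠ j in atTop, y (hitTime φ ρ j) < A * blockNorm ρ β j)
    (hblock : ∀ᶠ j in atTop, ∀ l, hitTime φ ρ j ≤ l → l ≤ hitTime φ ρ (j + 1) →
      y l - y (hitTime φ ρ j) < A' * blockNorm ρ β j) :
    ∀ᶠ n in atTop, y n ≤ L * lilNorm φ β n := by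
  obtain ⟨J, hJ⟩ := eventually_atTop.1
    (hstart.and (hblock.and (eventually_blockNorm_le_lilNorm (φ := φ) hρ β hη₀ hη)))
  filter_upwards [hφ.tendsto.eventually_ge_atTop (ρ ^ J)] with n hn
  obtain ⟨j, hjn, hnj⟩ := exists_nat_pow_near ((one_le_pow₀ hρ.le).trans hn) hρ
  have hJj : J < j + 1 := (pow_lt_pow_iff_right₀ hρ).1 (hn.trans_lt hnj)
  obtain ⟨hyj, hyn, hnorm⟩ := hJ j (Nat.lt_succ_iff.1 hJj)
  have hinc := hyn n (hitTime_le hjn) (hφ.lt_hitTime hnj).le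
  have hg := blockNorm_nonneg ρ β j
  calc y n ≤ (A + A') * blockNorm ρ β j := by linarith
    _ ≤ L * √(min 1 (ρ ^ β) * η) * blockNorm ρ β j := by gcongr
    _ = L * (√(min 1 (ρ ^ β) * η) * blockNorm ρ β j) := mul_assoc _ _ _
    _ ≤ L * lilNorm φ β n := by gcongr; exact hnorm n hjn hnj

end IsClock

theorem exists_one_lt_rpow_near_one (β C : ℝ) {x r η : ℝ} (hx : 0 < x) (hr : r < η) :
    ∃ ρ : ℝ, 1 < ρ ∧ C * (ρ ^ β - 1) < x ∧ r < min 1 (ρ ^ β) * η := by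
  have hpow : Tendsto (fun ρ : ℝ => ρ ^ β) (𝓝[>] 1) (𝓝 1) := by
    have hcont := Real.continuousAt_rpow_const 1 β (Or.inl one_ne_zero)
    simpa [ContinuousAt] using hcont.tendsto.mono_left (nhdsWithin_le_nhds (s := Set.Ioi 1))
  have hC := (hpow.sub_const 1).const_mul C
  have hmin := ((tendsto_const_nhds (x := (1 : ℝ))).min hpow).mul_const η
  rw [sub_self, mul_zero] at hC
  rw [min_self, one_mul] at hmin
  exact (eventually_mem_nhdsWithin.and
    ((hC.eventually_lt_const hx).and (hmin.eventually_const_lt hr))).exists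

/-- The sum of the squared weights over the `j`-th geometric block of the clock `φ`. -/
noncomputable def blockVariance (a φ : ℕ → ℝ) (ρ : ℝ) (j : ℕ) : ℝ :=
  ∑ k ∈ Finset.Ico (hitTime φ ρ j) (hitTime φ ρ (j + 1)), a k ^ 2

/-- A process `Y` whose increments are, up to the sign `σ`, weighted sums of subgaussian
differences that are nearly of unit variance, with variance proxy `w n ∼ c φ(n)^β`.  It models
both a weighted sum (`β > 0`, `σ = 1`) and the remainder of a convergent one (`β < 0`,
`σ = -1`). -/
structure IsScaledProcess {Ω : Type*} {mΩ : MeasurableSpace Ω} (μ : Measure Ω)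
    (ℱ : Filtration ℕ mΩ) (d : ℕ → Ω → ℝ) (K : ℝ) (a : ℕ → ℝ) (Y : ℕ → Ω → ℝ) (w φ : ℕ → ℝ)
    (β c σ : ℝ) : Prop where
  diff : IsSubgaussianDifference μ ℱ d K
  defect_le : ∃ C s : ℝ, 0 < C ∧ 0 < s ∧ ∀ k : ℕ, 1 - Var[d k; μ] ≤ C * ((k : ℝ) + 1) ^ (-s)
  clock : IsClock φ
  sub_eq : ∀ N n, N ≤ n → ∀ ω, Y n ω - Y N ω = σ * weightedSum d a N n ω
  sign_eq : (0 < β ∧ σ = 1) ∨ (β < 0 ∧ σ = -1)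
  subgaussian : ∀ n, HasSubgaussianMGF (Y n) (w n).toNNReal μ
  variance_eq : ∀ N n, N ≤ n → ∑ k ∈ Finset.Ico N n, a k ^ 2 = σ * (w n - w N)
  weight_le : ∃ C : ℝ, 0 < C ∧ ∀ᶠ n in atTop, ∀ k, n ≤ k → a k ^ 2 ≤ C * φ n ^ (β - 1)
  scale_pos : 0 < c
  scale : Tendsto (fun n => w n / φ n ^ β) atTop (𝓝 c)

theorem weightedSum_neg {Ω : Type*} (d : ℕ → Ω → ℝ) (b : ℕ → ℝ) (N n : ℕ) (ω : Ω) :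
    weightedSum (-d) b N n ω = -weightedSum d b N n ω := by
  simp only [weightedSum, Pi.neg_apply, mul_neg, Finset.sum_neg_distrib]

theorem IsSubgaussianDifference.neg {Ω : Type*} {mΩ : MeasurableSpace Ω} {μ : Measure Ω}
    {ℱ : Filtration ℕ mΩ} {d : ℕ → Ω → ℝ} {K : ℝ} (h : IsSubgaussianDifference μ ℱ d K) :
    IsSubgaussianDifference μ ℱ (-d) K where
  measurable_succ k := (h.measurable_succ k).neg
  ae_abs_le k := by simpa using h.ae_abs_le k
  condExp_eq_zero k := by
    filter_upwards [condExp_neg (d k) (ℱ k) (μ := μ), h.condExp_eq_zero k] with ω hneg hzero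
    simp [hneg, hzero]
  condExp_exp_le k θ := by simpa using h.condExp_exp_le k (-θ)

namespace IsScaledProcess

variable {Ω : Type*} {mΩ : MeasurableSpace Ω} {μ : Measure Ω} {ℱ : Filtration ℕ mΩ}
  {d : ℕ → Ω → ℝ} {K : ℝ} {a : ℕ → ℝ} {Y : ℕ → Ω → ℝ} {w φ : ℕ → ℝ} {β c σ ρ : ℝ}

theorem neg (h : IsScaledProcess μ ℱ d K a Y w φ β c σ) :
    IsScaledProcess μ ℱ (-d) K a (-Y) w φ β c σ where
  diff := h.diff.neg
  defect_le := by simpa only [Pi.neg_apply, variance_neg] using h.defect_le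
  clock := h.clock
  sub_eq N n hn ω := by
    rw [weightedSum_neg, mul_neg, ← h.sub_eq N n hn ω, Pi.neg_apply, Pi.neg_apply, Pi.neg_apply,
      Pi.neg_apply]
    ring
  sign_eq := h.sign_eq
  subgaussian n := (h.subgaussian n).neg
  variance_eq := h.variance_eq
  weight_le := h.weight_le
  scale_pos := h.scale_pos
  scale := h.scale

theorem sign_mul_pos (h : IsScaledProcess μ ℱ d K a Y w φ β c σ) (hρ : 1 < ρ) :
    0 < σ * (ρ ^ β - 1) := by
  rcases h.sign_eq with ⟨hβ, rfl⟩ | ⟨hβ, rfl⟩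
  · linarith [Real.one_lt_rpow hρ hβ]
  · linarith [Real.rpow_lt_one_of_one_lt_of_neg hρ hβ]

theorem mul_sign_mul_pos (h : IsScaledProcess μ ℱ d K a Y w φ β c σ) (hρ : 1 < ρ) :
    0 < c * (σ * (ρ ^ β - 1)) := mul_pos h.scale_pos (h.sign_mul_pos hρ)

theorem hitTime_le_succ (h : IsScaledProcess μ ℱ d K a Y w φ β c σ) (hρ : 1 < ρ) (j : ℕ) :
    hitTime φ ρ j ≤ hitTime φ ρ (j + 1) := h.clock.monotone_hitTime hρ.le j.le_succ

theorem tendsto_blockVariance_div (h : IsScaledProcess μ ℱ d K a Y w φ β c σ) (hρ : 1 < ρ) :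
    Tendsto (fun j => blockVariance a φ ρ j / (ρ ^ j) ^ β) atTop
      (𝓝 (c * (σ * (ρ ^ β - 1)))) := by
  have hlim := ((h.clock.tendsto_scale_hitTime_succ hρ h.scale).sub
    (h.clock.tendsto_scale_hitTime hρ h.scale)).const_mul σ
  rw [show c * (σ * (ρ ^ β - 1)) = σ * (c * ρ ^ β - c) by ring]
  refine hlim.congr fun j => ?_
  rw [blockVariance, h.variance_eq _ _ (h.hitTime_le_succ hρ j)]
  ring

theorem ae_eventually_lt_blockNorm [IsFiniteMeasure μ]
    (h : IsScaledProcess μ ℱ d K a Y w φ β c σ) (hρ : 1 < ρ) {A : ℝ} (hA : 0 ≤ A)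
    (hAc : c < A ^ 2) :
    ∀ᵐ ω ∂μ, ∀ᶠ j in atTop, Y (hitTime φ ρ j) ω < A * blockNorm ρ β j := by
  obtain ⟨D, hcD, hDA⟩ := exists_between hAc
  have hw := h.clock.tendsto_scale_hitTime hρ h.scale
  have hev : ∀ᶠ j in atTop, μ.real {ω | A * blockNorm ρ β j ≤ Y (hitTime φ ρ j) ω} ≤
      Real.exp (-((A * blockNorm ρ β j) ^ 2 / (2 * (D * (ρ ^ j) ^ β)))) := by
    filter_upwards [hw.eventually_lt_const hcD, hw.eventually_const_lt h.scale_pos]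
      with j hwD hw₀
    have hp : 0 < (ρ ^ j) ^ β := by positivity
    have hwpos : 0 < w (hitTime φ ρ j) := (div_pos_iff_of_pos_right hp).1 hw₀
    have hwle : w (hitTime φ ρ j) ≤ D * (ρ ^ j) ^ β := ((div_lt_iff₀ hp).1 hwD).le
    refine ((h.subgaussian _).measure_ge_le (mul_nonneg hA (blockNorm_nonneg ρ β j))).trans
      (Real.exp_le_exp.2 ?_)
    rw [Real.coe_toNNReal _ hwpos.le, neg_div]
    gcongr
  filter_upwards [ae_eventually_notMem_of_summable
    (summable_exp_neg_blockNorm (by positivity) β (h.scale_pos.trans hcD) hDA) hev] with ω hω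
  filter_upwards [hω] with j hj
  simpa using hj

variable [IsProbabilityMeasure μ]

theorem ae_eventually_weightedSum_lt_blockNorm (h : IsScaledProcess μ ℱ d K a Y w φ β c σ)
    (hρ : 1 < ρ) {A : ℝ} (hA : 0 ≤ A) (hAc : c * (σ * (ρ ^ β - 1)) < A ^ 2) :
    ∀ᵐ ω ∂μ, ∀ᶠ j in atTop, ∀ l ≤ hitTime φ ρ (j + 1),
      weightedSum d a (hitTime φ ρ j) l ω < A * blockNorm ρ β j := by
  obtain ⟨D, hcD, hDA⟩ := exists_between hAc
  have hD : 0 < D := (h.mul_sign_mul_pos hρ).trans hcD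
  have hev : ∀ᶠ j in atTop, μ.real {ω | ∃ l ≤ hitTime φ ρ (j + 1),
      A * blockNorm ρ β j ≤ weightedSum d a (hitTime φ ρ j) l ω} ≤
      Real.exp (-((A * blockNorm ρ β j) ^ 2 / (2 * (D * (ρ ^ j) ^ β)))) := by
    filter_upwards [(h.tendsto_blockVariance_div hρ).eventually_lt_const hcD] with j hj
    have hp : 0 < (ρ ^ j) ^ β := by positivity
    exact h.diff.measure_exists_le_weightedSum_le_exp a (h.hitTime_le_succ hρ j)
      (mul_nonneg hA (blockNorm_nonneg ρ β j)) (by positivity) ((div_lt_iff₀ hp).1 hj).le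
  filter_upwards [ae_eventually_notMem_of_summable
    (summable_exp_neg_blockNorm (by positivity) β hD hDA) hev] with ω hω
  filter_upwards [hω] with j hj
  simpa using hj

theorem ae_eventually_sub_lt_blockNorm (h : IsScaledProcess μ ℱ d K a Y w φ β c σ)
    (hρ : 1 < ρ) {A : ℝ} (hA : 0 ≤ A) (hAc : c * (σ * (ρ ^ β - 1)) < A ^ 2) :
    ∀ᵐ ω ∂μ, ∀ᶠ j in atTop, ∀ l, hitTime φ ρ j ≤ l → l ≤ hitTime φ ρ (j + 1) →
      Y l ω - Y (hitTime φ ρ j) ω < A * blockNorm ρ β j := by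
  rcases h.sign_eq with ⟨-, rfl⟩ | ⟨-, rfl⟩
  · filter_upwards [h.ae_eventually_weightedSum_lt_blockNorm hρ hA hAc] with ω hω
    filter_upwards [hω] with j hj l hjl hlj
    rw [h.sub_eq _ _ hjl, one_mul]
    exact hj l hlj
  · filter_upwards [h.neg.ae_eventually_weightedSum_lt_blockNorm hρ hA hAc] with ω hω
    filter_upwards [hω] with j hj l hjl hlj
    rw [h.sub_eq _ _ hjl, neg_one_mul, ← weightedSum_neg]
    exact hj l hlj

theorem ae_eventually_le_lilNorm (h : IsScaledProcess μ ℱ d K a Y w φ β c σ) {ε : ℝ}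
    (hε : 0 < ε) : ∀ᵐ ω ∂μ, ∀ᶠ n in atTop, Y n ω ≤ (√c + ε) * lilNorm φ β n := by
  have hc := Real.sqrt_pos.2 h.scale_pos
  set r := (√c + ε / 2) / (√c + ε) with hr
  have hr₀ : 0 ≤ r := by positivity
  have hr₁ : r < 1 := (div_lt_one (by positivity)).2 (by linarith)
  obtain ⟨η, hrη, hη⟩ := exists_between ((sq_lt_one_iff₀ hr₀).2 hr₁)
  obtain ⟨ρ, hρ, hρε, hρη⟩ := exists_one_lt_rpow_near_one β (c * σ)
    (show 0 < (ε / 4) ^ 2 by positivity) hrη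
  have hA : c < (√c + ε / 4) ^ 2 := by nlinarith [Real.sq_sqrt h.scale_pos.le]
  filter_upwards [h.ae_eventually_lt_blockNorm hρ (by positivity) hA,
    h.ae_eventually_sub_lt_blockNorm hρ (A := ε / 4) (by positivity) (by rwa [← mul_assoc])]
    with ω hstart hblock
  refine h.clock.eventually_le_lilNorm_of_blocks hρ ((sq_nonneg r).trans hrη.le) hη
    (by positivity) ?_ hstart hblock
  calc √c + ε / 4 + ε / 4 = (√c + ε) * r := by rw [hr]; field_simp; ring
    _ ≤ (√c + ε) * √(min 1 (ρ ^ β) * η) := by gcongr; exact Real.le_sqrt_of_sq_le hρη.le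

end IsScaledProcess

/-! ### The law of the iterated logarithm: lower half -/

/-- The level `2 log j / (1 + 2δ)` to which the block sums are tilted: the tilted event then has
probability of order `1 / j`. -/
noncomputable def blockLevel (δ : ℝ) (j : ℕ) : ℝ := 2 / (1 + 2 * δ) * Real.log j

/-- The tilt that gives the weights of the `j`-th block total variance `blockLevel δ j`. -/
noncomputable def blockTilt (a φ : ℕ → ℝ) (ρ δ : ℝ) (j : ℕ) : ℝ :=
  √(blockLevel δ j / blockVariance a φ ρ j)

section BlockLevel

variable {δ : ℝ}

theorem blockLevel_nonneg (hδ : 0 ≤ δ) (j : ℕ) : 0 ≤ blockLevel δ j := by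
  have := Real.log_natCast_nonneg j
  rw [blockLevel]
  positivity

theorem blockLevel_le_two_mul_log (hδ : 0 ≤ δ) (j : ℕ) :
    blockLevel δ j ≤ 2 * Real.log j := by
  have := Real.log_natCast_nonneg j
  rw [blockLevel]
  gcongr
  exact div_le_self zero_le_two (by linarith)

theorem blockLevel_le_two_mul (hδ : 0 ≤ δ) (j : ℕ) : blockLevel δ j ≤ 2 * j :=
  (blockLevel_le_two_mul_log hδ j).trans (by gcongr; exact Real.log_le_self j.cast_nonneg)

theorem tendsto_blockLevel (hδ : 0 ≤ δ) : Tendsto (blockLevel δ) atTop atTop :=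
  tendsto_log_natCast_atTop.const_mul_atTop (by positivity)

theorem exp_neg_mul_blockLevel (hδ : 0 ≤ δ) {j : ℕ} (hj : 0 < j) :
    Real.exp (-((1 / 2 + δ) * blockLevel δ j)) = 1 / (j : ℝ) := by
  have hlog : (1 / 2 + δ) * blockLevel δ j = Real.log j := by
    rw [blockLevel]
    field_simp
  rw [hlog, Real.exp_neg, Real.exp_log (by positivity), one_div]

theorem exp_two_mul_blockLevel_le (hδ : 0 ≤ δ) {j : ℕ} (hj : 0 < j) :
    Real.exp (2 * blockLevel δ j) ≤ (j : ℝ) ^ 4 := by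
  rw [← Real.exp_log (show (0 : ℝ) < j by positivity), ← Real.exp_nat_mul, Real.exp_le_exp]
  push_cast
  linarith [blockLevel_le_two_mul_log hδ j]

theorem eventually_exp_neg_blockLevel_le (hδ : 0 < δ) :
    ∀ᶠ j in atTop, 2 * Real.exp (-(blockLevel δ j * δ ^ 2 / 2)) ≤ 1 / 4 := by
  have hlim := (Real.tendsto_exp_neg_atTop_nhds_zero.comp
    (((tendsto_blockLevel hδ.le).atTop_mul_const (pow_pos hδ 2)).atTop_div_const
      two_pos)).const_mul 2
  rw [mul_zero] at hlim
  exact hlim.eventually_le_const (by norm_num)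

theorem exists_lt_one_sub_sq_div_mul {x y : ℝ} (hxy : x < y) :
    ∃ δ : ℝ, 0 < δ ∧ δ < 1 ∧ x < (1 - δ) ^ 2 / (1 + 2 * δ) * y := by
  have hcont : ContinuousAt (fun δ : ℝ => (1 - δ) ^ 2 / (1 + 2 * δ) * y) 0 :=
    ContinuousAt.mul (ContinuousAt.div₀ (by fun_prop) (by fun_prop) (by norm_num))
      continuousAt_const
  have hlim := hcont.tendsto.mono_left (nhdsWithin_le_nhds (s := Set.Ioi 0))
  norm_num at hlim
  have hlt_one : ∀ᶠ δ : ℝ in 𝓝[>] 0, δ < 1 := nhdsWithin_le_nhds (eventually_lt_nhds one_pos)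
  exact (eventually_mem_nhdsWithin.and (hlt_one.and (hlim.eventually_const_lt hxy))).exists

end BlockLevel

theorem sum_blockTilt_mul_sq (a φ : ℕ → ℝ) (ρ δ : ℝ) (j : ℕ) :
    ∑ k ∈ Finset.Ico (hitTime φ ρ j) (hitTime φ ρ (j + 1)), (blockTilt a φ ρ δ j * a k) ^ 2 =
      blockTilt a φ ρ δ j ^ 2 * blockVariance a φ ρ j := by
  simp only [mul_pow, ← Finset.mul_sum, blockVariance]

theorem sum_abs_cube_le {ι : Type*} {s : Finset ι} {b : ι → ℝ} {t : ℝ}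
    (hb : ∀ k ∈ s, |b k| ≤ t) : ∑ k ∈ s, |b k| ^ 3 ≤ t * ∑ k ∈ s, b k ^ 2 := by
  rw [Finset.mul_sum]
  refine Finset.sum_le_sum fun k hk => ?_
  rw [pow_succ', sq_abs]
  exact mul_le_mul_of_nonneg_right (hb k hk) (sq_nonneg _)

theorem tendsto_sum_range_one_div_two_mul_atTop :
    Tendsto (fun n => ∑ j ∈ Finset.range n, 1 / (2 * (j : ℝ))) atTop atTop := by
  have hlim := Real.tendsto_sum_range_one_div_nat_succ_atTop.const_mul_atTop
    (one_half_pos (α := ℝ))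
  refine (tendsto_add_atTop_iff_nat 1).1 (hlim.congr fun n => ?_)
  rw [Finset.sum_range_succ', Finset.mul_sum, Nat.cast_zero, mul_zero, div_zero, add_zero]
  refine Finset.sum_congr rfl fun i _ => ?_
  push_cast
  field_simp

theorem IsClock.eventually_rpow_hitTime_lt {φ : ℕ → ℝ} (hφ : IsClock φ) {ρ : ℝ} (hρ : 1 < ρ)
    (β : ℝ) : ∀ᶠ j in atTop, φ (hitTime φ ρ j) ^ β < 2 * (ρ ^ j) ^ β := by
  have hlim := (hφ.tendsto_hitTime_div hρ).rpow_const (p := β) (Or.inl one_ne_zero)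
  rw [Real.one_rpow] at hlim
  filter_upwards [hlim.eventually_lt_const one_lt_two] with j hj
  have hp : 0 < ρ ^ j := by positivity
  rw [Real.div_rpow (hp.le.trans (hφ.le_hitTime ρ j)) hp.le] at hj
  exact (div_lt_iff₀ (by positivity)).1 hj

namespace IsScaledProcess

variable {Ω : Type*} {mΩ : MeasurableSpace Ω} {μ : Measure Ω} {ℱ : Filtration ℕ mΩ}
  {d : ℕ → Ω → ℝ} {K : ℝ} {a : ℕ → ℝ} {Y : ℕ → Ω → ℝ} {w φ : ℕ → ℝ} {β c σ ρ δ : ℝ}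

theorem eventually_blockVariance_pos (h : IsScaledProcess μ ℱ d K a Y w φ β c σ) (hρ : 1 < ρ) :
    ∀ᶠ j in atTop, 0 < blockVariance a φ ρ j := by
  filter_upwards [(h.tendsto_blockVariance_div hρ).eventually_const_lt (h.mul_sign_mul_pos hρ)]
    with j hj
  exact (div_pos_iff_of_pos_right (by positivity)).1 hj

theorem eventually_blockTilt_sq_mul (h : IsScaledProcess μ ℱ d K a Y w φ β c σ) (hρ : 1 < ρ)
    (hδ : 0 ≤ δ) :
    ∀ᶠ j in atTop, blockTilt a φ ρ δ j ^ 2 * blockVariance a φ ρ j = blockLevel δ j := by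
  filter_upwards [h.eventually_blockVariance_pos hρ] with j hj
  rw [blockTilt, Real.sq_sqrt (div_nonneg (blockLevel_nonneg hδ j) hj.le)]
  field_simp

theorem exists_eventually_blockTilt_mul_sq_le (h : IsScaledProcess μ ℱ d K a Y w φ β c σ)
    (hρ : 1 < ρ) (hδ : 0 ≤ δ) :
    ∃ C : ℝ, ∀ᶠ j in atTop, ∀ k, hitTime φ ρ j ≤ k →
      (blockTilt a φ ρ δ j * a k) ^ 2 ≤ C * (j / ρ ^ j) := by
  obtain ⟨C, hC, hCa⟩ := h.weight_le
  have hv := h.mul_sign_mul_pos hρ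
  set v := c * (σ * (ρ ^ β - 1))
  refine ⟨8 * C / v, ?_⟩
  filter_upwards [(h.tendsto_blockVariance_div hρ).eventually_const_lt (half_lt_self hv),
    h.eventually_blockVariance_pos hρ, (h.clock.tendsto_hitTime hρ).eventually hCa,
    h.clock.eventually_rpow_hitTime_lt hρ β] with j hVj hV hweight hφβ k hk
  have hp : 0 < ρ ^ j := by positivity
  have hpβ : 0 < (ρ ^ j) ^ β := by positivity
  have hφ := h.clock.le_hitTime ρ j
  have hVle : v / 2 * (ρ ^ j) ^ β ≤ blockVariance a φ ρ j := ((lt_div_iff₀ hpβ).1 hVj).le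
  have hak : a k ^ 2 ≤ C * (2 * (ρ ^ j) ^ β / ρ ^ j) := by
    refine (hweight k hk).trans ?_
    rw [Real.rpow_sub_one (hp.trans_le hφ).ne']
    gcongr
  calc (blockTilt a φ ρ δ j * a k) ^ 2 = blockLevel δ j / blockVariance a φ ρ j * a k ^ 2 := by
        rw [mul_pow, blockTilt, Real.sq_sqrt (div_nonneg (blockLevel_nonneg hδ j) hV.le)]
    _ ≤ 2 * j / (v / 2 * (ρ ^ j) ^ β) * (C * (2 * (ρ ^ j) ^ β / ρ ^ j)) := by
        gcongr
        exact blockLevel_le_two_mul hδ j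
    _ = 8 * C / v * (j / ρ ^ j) := by field_simp; ring

theorem eventually_abs_blockTilt_mul_mul_le (h : IsScaledProcess μ ℱ d K a Y w φ β c σ)
    (hρ : 1 < ρ) (hδ : 0 ≤ δ) {ε : ℝ} (hε : 0 < ε) :
    ∀ᶠ j : ℕ in atTop, ∀ k, hitTime φ ρ j ≤ k → |blockTilt a φ ρ δ j * a k| * j ≤ ε := by
  obtain ⟨C, hC⟩ := h.exists_eventually_blockTilt_mul_sq_le hρ hδ
  have hlim := (tendsto_pow_div_pow_atTop_zero 3 hρ).const_mul C
  rw [mul_zero] at hlim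
  filter_upwards [hC, hlim.eventually_lt_const (show 0 < ε ^ 2 by positivity)]
    with j hsq hsmall k hk
  refine le_of_sq_le_sq ?_ hε.le
  calc (|blockTilt a φ ρ δ j * a k| * j) ^ 2 = (blockTilt a φ ρ δ j * a k) ^ 2 * j ^ 2 := by
        rw [mul_pow, sq_abs]
    _ ≤ C * (j / ρ ^ j) * j ^ 2 := by gcongr; exact hsq k hk
    _ = C * ((j : ℝ) ^ 3 / ρ ^ j) := by ring
    _ ≤ ε ^ 2 := hsmall.le

theorem eventually_abs_blockTilt_mul_le_one (h : IsScaledProcess μ ℱ d K a Y w φ β c σ)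
    (hρ : 1 < ρ) (hδ : 0 ≤ δ) :
    ∀ᶠ j in atTop, ∀ k, hitTime φ ρ j ≤ k → |blockTilt a φ ρ δ j * a k| ≤ 1 := by
  filter_upwards [h.eventually_abs_blockTilt_mul_mul_le hρ hδ one_pos, eventually_ge_atTop 1]
    with j hsmall hj k hk
  exact (le_mul_of_one_le_right (abs_nonneg _) (by exact_mod_cast hj)).trans (hsmall k hk)

theorem eventually_mul_sum_abs_blockTilt_mul_cube_le
    (h : IsScaledProcess μ ℱ d K a Y w φ β c σ) (hρ : 1 < ρ) (hδ : 0 ≤ δ) {T : ℝ} (hT : 0 < T) :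
    ∀ᶠ j in atTop, T * ∑ k ∈ Finset.Ico (hitTime φ ρ j) (hitTime φ ρ (j + 1)),
      |blockTilt a φ ρ δ j * a k| ^ 3 ≤ 1 / 4 := by
  filter_upwards [h.eventually_abs_blockTilt_mul_mul_le hρ hδ (show 0 < 1 / (8 * T) by positivity),
    h.eventually_blockTilt_sq_mul hρ hδ, eventually_gt_atTop 0] with j hsmall hlevel hj
  have hb : ∀ k ∈ Finset.Ico (hitTime φ ρ j) (hitTime φ ρ (j + 1)),
      |blockTilt a φ ρ δ j * a k| ≤ 1 / (8 * T) / j := fun k hk =>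
    (le_div_iff₀ (by positivity)).2 (hsmall k (Finset.mem_Ico.1 hk).1)
  have hcube := sum_abs_cube_le hb
  rw [sum_blockTilt_mul_sq, hlevel] at hcube
  calc _ ≤ T * (1 / (8 * T) / j * (2 * j)) := by
        gcongr
        exact hcube.trans (by gcongr; exact blockLevel_le_two_mul hδ j)
    _ = 1 / 4 := by field_simp; norm_num

theorem exists_defect_le_sq_mul_pow (h : IsScaledProcess μ ℱ d K a Y w φ β c σ) (hρ : 1 < ρ) :
    ∃ C q : ℝ, 0 < C ∧ 0 < q ∧ q < 1 ∧
      ∀ j k, hitTime φ ρ j ≤ k → 1 - Var[d k; μ] ≤ (C * q ^ j) ^ 2 := by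
  obtain ⟨C, s, hC, hs, hdef⟩ := h.defect_le
  have hρ₀ : 0 < ρ := by positivity
  refine ⟨√C, ρ ^ (-(s / 2)), Real.sqrt_pos.2 hC, by positivity,
    Real.rpow_lt_one_of_one_lt_of_neg hρ (by linarith), fun j k hk => (hdef k).trans ?_⟩
  have hpow : (√C * (ρ ^ (-(s / 2))) ^ j) ^ 2 = C * (ρ ^ j) ^ (-s) := by
    rw [mul_pow, Real.sq_sqrt hC.le, ← pow_mul, mul_comm j 2, pow_mul,
      ← Real.rpow_mul_natCast hρ₀.le, Real.rpow_pow_comm hρ₀.le]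
    norm_num
  have hk' : (hitTime φ ρ j : ℝ) ≤ k := by exact_mod_cast hk
  rw [hpow]
  refine mul_le_mul_of_nonneg_left (Real.rpow_le_rpow_of_nonpos (by positivity) ?_
    (by linarith)) hC.le
  linarith [h.clock.pow_le_natCast_hitTime ρ j]

theorem eventually_mul_blockNorm_le (h : IsScaledProcess μ ℱ d K a Y w φ β c σ) (hρ : 1 < ρ)
    (hδ₀ : 0 ≤ δ) (hδ₁ : δ ≤ 1) {D : ℝ}
    (hD : D ^ 2 < (1 - δ) ^ 2 / (1 + 2 * δ) * (c * (σ * (ρ ^ β - 1)))) :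
    ∀ᶠ j in atTop,
      D * blockNorm ρ β j ≤ (1 - δ) * (blockTilt a φ ρ δ j * blockVariance a φ ρ j) := by
  filter_upwards [h.eventually_blockTilt_sq_mul hρ hδ₀, h.eventually_blockVariance_pos hρ,
    ((h.tendsto_blockVariance_div hρ).const_mul _).eventually_const_lt hD] with j hlevel hV hDj
  have hp : 0 < (ρ ^ j) ^ β := by positivity
  have hlog := Real.log_natCast_nonneg j
  rw [← mul_div_assoc, lt_div_iff₀ hp] at hDj
  have ht : 0 ≤ blockTilt a φ ρ δ j := Real.sqrt_nonneg _
  have := sub_nonneg.2 hδ₁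
  refine le_of_sq_le_sq ?_ (by positivity)
  calc (D * blockNorm ρ β j) ^ 2 = 2 * Real.log j * (D ^ 2 * (ρ ^ j) ^ β) := by
        rw [mul_pow, blockNorm_sq (by positivity)]
        ring
    _ ≤ 2 * Real.log j * ((1 - δ) ^ 2 / (1 + 2 * δ) * blockVariance a φ ρ j) := by gcongr
    _ = (1 - δ) ^ 2 * (blockLevel δ j * blockVariance a φ ρ j) := by rw [blockLevel]; ring
    _ = ((1 - δ) * (blockTilt a φ ρ δ j * blockVariance a φ ρ j)) ^ 2 := by rw [← hlevel]; ring

variable [IsProbabilityMeasure μ]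

theorem eventually_le_measureReal_inter (h : IsScaledProcess μ ℱ d K a Y w φ β c σ) (hρ : 1 < ρ)
    (hδ : 0 < δ) :
    ∃ C q : ℝ, 0 < q ∧ q < 1 ∧ ∀ᶠ j : ℕ in atTop, ∀ B, MeasurableSet[ℱ (hitTime φ ρ j)] B →
      1 / (2 * (j : ℝ)) * μ.real B - C * ((j : ℝ) ^ 5 * q ^ j) ≤
        μ.real (B ∩ {ω | (1 - δ) * blockLevel δ j ≤ blockTilt a φ ρ δ j *
          weightedSum d a (hitTime φ ρ j) (hitTime φ ρ (j + 1)) ω}) := by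
  obtain ⟨C, q, hC, hq₀, hq₁, hdef⟩ := h.exists_defect_le_sq_mul_pow hρ
  refine ⟨2 * C, q, hq₀, hq₁, ?_⟩
  filter_upwards [h.eventually_blockTilt_sq_mul hρ hδ.le,
    h.eventually_abs_blockTilt_mul_le_one hρ hδ.le,
    h.eventually_mul_sum_abs_blockTilt_mul_cube_le hρ hδ.le (taylorConst_pos h.diff.bound_nonneg),
    eventually_exp_neg_blockLevel_le hδ, eventually_gt_atTop 0]
    with j hlevel hle_one hcube hexp hj B hB
  have := blockLevel_nonneg hδ.le j
  have key := h.diff.le_measureReal_inter_le_weightedSum (fun k => blockTilt a φ ρ δ j * a k)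
    (h.hitTime_le_succ hρ j) (fun k hk => hle_one k (Finset.mem_Ico.1 hk).1) (by positivity)
    (fun k hk => hdef j k (Finset.mem_Ico.1 hk).1)
    ((sum_blockTilt_mul_sq a φ ρ δ j).trans hlevel) hδ.le hcube hexp hB
  simp_rw [weightedSum_const_mul] at key
  rw [exp_neg_mul_blockLevel hδ.le hj] at key
  have herr : blockLevel δ j * (C * q ^ j * Real.exp (2 * blockLevel δ j)) ≤
      2 * C * ((j : ℝ) ^ 5 * q ^ j) := by
    calc _ ≤ 2 * j * (C * q ^ j * (j : ℝ) ^ 4) := by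
          gcongr
          exacts [blockLevel_le_two_mul hδ.le j, exp_two_mul_blockLevel_le hδ.le hj]
      _ = _ := by ring
  calc _ = 1 / (j : ℝ) / 2 * μ.real B - 2 * C * ((j : ℝ) ^ 5 * q ^ j) := by
        rw [div_div, mul_comm (j : ℝ) 2]
    _ ≤ _ := (sub_le_sub_left herr _).trans key

theorem ae_frequently_blockLevel_le (h : IsScaledProcess μ ℱ d K a Y w φ β c σ) (hρ : 1 < ρ)
    (hδ : 0 < δ) :
    ∀ᵐ ω ∂μ, ∃ᶠ j in atTop, (1 - δ) * blockLevel δ j ≤ blockTilt a φ ρ δ j *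
      weightedSum d a (hitTime φ ρ j) (hitTime φ ρ (j + 1)) ω := by
  obtain ⟨C, q, hq₀, hq₁, hle⟩ := h.eventually_le_measureReal_inter hρ hδ
  let 𝒢 : Filtration ℕ mΩ := ⟨fun j => ℱ (hitTime φ ρ j),
    fun i j hij => ℱ.mono (h.clock.monotone_hitTime hρ.le hij), fun j => ℱ.le _⟩
  have hsum : Summable fun j : ℕ => C * ((j : ℝ) ^ 5 * q ^ j) :=
    (summable_pow_mul_geometric_of_norm_lt_one 5 (by rwa [Real.norm_of_nonneg hq₀.le])).mul_left C
  exact ae_frequently_of_le_measureReal_inter (ℱ := 𝒢)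
    (A := fun j => {ω | (1 - δ) * blockLevel δ j ≤ blockTilt a φ ρ δ j *
      weightedSum d a (hitTime φ ρ j) (hitTime φ ρ (j + 1)) ω})
    (fun j => ((h.diff.measurable_weightedSum_adapted a (hitTime φ ρ j)
      (hitTime φ ρ (j + 1))).const_mul _) measurableSet_Ici)
    tendsto_sum_range_one_div_two_mul_atTop hsum hle

theorem ae_frequently_blockNorm_le_weightedSum (h : IsScaledProcess μ ℱ d K a Y w φ β c σ)
    (hρ : 1 < ρ) {D : ℝ} (hDc : D ^ 2 < c * (σ * (ρ ^ β - 1))) :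
    ∀ᵐ ω ∂μ, ∃ᶠ j in atTop, D * blockNorm ρ β j ≤
      weightedSum d a (hitTime φ ρ j) (hitTime φ ρ (j + 1)) ω := by
  obtain ⟨δ, hδ₀, hδ₁, hδ⟩ := exists_lt_one_sub_sq_div_mul hDc
  filter_upwards [h.ae_frequently_blockLevel_le hρ hδ₀] with ω hω
  refine (hω.and_eventually ((h.eventually_mul_blockNorm_le hρ hδ₀.le hδ₁.le hδ).and
    ((h.eventually_blockTilt_sq_mul hρ hδ₀.le).and ((h.eventually_blockVariance_pos hρ).and
    ((tendsto_blockLevel hδ₀.le).eventually_gt_atTop 0))))).mono ?_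
  rintro j ⟨hj, hnorm, hlevel, hV, hX⟩
  have ht : 0 < blockTilt a φ ρ δ j := Real.sqrt_pos.2 (by positivity)
  refine hnorm.trans (le_of_mul_le_mul_left ?_ ht)
  calc _ = (1 - δ) * (blockTilt a φ ρ δ j ^ 2 * blockVariance a φ ρ j) := by ring
    _ ≤ _ := by rwa [hlevel]

end IsScaledProcess

/-! ### The limit superior -/

theorem IsClock.eventually_lilNorm_pos {φ : ℕ → ℝ} (hφ : IsClock φ) (β : ℝ) :
    ∀ᶠ n in atTop, 0 < lilNorm φ β n := by
  filter_upwards [(Real.tendsto_log_atTop.comp (Real.tendsto_log_atTop.comp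
    hφ.tendsto)).eventually_gt_atTop 0, hφ.tendsto.eventually_gt_atTop 0] with n hlog hn
  rw [Function.comp_apply, Function.comp_apply] at hlog
  exact Real.sqrt_pos.2 (by positivity)

theorem IsClock.frequently_lilNorm_le_of_blocks {φ : ℕ → ℝ} (hφ : IsClock φ) {ρ : ℝ}
    (hρ : 1 < ρ) {β : ℝ} {y : ℕ → ℝ} {e o : ℕ → ℕ} (he : Tendsto e atTop atTop)
    (ho : Tendsto o atTop atTop) {B D r l : ℝ}
    (hy : ∀ᶠ n in atTop, -y n ≤ B * lilNorm φ β n)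
    (hr : Tendsto (fun j => blockNorm ρ β (o j) / blockNorm ρ β (e j)) atTop (𝓝 r))
    (hD : ∃ᶠ j in atTop, D * blockNorm ρ β (e j) ≤
      y (hitTime φ ρ (e j)) - y (hitTime φ ρ (o j))) (hl : l < D - B * r) :
    ∃ᶠ n in atTop, l * lilNorm φ β n ≤ y n := by
  have hρ₀ : 0 < ρ := by positivity
  have hnorm_e : Tendsto (fun j => lilNorm φ β (hitTime φ ρ (e j)) / blockNorm ρ β (e j)) atTop
      (𝓝 1) := (hφ.tendsto_lilNorm_hitTime_div hρ β).comp he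
  have hnorm_o : Tendsto (fun j => lilNorm φ β (hitTime φ ρ (o j)) / blockNorm ρ β (e j)) atTop
      (𝓝 r) := by
    have hmul := ((hφ.tendsto_lilNorm_hitTime_div hρ β).comp ho).mul hr
    rw [one_mul] at hmul
    refine hmul.congr' ?_
    filter_upwards [ho.eventually (eventually_blockNorm_pos hρ₀ β)] with j hj
    rw [Function.comp_apply]
    field_simp
  have hlim := ((hnorm_o.const_mul B).const_sub D).sub (hnorm_e.const_mul l)
  refine ((hφ.tendsto_hitTime hρ).comp he).frequently ((hD.and_eventually
    ((hlim.eventually_const_lt (show 0 < D - B * r - l * 1 by linarith)).and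
    ((he.eventually (eventually_blockNorm_pos hρ₀ β)).and
    (((hφ.tendsto_hitTime hρ).comp ho).eventually hy)))).mono ?_)
  rintro j ⟨hDj, hgap, hpos, hyj⟩
  have hexpand : (D - B * (lilNorm φ β (hitTime φ ρ (o j)) / blockNorm ρ β (e j)) -
      l * (lilNorm φ β (hitTime φ ρ (e j)) / blockNorm ρ β (e j))) * blockNorm ρ β (e j) =
      D * blockNorm ρ β (e j) - B * lilNorm φ β (hitTime φ ρ (o j)) -
      l * lilNorm φ β (hitTime φ ρ (e j)) := by field_simp
  have hgap' := hexpand ▸ mul_pos hgap hpos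
  rw [Function.comp_apply] at hyj ⊢
  linarith

theorem exists_one_lt_of_lt_sqrt {β c ε : ℝ} (hβ : 0 < β) (hε : 0 < ε) (hεc : ε < √c) :
    ∃ ρ : ℝ, 1 < ρ ∧ (√c - ε / 2) ^ 2 < c * (1 - ρ ^ (-β)) ∧
      √c - ε < √c - ε / 2 - 2 * √c * √(ρ ^ (-β)) := by
  have hc : 0 < c := Real.sqrt_pos.1 (hε.trans hεc)
  have hpow := tendsto_rpow_neg_atTop hβ
  have hvar := (hpow.const_sub 1).const_mul c
  have hnorm := (hpow.sqrt.const_mul (2 * √c)).const_sub (√c - ε / 2)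
  rw [sub_zero, mul_one] at hvar
  rw [Real.sqrt_zero, mul_zero, sub_zero] at hnorm
  exact ((eventually_gt_atTop 1).and ((hvar.eventually_const_lt
    (by nlinarith [Real.sq_sqrt hc.le])).and (hnorm.eventually_const_lt (by linarith)))).exists

theorem limsup_div_eq {y ψ : ℕ → ℝ} {c : ℝ} (hψ : ∀ᶠ n in atTop, 0 < ψ n)
    (hle : ∀ k : ℕ, ∀ᶠ n in atTop, y n ≤ (c + 1 / ((k : ℝ) + 1)) * ψ n)
    (hge : ∀ k : ℕ, ∃ᶠ n in atTop, (c - 1 / ((k : ℝ) + 1)) * ψ n ≤ y n) :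
    limsup (fun n => ((y n / ψ n : ℝ) : EReal)) atTop = c := by
  apply le_antisymm
  · rw [← EReal.le_of_forall_lt_iff_le]
    intro z hz
    obtain ⟨k, hk⟩ := exists_nat_one_div_lt (sub_pos.2 (EReal.coe_lt_coe_iff.1 hz))
    refine limsup_le_of_le (by isBoundedDefault) ?_
    filter_upwards [hψ, hle k] with n hn hyn
    rw [EReal.coe_le_coe_iff, div_le_iff₀ hn]
    exact hyn.trans (mul_le_mul_of_nonneg_right (by linarith) hn.le)
  · rw [← EReal.ge_of_forall_gt_iff_ge]
    intro z hz
    obtain ⟨k, hk⟩ := exists_nat_one_div_lt (sub_pos.2 (EReal.coe_lt_coe_iff.1 hz))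
    refine le_limsup_of_frequently_le ?_ (by isBoundedDefault)
    refine ((hge k).and_eventually hψ).mono fun n ⟨hyn, hn⟩ => ?_
    rw [EReal.coe_le_coe_iff, le_div_iff₀ hn]
    exact hyn.trans' (mul_le_mul_of_nonneg_right (by linarith) hn.le)

namespace IsScaledProcess

variable {Ω : Type*} {mΩ : MeasurableSpace Ω} {μ : Measure Ω} [IsProbabilityMeasure μ]
  {ℱ : Filtration ℕ mΩ} {d : ℕ → Ω → ℝ} {K : ℝ} {a : ℕ → ℝ} {Y : ℕ → Ω → ℝ} {w φ : ℕ → ℝ}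
  {β c σ ρ D l : ℝ}

theorem ae_eventually_neg_le_lilNorm (h : IsScaledProcess μ ℱ d K a Y w φ β c σ) :
    ∀ᵐ ω ∂μ, ∀ᶠ n in atTop, -Y n ω ≤ 2 * √c * lilNorm φ β n := by
  simpa [two_mul] using h.neg.ae_eventually_le_lilNorm (Real.sqrt_pos.2 h.scale_pos)

theorem ae_frequently_lilNorm_le_of_pos (h : IsScaledProcess μ ℱ d K a Y w φ β c 1)
    (hρ : 1 < ρ) (hD : 0 < D) (hDc : D ^ 2 < c * (1 - ρ ^ (-β)))
    (hl : l < D - 2 * √c * √(ρ ^ (-β))) :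
    ∀ᵐ ω ∂μ, ∃ᶠ n in atTop, l * lilNorm φ β n ≤ Y n ω := by
  have hρ₀ : 0 < ρ := by positivity
  have hpow : 0 < ρ ^ β := by positivity
  have hlim := tendsto_blockNorm_succ_div hρ₀ β
  have hsqrt : D * √(ρ ^ β) < √(c * (1 * (ρ ^ β - 1))) := by
    apply Real.lt_sqrt_of_sq_lt
    calc (D * √(ρ ^ β)) ^ 2 = D ^ 2 * ρ ^ β := by rw [mul_pow, Real.sq_sqrt hpow.le]
      _ < c * (1 - ρ ^ (-β)) * ρ ^ β := by gcongr
      _ = c * (1 * (ρ ^ β - 1)) := by rw [Real.rpow_neg hρ₀.le]; field_simp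
  obtain ⟨D', hDD', hD'⟩ := exists_between hsqrt
  have hD'₀ : 0 ≤ D' := (by positivity : 0 ≤ D * √(ρ ^ β)).trans hDD'.le
  filter_upwards [h.ae_eventually_neg_le_lilNorm,
    h.ae_frequently_blockNorm_le_weightedSum hρ ((Real.lt_sqrt hD'₀).1 hD')] with ω hneg hblock
  refine h.clock.frequently_lilNorm_le_of_blocks hρ (e := fun j => j + 1) (o := fun j => j)
    (tendsto_add_atTop_nat 1) tendsto_id hneg ?_ ?_ hl
  · rw [Real.rpow_neg hρ₀.le, Real.sqrt_inv]
    exact (hlim.inv₀ (Real.sqrt_pos.2 hpow).ne').congr fun j => inv_div _ _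
  · refine (hblock.and_eventually (((hlim.const_mul D).eventually_lt_const hDD').and
      (eventually_blockNorm_pos hρ₀ β))).mono ?_
    rintro j ⟨hj, hratio, hpos⟩
    rw [h.sub_eq _ _ (h.hitTime_le_succ hρ j), one_mul]
    rw [← mul_div_assoc, div_lt_iff₀ hpos] at hratio
    exact hratio.le.trans hj

theorem ae_frequently_lilNorm_le_of_neg (h : IsScaledProcess μ ℱ d K a Y w φ β c (-1))
    (hρ : 1 < ρ) (hDc : D ^ 2 < c * (1 - ρ ^ β)) (hl : l < D - 2 * √c * √(ρ ^ β)) :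
    ∀ᵐ ω ∂μ, ∃ᶠ n in atTop, l * lilNorm φ β n ≤ Y n ω := by
  filter_upwards [h.ae_eventually_neg_le_lilNorm,
    h.ae_frequently_blockNorm_le_weightedSum hρ (D := D) (by linarith)] with ω hneg hblock
  refine h.clock.frequently_lilNorm_le_of_blocks hρ (e := fun j => j) (o := fun j => j + 1)
    tendsto_id (tendsto_add_atTop_nat 1) hneg (tendsto_blockNorm_succ_div (by positivity) β)
    (hblock.mono fun j hj => ?_) hl
  linarith [h.sub_eq _ _ (h.hitTime_le_succ hρ j) ω]

theorem ae_frequently_lilNorm_le (h : IsScaledProcess μ ℱ d K a Y w φ β c σ) {ε : ℝ}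
    (hε : 0 < ε) : ∀ᵐ ω ∂μ, ∃ᶠ n in atTop, (√c - ε) * lilNorm φ β n ≤ Y n ω := by
  have hc := Real.sqrt_pos.2 h.scale_pos
  wlog hεc : ε < √c generalizing ε
  · filter_upwards [this (half_pos hc) (half_lt_self hc)] with ω hω
    refine hω.mono fun n hn => hn.trans' ?_
    exact mul_le_mul_of_nonneg_right (by linarith) (Real.sqrt_nonneg _)
  rcases h.sign_eq with ⟨hβ, rfl⟩ | ⟨hβ, rfl⟩
  · obtain ⟨ρ, hρ, hvar, hnorm⟩ := exists_one_lt_of_lt_sqrt hβ hε hεc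
    exact h.ae_frequently_lilNorm_le_of_pos hρ (by linarith) hvar hnorm
  · obtain ⟨ρ, hρ, hvar, hnorm⟩ := exists_one_lt_of_lt_sqrt (neg_pos.2 hβ) hε hεc
    rw [neg_neg] at hvar hnorm
    exact h.ae_frequently_lilNorm_le_of_neg hρ hvar hnorm

theorem ae_limsupPM (h : IsScaledProcess μ ℱ d K a Y w φ β c σ) :
    ∀ᵐ ω ∂μ, LimsupPM (fun n => Y n ω / lilNorm φ β n) √c := by
  have hpos (k : ℕ) : (0 : ℝ) < 1 / ((k : ℝ) + 1) := by positivity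
  have hψ := h.clock.eventually_lilNorm_pos β
  filter_upwards [ae_all_iff.2 fun k => h.ae_eventually_le_lilNorm (hpos k),
    ae_all_iff.2 fun k => h.ae_frequently_lilNorm_le (hpos k),
    ae_all_iff.2 fun k => h.neg.ae_eventually_le_lilNorm (hpos k),
    ae_all_iff.2 fun k => h.neg.ae_frequently_lilNorm_le (hpos k)] with ω hle hge hle' hge'
  refine ⟨limsup_div_eq hψ hle hge, ?_⟩
  simpa [neg_div] using limsup_div_eq hψ hle' hge'

end IsScaledProcess

/-! ### Second moments and convergent sums -/

section Limits

variable {Ω : Type*} {mΩ : MeasurableSpace Ω} {μ : Measure Ω}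

theorem eLpNorm_two_eq_ofReal_sqrt {f : Ω → ℝ} (hf : MemLp f 2 μ) :
    eLpNorm f 2 μ = ENNReal.ofReal √(∫ ω, f ω ^ 2 ∂μ) := by
  rw [hf.eLpNorm_eq_integral_rpow_norm two_ne_zero ENNReal.ofNat_ne_top, Real.sqrt_eq_rpow]
  simp

theorem eLpNorm_le_of_ae_tendsto {E : Type*} [NormedAddCommGroup E] {p C : ENNReal}
    {f : ℕ → Ω → E} {g : Ω → E} (hf : ∀ n, AEStronglyMeasurable (f n) μ)
    (hlim : ∀ᵐ ω ∂μ, Tendsto (fun n => f n ω) atTop (𝓝 (g ω))) (hC : ∀ n, eLpNorm (f n) p μ ≤ C) :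
    eLpNorm g p μ ≤ C :=
  (Lp.eLpNorm_lim_le_liminf_eLpNorm hf g hlim).trans
    (liminf_le_of_frequently_le' (Frequently.of_forall hC))

theorem hasSubgaussianMGF_mono {Y : Ω → ℝ} {c c' : NNReal} (hY : HasSubgaussianMGF Y c μ)
    (hc : c ≤ c') : HasSubgaussianMGF Y c' μ where
  integrable_exp_mul := hY.integrable_exp_mul
  mgf_le t := (hY.mgf_le t).trans (by gcongr)

theorem hasSubgaussianMGF_of_ae_tendsto {Y : ℕ → Ω → ℝ} {Z : Ω → ℝ} {c : NNReal}
    (hY : ∀ n, HasSubgaussianMGF (Y n) c μ)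
    (hlim : ∀ᵐ ω ∂μ, Tendsto (fun n => Y n ω) atTop (𝓝 (Z ω))) : HasSubgaussianMGF Z c μ := by
  have hnorm {W : Ω → ℝ} {t : ℝ} (hW : Integrable (fun ω => Real.exp (t * W ω)) μ) :
      eLpNorm (fun ω => Real.exp (t * W ω)) 1 μ = ENNReal.ofReal (mgf W μ t) := by
    rw [eLpNorm_one_eq_lintegral_enorm, ← ofReal_integral_norm_eq_lintegral_enorm hW]
    simp [mgf]
  have hexp (t : ℝ) : ∀ᵐ ω ∂μ,
      Tendsto (fun n => Real.exp (t * Y n ω)) atTop (𝓝 (Real.exp (t * Z ω))) :=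
    hlim.mono fun ω hω => (Real.continuous_exp.tendsto _).comp (hω.const_mul t)
  have hle (t : ℝ) : eLpNorm (fun ω => Real.exp (t * Z ω)) 1 μ ≤
      ENNReal.ofReal (Real.exp (c * t ^ 2 / 2)) := by
    refine eLpNorm_le_of_ae_tendsto (fun n => ((hY n).integrable_exp_mul t).1) (hexp t) fun n => ?_
    rw [hnorm ((hY n).integrable_exp_mul t)]
    exact ENNReal.ofReal_le_ofReal ((hY n).mgf_le t)
  have hintegral (t : ℝ) : Integrable (fun ω => Real.exp (t * Z ω)) μ :=
    memLp_one_iff_integrable.1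
      ⟨aestronglyMeasurable_of_tendsto_ae atTop (fun n => ((hY n).integrable_exp_mul t).1) (hexp t),
        (hle t).trans_lt ENNReal.ofReal_lt_top⟩
  refine ⟨hintegral, fun t => ?_⟩
  have := hle t
  rwa [hnorm (hintegral t), ENNReal.ofReal_le_ofReal_iff (Real.exp_pos _).le] at this

theorem variance_pos_of_tendsto_eLpNorm [IsProbabilityMeasure μ] {Y : ℕ → Ω → ℝ} {Z : Ω → ℝ}
    (hY : ∀ n, MemLp (Y n) 2 μ) (hZ : MemLp Z 2 μ)
    (hlim : Tendsto (fun n => eLpNorm (fun ω => Y n ω - Z ω) 2 μ) atTop (𝓝 0)) {ε : ℝ} (hε : 0 < ε)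
    (hvar : ∀ᶠ n in atTop, ε ≤ Var[Y n; μ]) : 0 < Var[Z; μ] := by
  refine (variance_nonneg _ _).lt_of_ne' fun hzero => ?_
  have hconst := ae_eq_integral_of_variance_eq_zero hZ hzero
  have hle : ∀ᶠ n in atTop, ENNReal.ofReal √ε ≤ eLpNorm (fun ω => Y n ω - Z ω) 2 μ := by
    filter_upwards [hvar] with n hn
    have hsub : (fun ω => Y n ω - Z ω) =ᵐ[μ] Y n - fun _ => μ[Z] := by
      filter_upwards [hconst] with ω hω
      rw [hω, Pi.sub_apply]
    rw [eLpNorm_congr_ae hsub, eLpNorm_two_eq_ofReal_sqrt ((hY n).sub (memLp_const _))]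
    gcongr
    rw [← variance_sub_const (hY n).1 μ[Z]] at hn
    exact hn.trans (variance_le_expectation_sq ((hY n).1.sub aestronglyMeasurable_const))
  have hnonpos := ge_of_tendsto hlim hle
  rw [nonpos_iff_eq_zero, ENNReal.ofReal_eq_zero] at hnonpos
  exact hnonpos.not_gt (Real.sqrt_pos.2 hε)

end Limits

theorem sum_Ico_sq_eq_tsum_sub_tsum {a : ℕ → ℝ} (ha : Summable fun k => a k ^ 2) {N n : ℕ}
    (hNn : N ≤ n) :
    ∑ k ∈ Finset.Ico N n, a k ^ 2 = (∑' k, a (k + N) ^ 2) - ∑' k, a (k + n) ^ 2 := by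
  have hN := ha.sum_add_tsum_nat_add N
  have hn := ha.sum_add_tsum_nat_add n
  rw [Finset.sum_Ico_eq_sub _ hNn]
  linarith

theorem sum_Ico_sq_le_tsum {a : ℕ → ℝ} (ha : Summable fun k => a k ^ 2) {N n : ℕ} (hNn : N ≤ n) :
    ∑ k ∈ Finset.Ico N n, a k ^ 2 ≤ ∑' k, a (k + N) ^ 2 := by
  rw [sum_Ico_sq_eq_tsum_sub_tsum ha hNn]
  exact sub_le_self _ (tsum_nonneg fun _ => sq_nonneg _)

theorem tendsto_weightedSum_add {Ω : Type*} {d : ℕ → Ω → ℝ} {a : ℕ → ℝ} {L : ℝ} {ω : Ω}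
    (hL : Tendsto (fun n => weightedSum d a 0 n ω) atTop (𝓝 L)) (n : ℕ) :
    Tendsto (fun l => weightedSum d a n (n + l) ω) atTop (𝓝 (L - weightedSum d a 0 n ω)) := by
  refine ((hL.comp (tendsto_add_atTop_nat n)).sub_const (weightedSum d a 0 n ω)).congr fun l => ?_
  rw [Function.comp, add_comm l n,
    ← weightedSum_add (d := d) a (Nat.zero_le n) (Nat.le_add_right n l)]
  ring

namespace IsSubgaussianDifference

variable {Ω : Type*} {mΩ : MeasurableSpace Ω} {μ : Measure Ω} {ℱ : Filtration ℕ mΩ}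
  {d : ℕ → Ω → ℝ} {K : ℝ} [IsProbabilityMeasure μ]

theorem integral_weightedSum (h : IsSubgaussianDifference μ ℱ d K) (b : ℕ → ℝ) (N n : ℕ) :
    ∫ ω, weightedSum d b N n ω ∂μ = 0 := by
  simp only [weightedSum]
  rw [integral_finsetSum _ fun k _ => (h.integrable k).const_mul (b k)]
  refine Finset.sum_eq_zero fun k _ => ?_
  have hzero := h.integral_smul_eq_zero k (H := fun _ => (1 : ℝ)) stronglyMeasurable_const
    (integrable_const 1)
  simp only [smul_eq_mul, mul_one] at hzero
  rw [integral_const_mul, hzero, mul_zero]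

theorem variance_weightedSum (h : IsSubgaussianDifference μ ℱ d K) (b : ℕ → ℝ) {N n : ℕ}
    (hNn : N ≤ n) :
    Var[weightedSum d b N n; μ] = ∑ k ∈ Finset.Ico N n, b k ^ 2 * Var[d k; μ] := by
  induction n, hNn using Nat.le_induction with
  | base =>
    rw [show weightedSum d b N N = 0 from funext (weightedSum_self b N)]
    simp
  | succ n hNn ih =>
    have horth : cov[weightedSum d b N n, d n; μ] = 0 := by
      rw [covariance_eq_sub (h.memLp_weightedSum b N n 2) (h.memLp n 2), h.integral_weightedSum,
        zero_mul, sub_zero, mul_comm]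
      exact h.integral_smul_eq_zero n (h.measurable_weightedSum_adapted b N n).stronglyMeasurable
        (h.integrable_weightedSum b N n)
    have hsucc : weightedSum d b N (n + 1) = fun ω => weightedSum d b N n ω + b n * d n ω :=
      funext (weightedSum_succ b hNn)
    rw [hsucc, variance_fun_add (h.memLp_weightedSum b N n 2) ((h.memLp n 2).const_mul (b n)),
      covariance_const_mul_right, variance_const_mul, horth, ih, Finset.sum_Ico_succ_top hNn]
    ring

theorem eLpNorm_weightedSum_le (h : IsSubgaussianDifference μ ℱ d K) (b : ℕ → ℝ) {N n : ℕ}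
    (hNn : N ≤ n) :
    eLpNorm (weightedSum d b N n) 2 μ ≤ ENNReal.ofReal √(∑ k ∈ Finset.Ico N n, b k ^ 2) := by
  rw [eLpNorm_two_eq_ofReal_sqrt (h.memLp_weightedSum b N n 2),
    ← variance_of_integral_eq_zero (h.measurable_weightedSum b N n).aemeasurable
      (h.integral_weightedSum b N n), h.variance_weightedSum b hNn]
  gcongr with k _
  exact mul_le_of_le_one_right (sq_nonneg _) (h.variance_le_one k)

theorem hasSubgaussianMGF_weightedSum (h : IsSubgaussianDifference μ ℱ d K) (b : ℕ → ℝ) {N n : ℕ}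
    (hNn : N ≤ n) :
    HasSubgaussianMGF (weightedSum d b N n) (∑ k ∈ Finset.Ico N n, b k ^ 2).toNNReal μ where
  integrable_exp_mul t := by
    simp_rw [← weightedSum_const_mul]
    exact h.integrable_exp_weightedSum _ N n
  mgf_le t := by
    have hle := h.integral_exp_weightedSum_le (fun k => t * b k) hNn
    simp_rw [weightedSum_const_mul, mul_pow, ← Finset.mul_sum] at hle
    rw [Real.coe_toNNReal _ (Finset.sum_nonneg fun k _ => sq_nonneg _), mul_comm _ (t ^ 2)]
    exact hle

theorem exists_ae_tendsto_weightedSum (h : IsSubgaussianDifference μ ℱ d K) {a : ℕ → ℝ}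
    (ha : Summable fun k => a k ^ 2) :
    ∃ L : Ω → ℝ, Measurable L ∧
      ∀ᵐ ω ∂μ, Tendsto (fun n => weightedSum d a 0 n ω) atTop (𝓝 (L ω)) := by
  refine measurable_limit_of_tendsto_metrizable_ae
    (fun n => (h.measurable_weightedSum a 0 n).aemeasurable)
    ((h.martingale_weightedSum a 0).submartingale.exists_ae_tendsto_of_bdd
      (R := (√(∑' k, a (k + 0) ^ 2)).toNNReal) fun n => ?_)
  calc eLpNorm (weightedSum d a 0 n) 1 μ ≤ eLpNorm (weightedSum d a 0 n) 2 μ :=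
        eLpNorm_le_eLpNorm_of_exponent_le one_le_two
          (h.measurable_weightedSum a 0 n).aestronglyMeasurable
    _ ≤ ENNReal.ofReal √(∑ k ∈ Finset.Ico 0 n, a k ^ 2) := h.eLpNorm_weightedSum_le a n.zero_le
    _ ≤ ENNReal.ofReal √(∑' k, a (k + 0) ^ 2) := by
        gcongr
        exact sum_Ico_sq_le_tsum ha n.zero_le

section Remainder

variable {a : ℕ → ℝ} {L : Ω → ℝ}

theorem eLpNorm_remainder_le (h : IsSubgaussianDifference μ ℱ d K)
    (ha : Summable fun k => a k ^ 2)
    (hL : ∀ᵐ ω ∂μ, Tendsto (fun n => weightedSum d a 0 n ω) atTop (𝓝 (L ω))) (n : ℕ) :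
    eLpNorm (fun ω => L ω - weightedSum d a 0 n ω) 2 μ ≤
      ENNReal.ofReal √(∑' k, a (k + n) ^ 2) := by
  refine eLpNorm_le_of_ae_tendsto
    (fun l => (h.measurable_weightedSum a n (n + l)).aestronglyMeasurable)
    (hL.mono fun ω hω => tendsto_weightedSum_add hω n) fun l => ?_
  refine (h.eLpNorm_weightedSum_le a (Nat.le_add_right n l)).trans ?_
  gcongr
  exact sum_Ico_sq_le_tsum ha (Nat.le_add_right n l)

theorem memLp_limit (h : IsSubgaussianDifference μ ℱ d K) (ha : Summable fun k => a k ^ 2)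
    (hLm : Measurable L)
    (hL : ∀ᵐ ω ∂μ, Tendsto (fun n => weightedSum d a 0 n ω) atTop (𝓝 (L ω))) : MemLp L 2 μ := by
  refine ⟨hLm.aestronglyMeasurable, ?_⟩
  simpa using (h.eLpNorm_remainder_le ha hL 0).trans_lt ENNReal.ofReal_lt_top

theorem tendsto_eLpNorm_weightedSum_sub (h : IsSubgaussianDifference μ ℱ d K)
    (ha : Summable fun k => a k ^ 2)
    (hL : ∀ᵐ ω ∂μ, Tendsto (fun n => weightedSum d a 0 n ω) atTop (𝓝 (L ω))) :
    Tendsto (fun n => eLpNorm (fun ω => weightedSum d a 0 n ω - L ω) 2 μ) atTop (𝓝 0) := by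
  have htail : Tendsto (fun n => ENNReal.ofReal √(∑' k, a (k + n) ^ 2)) atTop (𝓝 0) := by
    simpa using ENNReal.tendsto_ofReal (tendsto_sum_nat_add fun k => a k ^ 2).sqrt
  refine tendsto_of_tendsto_of_tendsto_of_le_of_le tendsto_const_nhds htail (fun _ => zero_le)
    fun n => ?_
  refine le_of_eq_of_le ?_ (h.eLpNorm_remainder_le ha hL n)
  exact eLpNorm_sub_comm _ _ _ _

theorem variance_limit_pos (h : IsSubgaussianDifference μ ℱ d K) (ha : Summable fun k => a k ^ 2)
    (hLm : Measurable L)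
    (hL : ∀ᵐ ω ∂μ, Tendsto (fun n => weightedSum d a 0 n ω) atTop (𝓝 (L ω))) {k : ℕ}
    (hak : a k ≠ 0) (hdk : 0 < Var[d k; μ]) : 0 < Var[L; μ] := by
  refine variance_pos_of_tendsto_eLpNorm (fun n => h.memLp_weightedSum a 0 n 2)
    (h.memLp_limit ha hLm hL) (h.tendsto_eLpNorm_weightedSum_sub ha hL)
    (mul_pos (pow_pos (abs_pos.2 hak) 2) hdk) ?_
  filter_upwards [eventually_gt_atTop k] with n hn
  rw [h.variance_weightedSum a n.zero_le, sq_abs]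
  exact Finset.single_le_sum (f := fun k => a k ^ 2 * Var[d k; μ])
    (fun k _ => mul_nonneg (sq_nonneg _) (variance_nonneg _ _))
    (Finset.mem_Ico.2 ⟨k.zero_le, hn⟩)

theorem hasSubgaussianMGF_remainder (h : IsSubgaussianDifference μ ℱ d K)
    (ha : Summable fun k => a k ^ 2)
    (hL : ∀ᵐ ω ∂μ, Tendsto (fun n => weightedSum d a 0 n ω) atTop (𝓝 (L ω))) (n : ℕ) :
    HasSubgaussianMGF (fun ω => L ω - weightedSum d a 0 n ω) (∑' k, a (k + n) ^ 2).toNNReal μ :=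
  hasSubgaussianMGF_of_ae_tendsto
    (fun l => hasSubgaussianMGF_mono (h.hasSubgaussianMGF_weightedSum a (Nat.le_add_right n l))
      (Real.toNNReal_le_toNNReal (sum_Ico_sq_le_tsum ha (Nat.le_add_right n l))))
    (hL.mono fun _ hω => tendsto_weightedSum_add hω n)

end Remainder

end IsSubgaussianDifference

/-! ### The central limit theorem -/

section GaussianApproximation

variable {Ω : Type*} [MeasurableSpace Ω] {μ : Measure Ω} [IsProbabilityMeasure μ] {v : ℝ}

theorem CLT.of_tendsto_charFun {Y : ℕ → Ω → ℝ} (hv : 0 ≤ v) (hY : ∀ n, AEMeasurable (Y n) μ)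
    (h : ∀ t : ℝ, Tendsto (fun n => ∫ ω, Complex.exp (Complex.I * (t * Y n ω : ℝ)) ∂μ) atTop
      (𝓝 (Complex.exp ((-(v * t ^ 2 / 2) : ℝ))))) : CLT μ Y v := by
  refine ⟨hY, aemeasurable_id, ProbabilityMeasure.tendsto_iff_tendsto_charFun.2 fun t => ?_⟩
  simp only [ProbabilityMeasure.coe_mk, Measure.map_id, charFun_gaussianReal]
  simp only [charFun_apply_real]
  convert h t using 1
  · ext n
    rw [integral_map (hY n) (by fun_prop)]
    congr 1 with ω
    push_cast
    ring_nf
  · rw [Real.coe_toNNReal _ hv]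
    push_cast
    ring_nf

theorem CLT.of_norm_charFun_sub_le {Z : ℕ → Ω → ℝ} {A D W r : ℕ → ℝ} {C : ℝ} (hv : 0 ≤ v)
    (hZ : ∀ n, AEMeasurable (Z n) μ) (hr : ∀ᶠ n in atTop, r n ≠ 0) (hA : A =o[atTop] r)
    (hD : D =o[atTop] W) (hW : Tendsto (fun n => W n / r n ^ 2) atTop (𝓝 v))
    (h : ∀ n s, |s| * A n ≤ 1 → ‖∫ ω, Complex.exp (Complex.I * (s * Z n ω : ℝ)) ∂μ -
      Complex.exp ((-(s ^ 2 * W n / 2) : ℝ))‖ ≤ C * (|s| * A n) * (s ^ 2 * W n) + s ^ 2 / 2 * D n) :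
    CLT μ (fun n ω => Z n ω / r n) v := by
  refine CLT.of_tendsto_charFun hv (fun n => (hZ n).div_const _) fun t => ?_
  have hsA : Tendsto (fun n => |t / r n| * A n) atTop (𝓝 0) := by
    have hlim := (hA.tendsto_div_nhds_zero.const_mul t).norm
    rw [mul_zero, norm_zero] at hlim
    refine tendsto_zero_iff_norm_tendsto_zero.2 (hlim.congr fun n => ?_)
    simp only [norm_mul, norm_div, Real.norm_eq_abs, abs_div, abs_abs]
    ring
  have hsW : Tendsto (fun n => (t / r n) ^ 2 * W n) atTop (𝓝 (v * t ^ 2)) :=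
    (hW.mul_const (t ^ 2)).congr fun n => by ring
  have hsD : Tendsto (fun n => (t / r n) ^ 2 / 2 * D n) atTop (𝓝 0) := by
    have hWr : W =O[atTop] fun n => r n ^ 2 :=
      Asymptotics.isBigO_of_div_tendsto_nhds
        (hr.mono fun n hn h0 => absurd h0 (pow_ne_zero 2 hn)) v hW
    have hlim := (hD.trans_isBigO hWr).tendsto_div_nhds_zero.const_mul (t ^ 2 / 2)
    rw [mul_zero] at hlim
    exact hlim.congr fun n => by ring
  have hexp : Tendsto (fun n => Complex.exp ((-((t / r n) ^ 2 * W n / 2) : ℝ))) atTop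
      (𝓝 (Complex.exp ((-(v * t ^ 2 / 2) : ℝ)))) :=
    (Complex.continuous_exp.tendsto _).comp
      ((Complex.continuous_ofReal.tendsto _).comp (hsW.div_const 2).neg)
  have hbound : Tendsto (fun n => C * (|t / r n| * A n) * ((t / r n) ^ 2 * W n) +
      (t / r n) ^ 2 / 2 * D n) atTop (𝓝 0) := by
    simpa using ((hsA.const_mul C).mul hsW).add hsD
  refine tendsto_of_tendsto_of_dist hexp
    (squeeze_zero' (Eventually.of_forall fun _ => dist_nonneg) ?_ hbound)
  filter_upwards [hsA.eventually_le_const one_pos] with n hn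
  rw [dist_comm, dist_eq_norm]
  have hscale (ω) : t * (Z n ω / r n) = t / r n * Z n ω := by ring
  simp_rw [hscale]
  exact h n _ hn

end GaussianApproximation

theorem isLittleO_tsum_nat_add_mul {u δ : ℕ → ℝ} (hu : Summable u) (hu₀ : ∀ k, 0 ≤ u k)
    (hδ : Tendsto δ atTop (𝓝 0)) :
    (fun n => ∑' k, u (k + n) * δ (k + n)) =o[atTop] fun n => ∑' k, u (k + n) := by
  refine Asymptotics.isLittleO_iff.2 fun ε hε => ?_
  filter_upwards [eventually_forall_ge_atTop.2
    ((tendsto_zero_iff_norm_tendsto_zero.1 hδ).eventually_le_const hε)] with n hn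
  rw [Real.norm_of_nonneg (tsum_nonneg fun k => hu₀ (k + n))]
  refine tsum_of_norm_bounded (((summable_nat_add_iff n).2 hu).hasSum.mul_left ε) fun k => ?_
  rw [norm_mul, Real.norm_of_nonneg (hu₀ _), mul_comm]
  gcongr
  · exact hu₀ _
  · exact hn _ (Nat.le_add_left n k)

namespace IsSubgaussianDifference

variable {Ω : Type*} {mΩ : MeasurableSpace Ω} {μ : Measure Ω} {ℱ : Filtration ℕ mΩ}
  {d : ℕ → Ω → ℝ} {K : ℝ} [IsProbabilityMeasure μ]

theorem norm_integral_cexp_mul_weightedSum_sub_le (h : IsSubgaussianDifference μ ℱ d K)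
    (a : ℕ → ℝ) {N n : ℕ} (hNn : N ≤ n) {A s : ℝ} (hA : ∀ k ∈ Finset.Ico N n, |a k| ≤ A)
    (hsA : |s| * A ≤ 1) :
    ‖∫ ω, Complex.exp (Complex.I * (s * weightedSum d a N n ω : ℝ)) ∂μ -
        Complex.exp ((-(s ^ 2 * (∑ k ∈ Finset.Ico N n, a k ^ 2) / 2) : ℝ))‖ ≤
      taylorConst K * (|s| * A) * (s ^ 2 * ∑ k ∈ Finset.Ico N n, a k ^ 2) +
        s ^ 2 / 2 * ∑ k ∈ Finset.Ico N n, a k ^ 2 * (1 - Var[d k; μ]) := by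
  have hb (k) (hk : k ∈ Finset.Ico N n) : |s * a k| ≤ |s| * A := by
    rw [abs_mul]
    gcongr
    exact hA k hk
  have hle := h.norm_integral_cexp_weightedSum_sub_le (fun k => s * a k) hNn
    fun k hk => (hb k hk).trans hsA
  have hcube := sum_abs_cube_le hb
  have := (taylorConst_pos h.bound_nonneg).le
  simp only [weightedSum_const_mul, mul_pow, ← Finset.mul_sum] at hle hcube
  refine hle.trans ?_
  rw [Finset.sum_add_distrib, ← Finset.mul_sum, mul_assoc (taylorConst K)]
  gcongr
  rw [Finset.mul_sum]
  exact Finset.sum_le_sum fun k _ => le_of_eq (by ring)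

theorem clt_weightedSum (h : IsSubgaussianDifference μ ℱ d K) {a : ℕ → ℝ} {A : ℝ}
    (ha : ∀ k, |a k| ≤ A) (hd : Tendsto (fun k => 1 - Var[d k; μ]) atTop (𝓝 0)) {r : ℕ → ℝ}
    (hr : Tendsto r atTop atTop) {v : ℝ} (hv : 0 < v)
    (hrv : Tendsto (fun n => (∑ k ∈ Finset.range n, a k ^ 2) / r n ^ 2) atTop (𝓝 v)) :
    CLT μ (fun n ω => weightedSum d a 0 n ω / r n) v := by
  have hsum : Tendsto (fun n => ∑ k ∈ Finset.range n, a k ^ 2) atTop atTop := by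
    refine (hrv.pos_mul_atTop hv ((tendsto_pow_atTop two_ne_zero).comp hr)).congr' ?_
    filter_upwards [hr.eventually_gt_atTop 0] with n hn
    exact div_mul_cancel₀ _ (pow_pos hn 2).ne'
  have hdefect : (fun n => ∑ k ∈ Finset.range n, a k ^ 2 * (1 - Var[d k; μ])) =o[atTop]
      fun n => ∑ k ∈ Finset.range n, a k ^ 2 := by
    refine Asymptotics.IsLittleO.sum_range ?_ (fun k => sq_nonneg _) hsum
    simpa only [mul_one] using (Asymptotics.isBigO_refl (fun k => a k ^ 2) atTop).mul_isLittleO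
      ((Asymptotics.isLittleO_one_iff ℝ).2 hd)
  refine CLT.of_norm_charFun_sub_le (A := fun _ => A) (C := taylorConst K) hv.le
    (fun n => (h.measurable_weightedSum a 0 n).aemeasurable) (hr.eventually_ne_atTop 0)
    (Asymptotics.isLittleO_const_left.2 (Or.inr (tendsto_norm_atTop_atTop.comp hr))) hdefect hrv
    fun n s hs => ?_
  simpa only [Finset.range_eq_Ico] using
    h.norm_integral_cexp_mul_weightedSum_sub_le a n.zero_le (fun k _ => ha k) hs

section Remainder

variable {a : ℕ → ℝ} {L : Ω → ℝ}

theorem tendsto_integral_cexp_weightedSum (h : IsSubgaussianDifference μ ℱ d K)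
    (hL : ∀ᵐ ω ∂μ, Tendsto (fun n => weightedSum d a 0 n ω) atTop (𝓝 (L ω))) (n : ℕ) (s : ℝ) :
    Tendsto (fun l => ∫ ω, Complex.exp (Complex.I * (s * weightedSum d a n (n + l) ω : ℝ)) ∂μ)
      atTop (𝓝 (∫ ω, Complex.exp (Complex.I * (s * (L ω - weightedSum d a 0 n ω) : ℝ)) ∂μ)) := by
  refine tendsto_integral_of_dominated_convergence (fun _ => 1) (fun l => ?_)
    (integrable_const _) (fun l => ae_of_all _ fun ω => ?_) ?_
  · have := h.measurable_weightedSum a n (n + l)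
    fun_prop
  · rw [mul_comm, Complex.norm_exp_ofReal_mul_I]
  · filter_upwards [hL] with ω hω
    exact (Complex.continuous_exp.tendsto _).comp (((Complex.continuous_ofReal.tendsto _).comp
      ((tendsto_weightedSum_add hω n).const_mul s)).const_mul _)

theorem norm_integral_cexp_mul_remainder_sub_le (h : IsSubgaussianDifference μ ℱ d K)
    (ha : Summable fun k => a k ^ 2)
    (hL : ∀ᵐ ω ∂μ, Tendsto (fun n => weightedSum d a 0 n ω) atTop (𝓝 (L ω))) {n : ℕ} {A s : ℝ}
    (hA : ∀ k, n ≤ k → |a k| ≤ A) (hsA : |s| * A ≤ 1) :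
    ‖∫ ω, Complex.exp (Complex.I * (s * (L ω - weightedSum d a 0 n ω) : ℝ)) ∂μ -
        Complex.exp ((-(s ^ 2 * (∑' k, a (k + n) ^ 2) / 2) : ℝ))‖ ≤
      taylorConst K * (|s| * A) * (s ^ 2 * ∑' k, a (k + n) ^ 2) +
        s ^ 2 / 2 * ∑' k, a (k + n) ^ 2 * (1 - Var[d (k + n); μ]) := by
  have hvar : Tendsto (fun l => ∑ k ∈ Finset.Ico n (n + l), a k ^ 2) atTop
      (𝓝 (∑' k, a (k + n) ^ 2)) := by
    refine ((summable_nat_add_iff n).2 ha).hasSum.tendsto_sum_nat.congr fun l => ?_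
    simp [Finset.sum_Ico_eq_sum_range, add_comm]
  have hdefect : Tendsto (fun l => ∑ k ∈ Finset.Ico n (n + l), a k ^ 2 * (1 - Var[d k; μ])) atTop
      (𝓝 (∑' k, a (k + n) ^ 2 * (1 - Var[d (k + n); μ]))) := by
    have hsum : Summable fun k => a k ^ 2 * (1 - Var[d k; μ]) :=
      ha.of_nonneg_of_le
        (fun k => mul_nonneg (sq_nonneg _) (sub_nonneg.2 (h.variance_le_one k)))
        fun k => mul_le_of_le_one_right (sq_nonneg _) (sub_le_self _ (variance_nonneg _ _))
    refine ((summable_nat_add_iff n).2 hsum).hasSum.tendsto_sum_nat.congr fun l => ?_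
    simp [Finset.sum_Ico_eq_sum_range, add_comm]
  have hexp : Tendsto (fun l => Complex.exp
      ((-(s ^ 2 * (∑ k ∈ Finset.Ico n (n + l), a k ^ 2) / 2) : ℝ))) atTop
      (𝓝 (Complex.exp ((-(s ^ 2 * (∑' k, a (k + n) ^ 2) / 2) : ℝ)))) :=
    (Complex.continuous_exp.tendsto _).comp ((Complex.continuous_ofReal.tendsto _).comp
      ((hvar.const_mul (s ^ 2)).div_const 2).neg)
  exact le_of_tendsto_of_tendsto' ((h.tendsto_integral_cexp_weightedSum hL n s).sub hexp).norm
    (((hvar.const_mul (s ^ 2)).const_mul _).add (hdefect.const_mul _)) fun l =>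
      h.norm_integral_cexp_mul_weightedSum_sub_le a (Nat.le_add_right n l)
        (fun k hk => hA k (Finset.mem_Ico.1 hk).1) hsA

theorem clt_remainder (h : IsSubgaussianDifference μ ℱ d K) (ha : Summable fun k => a k ^ 2)
    (hanti : Antitone fun k => |a k|) (hd : Tendsto (fun k => 1 - Var[d k; μ]) atTop (𝓝 0))
    (hLm : Measurable L)
    (hL : ∀ᵐ ω ∂μ, Tendsto (fun n => weightedSum d a 0 n ω) atTop (𝓝 (L ω))) {r : ℕ → ℝ}
    (hr : ∀ᶠ n in atTop, r n ≠ 0) (har : a =o[atTop] r) {v : ℝ} (hv : 0 ≤ v)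
    (hrv : Tendsto (fun n => (∑' k, a (k + n) ^ 2) / r n ^ 2) atTop (𝓝 v)) :
    CLT μ (fun n ω => (L ω - weightedSum d a 0 n ω) / r n) v :=
  CLT.of_norm_charFun_sub_le (A := fun n => |a n|) (C := taylorConst K) hv
    (fun n => (hLm.sub (h.measurable_weightedSum a 0 n)).aemeasurable) hr har.norm_left
    (isLittleO_tsum_nat_add_mul ha (fun _ => sq_nonneg _) hd) hrv fun _ _ hs =>
      h.norm_integral_cexp_mul_remainder_sub_le ha hL (fun _ hk => hanti hk) hs

end Remainder

end IsSubgaussianDifference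

/-! ### Power weights -/

section IntegralTest

variable {f : ℝ → ℝ}

theorem integral_le_sum_range (hf : AntitoneOn f (Set.Ici 1)) (hf₀ : ∀ x, 1 ≤ x → 0 ≤ f x)
    (n : ℕ) : ∫ x in (1 : ℝ)..(n + 1 : ℕ), f x ≤ ∑ k ∈ Finset.range (n + 1), f (k + 1) := by
  have hintegral := AntitoneOn.integral_le_sum_Ico (Nat.le_add_left 1 n)
    (hf.mono (by simpa using Set.Icc_subset_Ici_self))
  rw [Finset.sum_Ico_eq_sum_range, Nat.add_sub_cancel, Nat.cast_one] at hintegral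
  have hlast : 0 ≤ f (n + 1) := hf₀ _ (by simp)
  rw [Finset.sum_range_succ]
  simp only [Nat.cast_add, Nat.cast_one, add_comm (1 : ℝ)] at hintegral ⊢
  linarith

theorem sum_range_le_integral (hf : AntitoneOn f (Set.Ici 1)) (n : ℕ) :
    ∑ k ∈ Finset.range (n + 1), f (k + 1) ≤ f 1 + ∫ x in (1 : ℝ)..(n + 1 : ℕ), f x := by
  have hintegral := AntitoneOn.sum_le_integral_Ico (Nat.le_add_left 1 n)
    (hf.mono (by simpa using Set.Icc_subset_Ici_self))
  rw [Finset.sum_Ico_eq_sum_range, Nat.add_sub_cancel, Nat.cast_one] at hintegral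
  rw [Finset.sum_range_succ', add_comm, Nat.cast_zero, zero_add]
  simp only [Nat.cast_add, Nat.cast_one, add_comm (1 : ℝ)] at hintegral ⊢
  linarith

theorem tendsto_sum_range_div (hf : AntitoneOn f (Set.Ici 1)) (hf₀ : ∀ x, 1 ≤ x → 0 ≤ f x)
    {r : ℕ → ℝ} (hr : Tendsto r atTop atTop) {c : ℝ}
    (h : Tendsto (fun n : ℕ => (∫ x in (1 : ℝ)..n, f x) / r n) atTop (𝓝 c)) :
    Tendsto (fun n => (∑ k ∈ Finset.range n, f (k + 1)) / r n) atTop (𝓝 c) := by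
  have hupper : Tendsto (fun n : ℕ => (f 1 + ∫ x in (1 : ℝ)..n, f x) / r n) atTop (𝓝 c) := by
    simpa only [add_div, zero_add] using (hr.const_div_atTop (f 1)).add h
  refine tendsto_of_tendsto_of_tendsto_of_le_of_le' h hupper ?_ ?_ <;>
    filter_upwards [hr.eventually_ge_atTop 0, eventually_ge_atTop 1] with n hrn hn <;>
    obtain ⟨m, rfl⟩ := Nat.exists_eq_add_of_le' hn
  · exact div_le_div_of_nonneg_right (integral_le_sum_range hf hf₀ m) hrn
  · exact div_le_div_of_nonneg_right (sum_range_le_integral hf m) hrn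

end IntegralTest

theorem antitoneOn_rpow_sub_one {β : ℝ} (hβ : β ≤ 1) :
    AntitoneOn (fun x : ℝ => x ^ (β - 1)) (Set.Ioi 0) :=
  Real.antitoneOn_rpow_Ioi_of_exponent_nonpos (sub_nonpos.2 hβ)

theorem tendsto_sum_rpow_div {β : ℝ} (hβ : 0 < β) (hβ₁ : β ≤ 1) :
    Tendsto (fun n : ℕ => (∑ k ∈ Finset.range n, ((k : ℝ) + 1) ^ (β - 1)) / (n : ℝ) ^ β) atTop
      (𝓝 (1 / β)) := by
  have hr : Tendsto (fun n : ℕ => (n : ℝ) ^ β) atTop atTop :=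
    (tendsto_rpow_atTop hβ).comp tendsto_natCast_atTop_atTop
  refine tendsto_sum_range_div ((antitoneOn_rpow_sub_one hβ₁).mono
    (Set.Ici_subset_Ioi.2 one_pos)) (fun x hx => by positivity) hr ?_
  have hlim : Tendsto (fun n : ℕ => 1 / β - 1 / β / (n : ℝ) ^ β) atTop (𝓝 (1 / β)) := by
    simpa only [sub_zero] using (hr.const_div_atTop (1 / β)).const_sub (1 / β)
  refine hlim.congr' ?_
  filter_upwards [hr.eventually_gt_atTop 0] with n hn
  rw [integral_rpow (Or.inl (by linarith)), sub_add_cancel, Real.one_rpow]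
  field_simp

theorem tendsto_sum_inv_div_log :
    Tendsto (fun n : ℕ => (∑ k ∈ Finset.range n, ((k : ℝ) + 1)⁻¹) / Real.log n) atTop (𝓝 1) := by
  refine tendsto_sum_range_div (fun x hx y _ hxy => inv_anti₀ (one_pos.trans_le hx) hxy)
    (fun x hx => by positivity) tendsto_log_natCast_atTop (tendsto_const_nhds.congr' ?_)
  filter_upwards [tendsto_log_natCast_atTop.eventually_gt_atTop 0, eventually_gt_atTop 0] with
    n hlog hn
  rw [integral_inv_of_pos one_pos (by exact_mod_cast hn), div_one, div_self hlog.ne']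

theorem summable_rpow_sub_one {β : ℝ} (hβ : β < 0) :
    Summable fun k : ℕ => ((k : ℝ) + 1) ^ (β - 1) := by
  simpa using (summable_nat_add_iff 1).2 (Real.summable_nat_rpow.2 (by linarith : β - 1 < -1))

theorem tsum_rpow_le {β : ℝ} (hβ : β < 0) {n : ℕ} (hn : 0 < n) :
    ∑' k : ℕ, (((k + n : ℕ) : ℝ) + 1) ^ (β - 1) ≤ (n : ℝ) ^ β / -β := by
  have hn' : (0 : ℝ) < n := by exact_mod_cast hn
  have hintegral := AntitoneOn.tsum_comp_add_le_integral n
    ((antitoneOn_rpow_sub_one (hβ.le.trans zero_le_one)).mono (Set.Ici_subset_Ioi.2 hn'))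
    (integrableOn_Ioi_rpow_of_lt (by linarith) hn')
    (fun x hx => Real.rpow_nonneg (hn'.trans hx).le _)
  rw [integral_Ioi_rpow_of_lt (by linarith) hn', sub_add_cancel, neg_div] at hintegral
  simpa [div_neg, add_assoc] using hintegral

theorem le_tsum_rpow {β : ℝ} (hβ : β < 0) (n : ℕ) :
    ((n : ℝ) + 1) ^ β / -β ≤ ∑' k : ℕ, (((k + n : ℕ) : ℝ) + 1) ^ (β - 1) := by
  have hn : (0 : ℝ) < (n + 1 : ℕ) := by positivity
  have hintegral := AntitoneOn.integral_le_tsum_comp_add (n + 1)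
    ((antitoneOn_rpow_sub_one (hβ.le.trans zero_le_one)).mono (Set.Ici_subset_Ioi.2 hn))
    (Real.summable_nat_rpow.2 (by linarith))
    (fun x hx => Real.rpow_nonneg (hn.trans hx).le _)
  rw [integral_Ioi_rpow_of_lt (by linarith) hn, sub_add_cancel, neg_div] at hintegral
  simpa [div_neg, add_assoc] using hintegral

theorem isClock_natCast : IsClock fun n => (n : ℝ) where
  mono := Nat.mono_cast
  tendsto := tendsto_natCast_atTop_atTop
  le_self _ := le_rfl
  ratio := by
    simpa using (tendsto_natCast_div_add_atTop (1 : ℝ)).inv₀ one_ne_zero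

theorem tendsto_tsum_rpow_div {β : ℝ} (hβ : β < 0) :
    Tendsto (fun n : ℕ => (∑' k : ℕ, (((k + n : ℕ) : ℝ) + 1) ^ (β - 1)) / (n : ℝ) ^ β) atTop
      (𝓝 (1 / -β)) := by
  have hlower : Tendsto (fun n : ℕ => (((n + 1 : ℕ) : ℝ) / n) ^ β / -β) atTop (𝓝 (1 / -β)) := by
    simpa using (isClock_natCast.ratio.rpow_const (p := β) (Or.inl one_ne_zero)).div_const (-β)
  refine tendsto_of_tendsto_of_tendsto_of_le_of_le' hlower tendsto_const_nhds ?_ ?_ <;>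
    filter_upwards [eventually_gt_atTop 0] with n hn <;>
    have hpow : 0 < (n : ℝ) ^ β := by positivity
  · rw [Real.div_rpow (by positivity) (by positivity), div_right_comm, Nat.cast_succ]
    exact div_le_div_of_nonneg_right (le_tsum_rpow hβ n) hpow.le
  · rw [div_le_iff₀ hpow, one_div_mul_eq_div]
    exact tsum_rpow_le hβ hn

theorem isClock_log : IsClock fun n => Real.log n where
  mono := monotone_nat_of_le_succ fun n => by
    rcases Nat.eq_zero_or_pos n with rfl | hn
    · simp
    · exact Real.log_le_log (by exact_mod_cast hn) (by simp)
  tendsto := tendsto_log_natCast_atTop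
  le_self n := Real.log_le_self n.cast_nonneg
  ratio := tendsto_log_natCast_succ_div

/-- The weights `(k + 1)^(-γ)` of the steps: since weighted sums start at index `0`, the weight
with index `k` belongs to the step with index `k + 1`. -/
noncomputable def powWeight (γ : ℝ) (k : ℕ) : ℝ := ((k : ℝ) + 1) ^ (-γ)

theorem powWeight_sq (γ : ℝ) (k : ℕ) :
    powWeight γ k ^ 2 = ((k : ℝ) + 1) ^ ((1 - 2 * γ) - 1) := by
  rw [powWeight, ← Real.rpow_mul_natCast (by positivity)]
  congr 1
  push_cast
  ring

theorem powWeight_pos (γ : ℝ) (k : ℕ) : 0 < powWeight γ k := by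
  unfold powWeight
  positivity

theorem powWeight_antitone {γ : ℝ} (hγ : 0 ≤ γ) : Antitone (powWeight γ) := fun m n hmn =>
  Real.rpow_le_rpow_of_nonpos (by positivity) (by gcongr) (neg_nonpos.2 hγ)

theorem exists_powWeight_sq_le {γ : ℝ} (hγ : 0 ≤ γ) :
    ∃ C : ℝ, 0 < C ∧ ∀ᶠ n : ℕ in atTop, ∀ k, n ≤ k →
      powWeight γ k ^ 2 ≤ C * (n : ℝ) ^ ((1 - 2 * γ) - 1) := by
  refine ⟨1, one_pos, ?_⟩
  filter_upwards [eventually_gt_atTop 0] with n hn k hnk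
  have hnk' : (n : ℝ) ≤ k + 1 := by exact_mod_cast hnk.trans k.le_succ
  rw [powWeight_sq, one_mul]
  exact Real.rpow_le_rpow_of_nonpos (by exact_mod_cast hn) hnk' (by linarith)

theorem abs_powWeight_le_one {γ : ℝ} (hγ : 0 ≤ γ) (k : ℕ) : |powWeight γ k| ≤ 1 := by
  rw [abs_of_pos (powWeight_pos γ k)]
  simpa [powWeight] using powWeight_antitone hγ (Nat.zero_le k)

theorem tendsto_powWeight {γ : ℝ} (hγ : 0 < γ) : Tendsto (powWeight γ) atTop (𝓝 0) :=
  (tendsto_rpow_neg_atTop hγ).comp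
    (tendsto_atTop_add_const_right _ 1 tendsto_natCast_atTop_atTop)

theorem isLittleO_powWeight {γ s : ℝ} (hγ : 0 ≤ γ) (hs : -γ < s) :
    powWeight γ =o[atTop] fun n : ℕ => (n : ℝ) ^ s := by
  have hpow : ∀ᶠ n : ℕ in atTop, 0 < (n : ℝ) ^ s := by
    filter_upwards [eventually_gt_atTop 0] with n hn
    positivity
  refine Asymptotics.isLittleO_of_tendsto' (hpow.mono fun n hn h₀ => (hn.ne' h₀).elim) ?_
  refine squeeze_zero' (hpow.mono fun n hn => div_nonneg (powWeight_pos γ n).le hn.le) ?_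
    ((tendsto_rpow_neg_atTop (neg_lt_iff_pos_add'.1 hs)).comp tendsto_natCast_atTop_atTop)
  filter_upwards [hpow, eventually_gt_atTop 0] with n hpos hn
  have hn' : (0 : ℝ) < n := by exact_mod_cast hn
  rw [Function.comp_apply, div_le_iff₀ hpos, ← Real.rpow_add hn', neg_add, neg_add_cancel_right]
  exact Real.rpow_le_rpow_of_nonpos hn' (by simp) (neg_nonpos.2 hγ)

theorem natCast_rpow_half_sq (γ : ℝ) (n : ℕ) :
    ((n : ℝ) ^ (1 / 2 - γ)) ^ 2 = (n : ℝ) ^ (1 - 2 * γ) := by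
  rw [← Real.rpow_mul_natCast n.cast_nonneg]
  congr 1
  push_cast
  ring

theorem tendsto_sum_powWeight_sq_div {γ : ℝ} (hγ : 0 ≤ γ) (hγ' : γ < 1 / 2) :
    Tendsto (fun n : ℕ => (∑ k ∈ Finset.range n, powWeight γ k ^ 2) / (n : ℝ) ^ (1 - 2 * γ))
      atTop (𝓝 (1 / (1 - 2 * γ))) := by
  simp_rw [powWeight_sq]
  exact tendsto_sum_rpow_div (by linarith) (by linarith)

theorem tendsto_sum_powWeight_half_sq_div :
    Tendsto (fun n : ℕ => (∑ k ∈ Finset.range n, powWeight (1 / 2) k ^ 2) / Real.log n) atTop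
      (𝓝 1) := by
  simpa [powWeight_sq, Real.rpow_neg_one] using tendsto_sum_inv_div_log

theorem summable_powWeight_sq {γ : ℝ} (hγ : 1 / 2 < γ) : Summable fun k => powWeight γ k ^ 2 := by
  simp_rw [powWeight_sq]
  exact summable_rpow_sub_one (by linarith)

theorem tendsto_tsum_powWeight_sq_div {γ : ℝ} (hγ : 1 / 2 < γ) :
    Tendsto (fun n : ℕ => (∑' k, powWeight γ (k + n) ^ 2) / (n : ℝ) ^ (1 - 2 * γ)) atTop
      (𝓝 (1 / (2 * γ - 1))) := by
  simp_rw [powWeight_sq]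
  simpa only [neg_sub] using tendsto_tsum_rpow_div (show 1 - 2 * γ < 0 by linarith)

theorem LimsupPM.neg {y : ℕ → ℝ} {c : ℝ} (h : LimsupPM y c) : LimsupPM (fun n => -y n) c :=
  ⟨h.2, by simpa only [neg_neg] using h.1⟩

namespace IsSubgaussianDifference

variable {Ω : Type*} {mΩ : MeasurableSpace Ω} {μ : Measure Ω} [IsProbabilityMeasure μ]
  {ℱ : Filtration ℕ mΩ} {d : ℕ → Ω → ℝ} {K : ℝ}

theorem isScaledProcess_weightedSum (h : IsSubgaussianDifference μ ℱ d K)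
    (hd : ∃ C s : ℝ, 0 < C ∧ 0 < s ∧ ∀ k : ℕ, 1 - Var[d k; μ] ≤ C * ((k : ℝ) + 1) ^ (-s))
    {a φ : ℕ → ℝ} (hφ : IsClock φ) {β c : ℝ} (hβ : 0 < β) (hc : 0 < c)
    (ha : ∃ C : ℝ, 0 < C ∧ ∀ᶠ n in atTop, ∀ k, n ≤ k → a k ^ 2 ≤ C * φ n ^ (β - 1))
    (hw : Tendsto (fun n => (∑ k ∈ Finset.range n, a k ^ 2) / φ n ^ β) atTop (𝓝 c)) :
    IsScaledProcess μ ℱ d K a (fun n => weightedSum d a 0 n)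
      (fun n => ∑ k ∈ Finset.range n, a k ^ 2) φ β c 1 where
  diff := h
  defect_le := hd
  clock := hφ
  sub_eq N n hNn ω := by rw [← weightedSum_add a (Nat.zero_le N) hNn]; ring
  sign_eq := Or.inl ⟨hβ, rfl⟩
  subgaussian n := by
    simpa only [Finset.range_eq_Ico] using h.hasSubgaussianMGF_weightedSum a (Nat.zero_le n)
  variance_eq N n hNn := by rw [Finset.sum_Ico_eq_sub _ hNn, one_mul]
  weight_le := ha
  scale_pos := hc
  scale := hw

theorem isScaledProcess_remainder (h : IsSubgaussianDifference μ ℱ d K)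
    (hd : ∃ C s : ℝ, 0 < C ∧ 0 < s ∧ ∀ k : ℕ, 1 - Var[d k; μ] ≤ C * ((k : ℝ) + 1) ^ (-s))
    {a φ : ℕ → ℝ} (hφ : IsClock φ) {β c : ℝ} (hβ : β < 0) (hc : 0 < c)
    (ha : ∃ C : ℝ, 0 < C ∧ ∀ᶠ n in atTop, ∀ k, n ≤ k → a k ^ 2 ≤ C * φ n ^ (β - 1))
    (hsum : Summable fun k => a k ^ 2) {L : Ω → ℝ}
    (hL : ∀ᵐ ω ∂μ, Tendsto (fun n => weightedSum d a 0 n ω) atTop (𝓝 (L ω)))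
    (hw : Tendsto (fun n => (∑' k, a (k + n) ^ 2) / φ n ^ β) atTop (𝓝 c)) :
    IsScaledProcess μ ℱ d K a (fun n ω => L ω - weightedSum d a 0 n ω)
      (fun n => ∑' k, a (k + n) ^ 2) φ β c (-1) where
  diff := h
  defect_le := hd
  clock := hφ
  sub_eq N n hNn ω := by rw [← weightedSum_add a (Nat.zero_le N) hNn]; ring
  sign_eq := Or.inr ⟨hβ, rfl⟩
  subgaussian n := h.hasSubgaussianMGF_remainder hsum hL n
  variance_eq N n hNn := by rw [sum_Ico_sq_eq_tsum_sub_tsum hsum hNn]; ring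
  weight_le := ha
  scale_pos := hc
  scale := hw

theorem tendsto_one_sub_variance (h : IsSubgaussianDifference μ ℱ d K)
    (hd : ∃ C s : ℝ, 0 < C ∧ 0 < s ∧ ∀ k : ℕ, 1 - Var[d k; μ] ≤ C * ((k : ℝ) + 1) ^ (-s)) :
    Tendsto (fun k => 1 - Var[d k; μ]) atTop (𝓝 0) := by
  obtain ⟨C, s, -, hs, hle⟩ := hd
  refine squeeze_zero (fun k => sub_nonneg.2 (h.variance_le_one k)) hle ?_
  simpa [powWeight] using (tendsto_powWeight hs).const_mul C

theorem clt_powWeight_of_lt_half (h : IsSubgaussianDifference μ ℱ d K)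
    (hd : Tendsto (fun k => 1 - Var[d k; μ]) atTop (𝓝 0)) {γ : ℝ} (hγ : 0 ≤ γ)
    (hγ' : γ < 1 / 2) :
    CLT μ (fun n ω => weightedSum d (powWeight γ) 0 n ω / (n : ℝ) ^ (1 / 2 - γ))
      (1 / (1 - 2 * γ)) :=
  h.clt_weightedSum (abs_powWeight_le_one hγ) hd
    ((tendsto_rpow_atTop (sub_pos.2 hγ')).comp tendsto_natCast_atTop_atTop)
    (one_div_pos.2 (by linarith))
    (by simpa only [Function.comp_apply, natCast_rpow_half_sq] using
      tendsto_sum_powWeight_sq_div hγ hγ')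

theorem ae_limsupPM_powWeight_of_lt_half (h : IsSubgaussianDifference μ ℱ d K)
    (hd : ∃ C s : ℝ, 0 < C ∧ 0 < s ∧ ∀ k : ℕ, 1 - Var[d k; μ] ≤ C * ((k : ℝ) + 1) ^ (-s))
    {γ : ℝ} (hγ : 0 ≤ γ) (hγ' : γ < 1 / 2) :
    ∀ᵐ ω ∂μ, LimsupPM (fun n => weightedSum d (powWeight γ) 0 n ω /
      √(2 * (n : ℝ) ^ (1 - 2 * γ) * Real.log (Real.log n))) (1 / √(1 - 2 * γ)) := by
  have hβ : 0 < 1 - 2 * γ := by linarith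
  have hscaled := h.isScaledProcess_weightedSum hd isClock_natCast hβ (one_div_pos.2 hβ)
    (exists_powWeight_sq_le hγ) (tendsto_sum_powWeight_sq_div hγ hγ')
  simpa only [lilNorm, Real.sqrt_div zero_le_one, Real.sqrt_one] using hscaled.ae_limsupPM

theorem clt_powWeight_half (h : IsSubgaussianDifference μ ℱ d K)
    (hd : Tendsto (fun k => 1 - Var[d k; μ]) atTop (𝓝 0)) :
    CLT μ (fun n ω => weightedSum d (powWeight (1 / 2)) 0 n ω / √(Real.log n)) 1 :=
  h.clt_weightedSum (abs_powWeight_le_one (by norm_num)) hd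
    (Real.tendsto_sqrt_atTop.comp tendsto_log_natCast_atTop) one_pos
    (by simpa only [Function.comp_apply, Real.sq_sqrt (Real.log_natCast_nonneg _)] using
      tendsto_sum_powWeight_half_sq_div)

theorem ae_limsupPM_powWeight_half (h : IsSubgaussianDifference μ ℱ d K)
    (hd : ∃ C s : ℝ, 0 < C ∧ 0 < s ∧ ∀ k : ℕ, 1 - Var[d k; μ] ≤ C * ((k : ℝ) + 1) ^ (-s)) :
    ∀ᵐ ω ∂μ, LimsupPM (fun n => weightedSum d (powWeight (1 / 2)) 0 n ω /
      √(2 * Real.log n * Real.log (Real.log (Real.log n)))) 1 := by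
  have hweight : ∀ n k : ℕ, n ≤ k →
      powWeight (1 / 2) k ^ 2 ≤ 1 * Real.log n ^ ((1 : ℝ) - 1) := fun n k _ => by
    rw [sub_self, Real.rpow_zero, one_mul, sq_le_one_iff_abs_le_one]
    exact abs_powWeight_le_one (by norm_num) k
  have hscaled := h.isScaledProcess_weightedSum hd isClock_log one_pos one_pos
    ⟨1, one_pos, Eventually.of_forall hweight⟩
    (by simpa only [Real.rpow_one] using tendsto_sum_powWeight_half_sq_div)
  simpa only [lilNorm, Real.sqrt_one, Real.rpow_one] using hscaled.ae_limsupPM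

section Remainder

variable {γ : ℝ} {L : Ω → ℝ}

theorem clt_powWeight_of_half_lt (h : IsSubgaussianDifference μ ℱ d K)
    (hd : Tendsto (fun k => 1 - Var[d k; μ]) atTop (𝓝 0)) (hγ : 1 / 2 < γ) (hLm : Measurable L)
    (hL : ∀ᵐ ω ∂μ, Tendsto (fun n => weightedSum d (powWeight γ) 0 n ω) atTop (𝓝 (L ω))) :
    CLT μ (fun n ω => (weightedSum d (powWeight γ) 0 n ω - L ω) / (n : ℝ) ^ (1 / 2 - γ))
      (1 / (2 * γ - 1)) := by
  have hγ₀ : 0 ≤ γ := by linarith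
  have hpow : ∀ᶠ n : ℕ in atTop, -(n : ℝ) ^ (1 / 2 - γ) ≠ 0 := by
    filter_upwards [eventually_gt_atTop 0] with n hn
    exact neg_ne_zero.2 (by positivity)
  have hclt := h.clt_remainder (v := 1 / (2 * γ - 1)) (summable_powWeight_sq hγ)
    (by simpa only [abs_of_pos (powWeight_pos γ _)] using powWeight_antitone hγ₀) hd hLm hL hpow
    (isLittleO_powWeight hγ₀ (by linarith)).neg_right
    (one_div_nonneg.2 (by linarith))
    (by simpa only [neg_sq, natCast_rpow_half_sq] using tendsto_tsum_powWeight_sq_div hγ)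
  simpa only [div_neg, ← neg_div, neg_sub] using hclt

theorem ae_limsupPM_powWeight_of_half_lt (h : IsSubgaussianDifference μ ℱ d K)
    (hd : ∃ C s : ℝ, 0 < C ∧ 0 < s ∧ ∀ k : ℕ, 1 - Var[d k; μ] ≤ C * ((k : ℝ) + 1) ^ (-s))
    (hγ : 1 / 2 < γ)
    (hL : ∀ᵐ ω ∂μ, Tendsto (fun n => weightedSum d (powWeight γ) 0 n ω) atTop (𝓝 (L ω))) :
    ∀ᵐ ω ∂μ, LimsupPM (fun n => (weightedSum d (powWeight γ) 0 n ω - L ω) /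
      √(2 * (n : ℝ) ^ (1 - 2 * γ) * Real.log (Real.log n))) (1 / √(2 * γ - 1)) := by
  have hscaled := h.isScaledProcess_remainder hd isClock_natCast
    (show 1 - 2 * γ < 0 by linarith) (one_div_pos.2 (by linarith))
    (exists_powWeight_sq_le (by linarith)) (summable_powWeight_sq hγ) hL
    (tendsto_tsum_powWeight_sq_div hγ)
  filter_upwards [hscaled.ae_limsupPM] with ω hω
  simpa only [lilNorm, Real.sqrt_div zero_le_one, Real.sqrt_one, ← neg_div, neg_sub] using hω.neg

end Remainder

end IsSubgaussianDifference

/-! ### The conditional law of a step -/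

section Discrete

variable {Ω α β δ : Type*} [MeasurableSpace Ω] {μ : Measure Ω} [IsProbabilityMeasure μ]

theorem indepFun_prodMk_of_indepFun [MeasurableSpace α] [MeasurableSpace β] [MeasurableSpace δ]
    {f : Ω → α} {g : Ω → β} {h : Ω → δ} (hf : Measurable f) (hg : Measurable g)
    (hh : Measurable h) (hfgh : IndepFun f (fun ω => (g ω, h ω)) μ) (hgh : IndepFun g h μ) :
    IndepFun (fun ω => (f ω, g ω)) h μ := by
  have hfg : IndepFun f g μ := hfgh.comp (φ := id) (ψ := Prod.fst) measurable_id measurable_fst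
  have := Measure.isProbabilityMeasure_map (μ := μ) hf.aemeasurable
  have := Measure.isProbabilityMeasure_map (μ := μ) hg.aemeasurable
  have := Measure.isProbabilityMeasure_map (μ := μ) hh.aemeasurable
  rw [indepFun_iff_map_prod_eq_prod_map_map (hf.prodMk hg).aemeasurable hh.aemeasurable]
  calc μ.map (fun ω => ((f ω, g ω), h ω))
      = (μ.map fun ω => (f ω, (g ω, h ω))).map MeasurableEquiv.prodAssoc.symm := by
        rw [Measure.map_map (MeasurableEquiv.measurable _) (by fun_prop)]
        rfl
    _ = ((μ.map f).prod ((μ.map g).prod (μ.map h))).map MeasurableEquiv.prodAssoc.symm := by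
        rw [(indepFun_iff_map_prod_eq_prod_map_map hf.aemeasurable
            (hg.prodMk hh).aemeasurable).1 hfgh,
          (indepFun_iff_map_prod_eq_prod_map_map hg.aemeasurable hh.aemeasurable).1 hgh]
    _ = ((μ.map f).prod (μ.map g)).prod (μ.map h) :=
        (measurePreserving_prodAssoc _ _ _).symm.map_eq
    _ = (μ.map fun ω => (f ω, g ω)).prod (μ.map h) := by
        rw [(indepFun_iff_map_prod_eq_prod_map_map hf.aemeasurable hg.aemeasurable).1 hfg]

theorem ae_mem_of_sum_measureReal_eq_one [MeasurableSpace α] [MeasurableSingletonClass α]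
    {f : Ω → α} (hf : Measurable f) {s : Finset α}
    (hs : ∑ a ∈ s, μ.real (f ⁻¹' {a}) = 1) : ∀ᵐ ω ∂μ, f ω ∈ s := by
  rw [sum_measureReal_preimage_singleton s fun a _ => hf (measurableSet_singleton a)] at hs
  have hprob : μ (f ⁻¹' s) = 1 := by rw [← ofReal_measureReal, hs, ENNReal.ofReal_one]
  exact (mem_ae_iff_prob_eq_one (hf s.measurableSet)).2 hprob

theorem ae_eq_one_or_eq_neg_one {f : Ω → ℝ} (hf : Measurable f) {r : ℝ}
    (hpos : μ.real {ω | f ω = 1} = r) (hneg : μ.real {ω | f ω = -1} = 1 - r) :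
    ∀ᵐ ω ∂μ, f ω = 1 ∨ f ω = -1 := by
  have hsum : ∑ a ∈ {1, -1}, μ.real (f ⁻¹' {a}) = 1 := by
    rw [Finset.sum_pair (by norm_num)]
    exact (congrArg₂ (· + ·) hpos hneg).trans (add_sub_cancel r 1)
  simpa using ae_mem_of_sum_measureReal_eq_one hf hsum

theorem integral_eq_of_measureReal_sign {f : Ω → ℝ} (hf : Measurable f) {r : ℝ}
    (hpos : μ.real {ω | f ω = 1} = r) (hneg : μ.real {ω | f ω = -1} = 1 - r) :
    ∫ ω, f ω ∂μ = 2 * r - 1 := by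
  have hmeas : MeasurableSet {ω | f ω = 1} := hf (measurableSet_singleton 1)
  have hind : f =ᵐ[μ] fun ω => 2 * {ω | f ω = 1}.indicator 1 ω - 1 := by
    filter_upwards [ae_eq_one_or_eq_neg_one hf hpos hneg] with ω hω
    rcases hω with hω | hω <;> norm_num [Set.indicator_apply, hω]
  rw [integral_congr_ae hind, integral_sub (((integrable_const _).indicator hmeas).const_mul _)
    (integrable_const _), integral_const_mul, integral_indicator_one hmeas, hpos]
  simp

end Discrete

theorem measurable_history {Ω : Type*} (X : ℕ → Ω → ℝ) {n j : ℕ} (hj : 1 ≤ j) (hjn : j ≤ n) :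
    Measurable[history X n] (X j) :=
  measurable_iff_comap_le.2 (le_iSup₂_of_le j (Finset.mem_Icc.2 ⟨hj, hjn⟩) le_rfl)

/-- The elephant random walk `X 1 + ⋯ + X n` with steps of constant size, in terms of which the
next step is predicted. -/
def walk {Ω : Type*} (X : ℕ → Ω → ℝ) (n : ℕ) (ω : Ω) : ℝ :=
  ∑ j ∈ Finset.Icc 1 n, X j ω

theorem measurable_walk {Ω : Type*} (X : ℕ → Ω → ℝ) (n : ℕ) :
    Measurable[history X n] (walk X n) :=
  Finset.measurable_fun_sum _ fun _ hj =>
    measurable_history X (Finset.mem_Icc.1 hj).1 (Finset.mem_Icc.1 hj).2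

/-- The contribution of the choice `j` to the step `n + 1`: the sign `ξ n` if `U n = j`, and `0`
otherwise, so that `X (n + 1) = ∑ j, copySign U ξ n j * X j`. -/
def copySign {Ω : Type*} (U : ℕ → Ω → ℕ) (ξ : ℕ → Ω → ℝ) (n j : ℕ) (ω : Ω) : ℝ :=
  if U n ω = j then ξ n ω else 0

/-- The first step and the choices and signs up to time `n`, which determine the steps up to time
`n + 1`. -/
def past {Ω : Type*} (X : ℕ → Ω → ℝ) (U : ℕ → Ω → ℕ) (ξ : ℕ → Ω → ℝ) (n : ℕ) (ω : Ω) :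
    ℝ × (Finset.range n → ℕ × ℝ) :=
  (X 1 ω, fun k => (U (k + 1) ω, ξ (k + 1) ω))

theorem measurable_copySign {Ω : Type*} {_ : MeasurableSpace Ω} {U : ℕ → Ω → ℕ}
    {ξ : ℕ → Ω → ℝ} {n : ℕ} (h : Measurable fun ω => (U n ω, ξ n ω)) (j : ℕ) :
    Measurable (copySign U ξ n j) :=
  Measurable.ite (h.fst (measurableSet_singleton j)) h.snd measurable_const

theorem measurable_comap_past {Ω : Type*} (X : ℕ → Ω → ℝ) (U : ℕ → Ω → ℕ) (ξ : ℕ → Ω → ℝ)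
    {k n : ℕ} (hkn : k < n) :
    Measurable[MeasurableSpace.comap (past X U ξ n) inferInstance]
      fun ω => (U (k + 1) ω, ξ (k + 1) ω) :=
  ((measurable_pi_apply (⟨k, Finset.mem_range.2 hkn⟩ : Finset.range n)).comp
    measurable_snd).comp (comap_measurable (past X U ξ n))

namespace IsElephantRandomWalk

variable {Ω : Type*} [mΩ : MeasurableSpace Ω] {μ : Measure Ω} {p q : ℝ} {X : ℕ → Ω → ℝ}
  {U : ℕ → Ω → ℕ} {ξ : ℕ → Ω → ℝ}

theorem history_le (h : IsElephantRandomWalk μ p q X U ξ) (n : ℕ) : history X n ≤ mΩ :=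
  iSup₂_le fun k hk => (h.measurable_step k (Finset.mem_Icc.1 hk).1).comap_le

theorem measurable_pair (h : IsElephantRandomWalk μ p q X U ξ) {n : ℕ} (hn : 1 ≤ n) :
    Measurable fun ω => (U n ω, ξ n ω) :=
  (h.measurable_choice n hn).prodMk (h.measurable_sign n hn)

variable [IsProbabilityMeasure μ]

theorem ae_choice_mem (h : IsElephantRandomWalk μ p q X U ξ) {n : ℕ} (hn : 1 ≤ n) :
    ∀ᵐ ω ∂μ, U n ω ∈ Finset.Icc 1 n := by
  refine ae_mem_of_sum_measureReal_eq_one (h.measurable_choice n hn) ?_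
  have huniform : ∀ j ∈ Finset.Icc 1 n, μ.real (U n ⁻¹' {j}) = 1 / (n : ℝ) := fun j hj =>
    h.choice_uniform n hn j (Finset.mem_Icc.1 hj).1 (Finset.mem_Icc.1 hj).2
  rw [Finset.sum_congr rfl huniform, Finset.sum_const, Nat.card_Icc, Nat.add_sub_cancel,
    nsmul_eq_mul, mul_one_div_cancel (by positivity)]

theorem ae_sign_eq (h : IsElephantRandomWalk μ p q X U ξ) {n : ℕ} (hn : 1 ≤ n) :
    ∀ᵐ ω ∂μ, ξ n ω = 1 ∨ ξ n ω = -1 :=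
  ae_eq_one_or_eq_neg_one (h.measurable_sign n hn) (h.sign_pos n hn) (h.sign_neg n hn)

theorem ae_step_eq (h : IsElephantRandomWalk μ p q X U ξ) {n : ℕ} (hn : 1 ≤ n) :
    ∀ᵐ ω ∂μ, X n ω = 1 ∨ X n ω = -1 := by
  induction n using Nat.strong_induction_on with
  | _ n ih =>
    obtain rfl | ⟨k, hk, rfl⟩ : n = 1 ∨ ∃ k, 1 ≤ k ∧ n = k + 1 :=
      hn.eq_or_lt'.imp id fun hn => ⟨n - 1, by omega, by omega⟩
    · exact ae_eq_one_or_eq_neg_one (h.measurable_step 1 le_rfl) h.first_pos h.first_neg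
    · have hprev : ∀ᵐ ω ∂μ, ∀ j ∈ Finset.Icc 1 k, X j ω = 1 ∨ X j ω = -1 :=
        (Finset.eventually_all _).2 fun j hj =>
          ih j (Nat.lt_succ_of_le (Finset.mem_Icc.1 hj).2) (Finset.mem_Icc.1 hj).1
      filter_upwards [h.step k hk, h.ae_choice_mem hk, h.ae_sign_eq hk, hprev] with
        ω hstep hchoice hsign hprev
      rw [hstep]
      rcases hsign with hs | hs <;> rcases hprev _ hchoice with hX | hX <;> simp [hs, hX]

theorem ae_abs_step_eq_one (h : IsElephantRandomWalk μ p q X U ξ) {n : ℕ} (hn : 1 ≤ n) :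
    ∀ᵐ ω ∂μ, |X n ω| = 1 := by
  filter_upwards [h.ae_step_eq hn] with ω hω
  rcases hω with hω | hω <;> simp [hω]

theorem step_ae_eq_sum (h : IsElephantRandomWalk μ p q X U ξ) {n : ℕ} (hn : 1 ≤ n) :
    X (n + 1) =ᵐ[μ] ∑ j ∈ Finset.Icc 1 n, copySign U ξ n j * X j := by
  filter_upwards [h.step n hn, h.ae_choice_mem hn] with ω hstep hchoice
  simp only [hstep, copySign, Finset.sum_apply, Pi.mul_apply, ite_mul, zero_mul,
    Finset.sum_ite_eq, if_pos hchoice]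

theorem indepFun_past (h : IsElephantRandomWalk μ p q X U ξ) (n : ℕ) :
    IndepFun (past X U ξ n) (fun ω => (U (n + 1) ω, ξ (n + 1) ω)) μ := by
  have hpair (k : ℕ) : Measurable fun ω => (U (k + 1) ω, ξ (k + 1) ω) :=
    h.measurable_pair k.succ_pos
  refine indepFun_prodMk_of_indepFun (h.measurable_step 1 le_rfl)
    (measurable_pi_lambda _ fun k => hpair k) (hpair n) ?_ ?_
  · exact h.indep_first.comp (φ := id)
      (ψ := fun s : ℕ → ℕ × ℝ => ((fun k : Finset.range n => s k), s n)) measurable_id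
      (by fun_prop)
  · exact (h.indep_times.indepFun_finset (Finset.range n) {n} (by simp) hpair).comp (φ := id)
      (ψ := fun s : ({n} : Finset ℕ) → ℕ × ℝ => s ⟨n, by simp⟩) measurable_id
      (measurable_pi_apply _)

theorem aestronglyMeasurable_comap_past (h : IsElephantRandomWalk μ p q X U ξ) {n j : ℕ}
    (hj : 1 ≤ j) (hjn : j ≤ n + 1) :
    AEStronglyMeasurable[MeasurableSpace.comap (past X U ξ n) inferInstance] (X j) μ := by
  induction j using Nat.strong_induction_on with
  | _ j ih =>
    obtain rfl | ⟨k, hk, rfl⟩ : j = 1 ∨ ∃ k, 1 ≤ k ∧ j = k + 1 :=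
      hj.eq_or_lt'.imp id fun hj => ⟨j - 1, by omega, by omega⟩
    · exact (measurable_fst.comp (comap_measurable (past X U ξ n))).stronglyMeasurable
        |>.aestronglyMeasurable
    · refine AEStronglyMeasurable.congr ?_ (h.step_ae_eq_sum hk).symm
      refine Finset.sum_induction _
        (AEStronglyMeasurable[MeasurableSpace.comap (past X U ξ n) inferInstance] · μ)
        (fun _ _ hf hg => hf.add hg) stronglyMeasurable_zero.aestronglyMeasurable fun i hi => ?_
      obtain ⟨hi, hik⟩ := Finset.mem_Icc.1 hi
      have hpair := measurable_comap_past X U ξ (show k - 1 < n by omega)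
      rw [Nat.sub_add_cancel hk] at hpair
      exact (measurable_copySign hpair i).stronglyMeasurable.aestronglyMeasurable.mul
        (ih i (by omega) hi (by omega))

theorem indep_history (h : IsElephantRandomWalk μ p q X U ξ) {n : ℕ} (hn : 1 ≤ n) :
    Indep (MeasurableSpace.comap (fun ω => (U n ω, ξ n ω)) inferInstance) (history X n) μ := by
  obtain ⟨n, rfl⟩ := Nat.exists_eq_add_of_le' hn
  let Y (ω : Ω) (j : Finset.Icc 1 (n + 1)) : ℝ := X j ω
  have hX (j : Finset.Icc 1 (n + 1)) :
      AEStronglyMeasurable[MeasurableSpace.comap (past X U ξ n) inferInstance] (X j) μ :=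
    h.aestronglyMeasurable_comap_past (Finset.mem_Icc.1 j.2).1 (Finset.mem_Icc.1 j.2).2
  have hmk : Measurable[MeasurableSpace.comap (past X U ξ n) inferInstance]
      fun ω j => (hX j).mk (X j) ω :=
    @measurable_pi_lambda _ _ _ (_) _ _ fun j => (hX j).stronglyMeasurable_mk.measurable
  have hindep : IndepFun (fun ω => (U (n + 1) ω, ξ (n + 1) ω)) Y μ := by
    have hpast := (IndepFun_iff_Indep _ _ _).1 (h.indepFun_past n).symm
    refine IndepFun.congr ((IndepFun_iff_Indep _ _ _).2
      (indep_of_indep_of_le_right hpast hmk.comap_le)) (ae_eq_refl _) ?_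
    filter_upwards [ae_all_iff.2 fun j => (hX j).ae_eq_mk] with ω hω
    exact funext fun j => (hω j).symm
  refine indep_of_indep_of_le_right ((IndepFun_iff_Indep _ _ _).1 hindep)
    (iSup₂_le fun k hk => Measurable.comap_le ?_)
  exact (measurable_pi_apply (⟨k, hk⟩ : Finset.Icc 1 (n + 1))).comp (comap_measurable Y)

theorem integral_copySign (h : IsElephantRandomWalk μ p q X U ξ) {n j : ℕ} (hj : 1 ≤ j)
    (hjn : j ≤ n) : ∫ ω, copySign U ξ n j ω ∂μ = (2 * p - 1) / n := by
  have hn := hj.trans hjn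
  have hmeas : MeasurableSet {ω | U n ω = j} :=
    h.measurable_choice n hn (measurableSet_singleton j)
  have hindep : IndepFun ({ω | U n ω = j}.indicator (1 : Ω → ℝ)) (ξ n) μ :=
    (h.indep_choice_sign n hn).comp (φ := Set.indicator {j} (1 : ℕ → ℝ)) (ψ := id)
      (measurable_of_countable _) measurable_id
  have hcopy : copySign U ξ n j = {ω | U n ω = j}.indicator 1 * ξ n := by
    ext ω
    simp [copySign, Set.indicator_apply]
  rw [hcopy, hindep.integral_mul_eq_mul_integral
      (measurable_one.indicator hmeas).aestronglyMeasurable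
      (h.measurable_sign n hn).aestronglyMeasurable, integral_indicator_one hmeas,
    h.choice_uniform n hn j hj hjn, one_div_mul_eq_div,
    integral_eq_of_measureReal_sign (h.measurable_sign n hn) (h.sign_pos n hn) (h.sign_neg n hn)]

theorem integrable_copySign (h : IsElephantRandomWalk μ p q X U ξ) {n : ℕ} (hn : 1 ≤ n) (j : ℕ) :
    Integrable (copySign U ξ n j) μ := by
  refine .of_bound (measurable_copySign (h.measurable_pair hn) j).aestronglyMeasurable 1 ?_
  filter_upwards [h.ae_sign_eq hn] with ω hω
  rcases hω with hω | hω <;> simp only [copySign, hω] <;> split_ifs <;> simp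

theorem integrable_copySign_mul (h : IsElephantRandomWalk μ p q X U ξ) {n j : ℕ} (hn : 1 ≤ n)
    (hj : 1 ≤ j) : Integrable (copySign U ξ n j * X j) μ :=
  (h.integrable_copySign hn j).mul_bdd (c := 1) (h.measurable_step j hj).aestronglyMeasurable
    ((h.ae_abs_step_eq_one hj).mono fun _ hω => hω.le)

theorem condExp_copySign_mul (h : IsElephantRandomWalk μ p q X U ξ) {n j : ℕ} (hj : 1 ≤ j)
    (hjn : j ≤ n) :
    μ[copySign U ξ n j * X j | history X n] =ᵐ[μ] fun ω => (2 * p - 1) / n * X j ω := by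
  have hn := hj.trans hjn
  have hpull := condExp_mul_of_stronglyMeasurable_right (m := history X n) (μ := μ)
    (measurable_history X hj hjn).stronglyMeasurable (h.integrable_copySign_mul hn hj)
    (h.integrable_copySign hn j)
  have hconst := condExp_indep_eq (h.measurable_pair hn).comap_le (h.history_le n)
    (measurable_copySign (comap_measurable _) j).stronglyMeasurable (h.indep_history hn)
  filter_upwards [hpull, hconst] with ω hpull hconst
  rw [hpull, Pi.mul_apply, hconst, h.integral_copySign hj hjn]

theorem condExp_step (h : IsElephantRandomWalk μ p q X U ξ) {n : ℕ} (hn : 1 ≤ n) :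
    μ[X (n + 1) | history X n] =ᵐ[μ]
      fun ω => (2 * p - 1) / n * walk X n ω := by
  have hsum := condExp_finsetSum (μ := μ) (s := Finset.Icc 1 n) (fun j hj =>
    h.integrable_copySign_mul hn (Finset.mem_Icc.1 hj).1) (history X n)
  have hterm : ∀ᵐ ω ∂μ, ∀ j ∈ Finset.Icc 1 n,
      (μ[copySign U ξ n j * X j | history X n]) ω = (2 * p - 1) / n * X j ω :=
    (Finset.eventually_all _).2 fun j hj =>
      h.condExp_copySign_mul (Finset.mem_Icc.1 hj).1 (Finset.mem_Icc.1 hj).2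
  filter_upwards [condExp_congr_ae (m := history X n) (h.step_ae_eq_sum hn), hsum, hterm] with
    ω hstep hsum hterm
  rw [hstep, hsum, Finset.sum_apply, Finset.sum_congr rfl hterm, walk, Finset.mul_sum]

end IsElephantRandomWalk

/-! ### Centred signs -/

section Sign

variable {Ω : Type*} {m mΩ : MeasurableSpace Ω} {μ : Measure Ω} [IsProbabilityMeasure μ]
  {x : Ω → ℝ}

-- Hoeffding's lemma for the law on `{1, -1}` with mean `a`.
theorem exp_neg_mul_mul_cosh_add_sinh_le (θ : ℝ) {a : ℝ} (ha : |a| ≤ 1) :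
    Real.exp (-θ * a) * (Real.cosh θ + a * Real.sinh θ) ≤ Real.exp (θ ^ 2 / 2) := by
  obtain ⟨hneg, hpos⟩ : 0 ≤ (1 - a) / 2 ∧ 0 ≤ (1 + a) / 2 := by
    constructor <;> linarith [(abs_le.1 ha).1, (abs_le.1 ha).2]
  let P : Measure ℝ := ENNReal.ofReal ((1 + a) / 2) • Measure.dirac 1 +
    ENNReal.ofReal ((1 - a) / 2) • Measure.dirac (-1)
  have hintegral (f : ℝ → ℝ) : ∫ y, f y ∂P = (1 + a) / 2 * f 1 + (1 - a) / 2 * f (-1) := by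
    rw [integral_add_measure ((integrable_dirac enorm_lt_top).smul_measure ENNReal.ofReal_ne_top)
        ((integrable_dirac enorm_lt_top).smul_measure ENNReal.ofReal_ne_top),
      integral_smul_measure, integral_smul_measure, integral_dirac, integral_dirac,
      ENNReal.toReal_ofReal hpos, ENNReal.toReal_ofReal hneg, smul_eq_mul, smul_eq_mul]
  have hprob : IsProbabilityMeasure P := ⟨by
    simp only [P, Measure.coe_add, Measure.coe_smul, Pi.add_apply, Pi.smul_apply, measure_univ,
      smul_eq_mul, mul_one]
    rw [← ENNReal.ofReal_add hpos hneg, ← ENNReal.ofReal_one]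
    ring_nf⟩
  have hmem : ∀ᵐ y ∂P, y ∈ Set.Icc (-1 : ℝ) 1 := by
    rw [ae_add_measure_iff]
    constructor <;> refine Measure.ae_smul_measure ((ae_dirac_iff measurableSet_Icc).2 ?_) _ <;>
      norm_num
  have hmgf := (hasSubgaussianMGF_of_mem_Icc aemeasurable_id hmem).mgf_le θ
  have hmean : ∫ y, id y ∂P = a := by
    rw [hintegral]
    simp only [id]
    ring
  rw [hmean, mgf, hintegral] at hmgf
  calc Real.exp (-θ * a) * (Real.cosh θ + a * Real.sinh θ)
      = (1 + a) / 2 * Real.exp (θ * (1 - a)) + (1 - a) / 2 * Real.exp (θ * (-1 - a)) := by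
        rw [Real.cosh_eq, Real.sinh_eq, show θ * (1 - a) = -θ * a + θ by ring,
          show θ * (-1 - a) = -θ * a + -θ by ring, Real.exp_add, Real.exp_add]
        ring
    _ ≤ _ := hmgf
    _ = Real.exp (θ ^ 2 / 2) := by norm_num

theorem condExp_exp_mul_of_abs_eq_one (hm : m ≤ mΩ) (hxm : Measurable x)
    (hx : ∀ᵐ ω ∂μ, |x ω| = 1) (θ : ℝ) :
    μ[fun ω => Real.exp (θ * x ω) | m] =ᵐ[μ]
      fun ω => Real.cosh θ + (μ[x | m]) ω * Real.sinh θ := by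
  have hxi : Integrable x μ := .of_bound hxm.aestronglyMeasurable 1 (hx.mono fun _ hω => hω.le)
  have haffine : (fun ω => Real.exp (θ * x ω)) =ᵐ[μ]
      (fun _ => Real.cosh θ) + Real.sinh θ • x := by
    filter_upwards [hx] with ω hω
    rw [Pi.add_apply, Pi.smul_apply, smul_eq_mul]
    rcases eq_or_eq_neg_of_abs_eq hω with hω | hω <;> rw [hω]
    · rw [mul_one, mul_one, Real.cosh_add_sinh]
    · rw [mul_neg_one, mul_neg_one, ← sub_eq_add_neg, Real.cosh_sub_sinh]
  filter_upwards [condExp_congr_ae (m := m) haffine,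
    condExp_add (integrable_const (Real.cosh θ)) (hxi.smul (Real.sinh θ)) m,
    condExp_smul (Real.sinh θ) x m] with ω hexp hadd hsmul
  rw [hexp, hadd, Pi.add_apply, hsmul, condExp_const hm, Pi.smul_apply, smul_eq_mul, mul_comm]

theorem condExp_exp_mul_sub_condExp_le (hm : m ≤ mΩ) (hxm : Measurable x)
    (hx : ∀ᵐ ω ∂μ, |x ω| = 1) (θ : ℝ) :
    μ[fun ω => Real.exp (θ * (x ω - (μ[x | m]) ω)) | m] ≤ᵐ[μ] fun _ => Real.exp (θ ^ 2 / 2) := by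
  have hmean : ∀ᵐ ω ∂μ, |(μ[x | m]) ω| ≤ 1 :=
    ae_bdd_abs_condExp_of_ae_bdd_abs (hx.mono fun _ hω => hω.le)
  have hfactor : (fun ω => Real.exp (θ * (x ω - (μ[x | m]) ω))) =
      (fun ω => Real.exp (-θ * (μ[x | m]) ω)) * fun ω => Real.exp (θ * x ω) := by
    ext ω
    rw [Pi.mul_apply, mul_sub, sub_eq_neg_add, ← neg_mul, Real.exp_add]
  have hbound {y : Ω → ℝ} (hy : ∀ᵐ ω ∂μ, |y ω| ≤ 1) (t : ℝ) :
      ∀ᵐ ω ∂μ, ‖Real.exp (t * y ω)‖ ≤ Real.exp |t| := by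
    filter_upwards [hy] with ω hω
    rw [Real.norm_eq_abs, Real.abs_exp, Real.exp_le_exp]
    exact ((le_abs_self _).trans_eq (abs_mul _ _)).trans
      (mul_le_of_le_one_right (abs_nonneg t) hω)
  have hpull := condExp_stronglyMeasurable_mul_of_bound hm
    (Real.continuous_exp.comp_stronglyMeasurable (stronglyMeasurable_condExp.const_mul (-θ)))
    (Integrable.of_bound (by fun_prop) _ (hbound (hx.mono fun _ hω => hω.le) θ)) _
    (hbound hmean (-θ))
  filter_upwards [(congrArg (μ[· | m]) hfactor).eventuallyEq.trans hpull,
    condExp_exp_mul_of_abs_eq_one hm hxm hx θ, hmean] with ω hpull hexp hω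
  rw [hpull, Pi.mul_apply, hexp]
  exact exp_neg_mul_mul_cosh_add_sinh_le θ hω

theorem variance_sub_condExp (hm : m ≤ mΩ) (hx : MemLp x 2 μ) :
    Var[fun ω => x ω - (μ[x | m]) ω; μ] = ∫ ω, x ω ^ 2 ∂μ - ∫ ω, (μ[x | m]) ω ^ 2 ∂μ := by
  have hintegral := hx.integrable one_le_two
  have hmean : ∫ ω, (x ω - (μ[x | m]) ω) ∂μ = 0 := by
    rw [integral_sub hintegral integrable_condExp, integral_condExp hm, sub_self]
  have hmeas : AEMeasurable (fun ω => x ω - (μ[x | m]) ω) μ :=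
    (hintegral.sub integrable_condExp).aemeasurable
  calc Var[fun ω => x ω - (μ[x | m]) ω; μ] = ∫ ω, (x ω - (μ[x | m]) ω) ^ 2 ∂μ :=
        variance_of_integral_eq_zero hmeas hmean
    _ = ∫ ω, (Var[x; μ | m]) ω ∂μ := (integral_condExp hm).symm
    _ = ∫ ω, ((μ[x ^ 2 | m]) ω - (μ[x | m]) ω ^ 2) ∂μ :=
        integral_congr_ae (condVar_ae_eq_condExp_sq_sub_sq_condExp hm hx)
    _ = ∫ ω, x ω ^ 2 ∂μ - ∫ ω, (μ[x | m]) ω ^ 2 ∂μ := by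
        rw [integral_sub integrable_condExp (hx.condExp one_le_two).integrable_sq,
          integral_condExp hm]
        rfl

end Sign

/-! ### The innovations of the elephant random walk -/

/-- The innovation `X (k + 1) - E[X (k + 1) | F_k]`, the `k`-th martingale difference of the walk;
the index is shifted so that it starts at `0`. -/
noncomputable def innovation {Ω : Type*} [MeasurableSpace Ω] (μ : Measure Ω) (X : ℕ → Ω → ℝ)
    (k : ℕ) (ω : Ω) : ℝ :=
  X (k + 1) ω - (μ[X (k + 1) | history X k]) ω

theorem martPart_eq_weightedSum {Ω : Type*} [MeasurableSpace Ω] (μ : Measure Ω) (γ : ℝ)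
    (X : ℕ → Ω → ℝ) :
    martPart μ γ X = weightedSum (innovation μ X) (powWeight γ) 0 := by
  ext n ω
  calc martPart μ γ X n ω = ∑ k ∈ Finset.Ico 0 n, innovation μ X k ω / ((k + 1 : ℕ) : ℝ) ^ γ :=
        (Finset.sum_Ico_add' (fun k => (X k ω - (μ[X k | history X (k - 1)]) ω) / (k : ℝ) ^ γ)
          0 n 1).symm
    _ = weightedSum (innovation μ X) (powWeight γ) 0 n ω := by
      refine Finset.sum_congr rfl fun k _ => ?_
      rw [powWeight, Real.rpow_neg (by positivity), Nat.cast_succ, div_eq_inv_mul]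

theorem rpow_recurrence_le {A : ℝ} (hA : 0 ≤ A) (hA' : A < 1) {n : ℕ} (hn : 1 ≤ n) :
    (1 + 2 * (A / n)) * ((n : ℝ) ^ (1 + A) / (1 - A)) + 1 ≤
      ((n + 1 : ℕ) : ℝ) ^ (1 + A) / (1 - A) := by
  have hn' : (0 : ℝ) < n := by positivity
  have hA'' : 0 < 1 - A := sub_pos.2 hA'
  have hbernoulli : 1 + (1 + A) * (1 / n) ≤ (1 + 1 / (n : ℝ)) ^ (1 + A) :=
    one_add_mul_self_le_rpow_one_add (neg_one_lt_zero.le.trans (by positivity)) (by linarith)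
  have hpow : (n : ℝ) ^ (1 + A) * (1 + (1 + A) * (1 / n)) ≤ ((n + 1 : ℕ) : ℝ) ^ (1 + A) := by
    calc (n : ℝ) ^ (1 + A) * (1 + (1 + A) * (1 / n))
        ≤ (n : ℝ) ^ (1 + A) * (1 + 1 / n) ^ (1 + A) := by gcongr
      _ = ((n + 1 : ℕ) : ℝ) ^ (1 + A) := by
        rw [← Real.mul_rpow hn'.le (by positivity), mul_one_add, mul_one_div_cancel hn'.ne',
          Nat.cast_succ]
  have hone : 1 ≤ (n : ℝ) ^ A := Real.one_le_rpow (by exact_mod_cast hn) hA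
  have hsplit : (n : ℝ) ^ (1 + A) = n * (n : ℝ) ^ A := by rw [Real.rpow_add hn', Real.rpow_one]
  calc (1 + 2 * (A / n)) * ((n : ℝ) ^ (1 + A) / (1 - A)) + 1
      ≤ (1 + 2 * (A / n)) * ((n : ℝ) ^ (1 + A) / (1 - A)) + (n : ℝ) ^ A := by gcongr
    _ = (n : ℝ) ^ (1 + A) * (1 + (1 + A) * (1 / n)) / (1 - A) := by
      rw [hsplit]
      field_simp
      ring
    _ ≤ ((n + 1 : ℕ) : ℝ) ^ (1 + A) / (1 - A) := by gcongr

namespace IsElephantRandomWalk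

variable {Ω : Type*} [mΩ : MeasurableSpace Ω] {μ : Measure Ω} {p q : ℝ} {X : ℕ → Ω → ℝ}
  {U : ℕ → Ω → ℕ} {ξ : ℕ → Ω → ℝ}

theorem abs_two_mul_sub_one_le (h : IsElephantRandomWalk μ p q X U ξ) : |2 * p - 1| ≤ 1 := by
  have hp : 0 ≤ p := h.sign_pos 1 le_rfl ▸ measureReal_nonneg
  have hp' : 0 ≤ 1 - p := h.sign_neg 1 le_rfl ▸ measureReal_nonneg
  exact abs_le.2 ⟨by linarith, by linarith⟩

variable [IsProbabilityMeasure μ]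

theorem ae_abs_walk_le (h : IsElephantRandomWalk μ p q X U ξ) (n : ℕ) :
    ∀ᵐ ω ∂μ, |walk X n ω| ≤ n := by
  have hstep : ∀ᵐ ω ∂μ, ∀ j ∈ Finset.Icc 1 n, |X j ω| = 1 :=
    (Finset.eventually_all _).2 fun j hj => h.ae_abs_step_eq_one (Finset.mem_Icc.1 hj).1
  filter_upwards [hstep] with ω hω
  calc |walk X n ω| ≤ ∑ j ∈ Finset.Icc 1 n, |X j ω| := Finset.abs_sum_le_sum_abs _ _
    _ = n := by
      rw [Finset.sum_congr rfl hω, Finset.sum_const, Nat.card_Icc, Nat.add_sub_cancel,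
        nsmul_eq_mul, mul_one]

theorem memLp_walk (h : IsElephantRandomWalk μ p q X U ξ) (n : ℕ) : MemLp (walk X n) 2 μ :=
  .of_bound ((measurable_walk X n).mono (h.history_le n) le_rfl).aestronglyMeasurable n
    (h.ae_abs_walk_le n)

theorem memLp_step (h : IsElephantRandomWalk μ p q X U ξ) {n : ℕ} (hn : 1 ≤ n) :
    MemLp (X n) 2 μ :=
  .of_bound (h.measurable_step n hn).aestronglyMeasurable 1
    ((h.ae_abs_step_eq_one hn).mono fun _ hω => hω.le)

theorem integral_step_sq (h : IsElephantRandomWalk μ p q X U ξ) {n : ℕ} (hn : 1 ≤ n) :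
    ∫ ω, X n ω ^ 2 ∂μ = 1 := by
  have hsq : (fun ω => X n ω ^ 2) =ᵐ[μ] fun _ => 1 := by
    filter_upwards [h.ae_abs_step_eq_one hn] with ω hω
    rw [← sq_abs, hω, one_pow]
  rw [integral_congr_ae hsq, integral_const, probReal_univ, one_smul]

theorem integral_walk_mul_step (h : IsElephantRandomWalk μ p q X U ξ) {n : ℕ} (hn : 1 ≤ n) :
    ∫ ω, walk X n ω * X (n + 1) ω ∂μ = (2 * p - 1) / n * ∫ ω, walk X n ω ^ 2 ∂μ := by
  have hpull := condExp_mul_of_stronglyMeasurable_left (m := history X n) (μ := μ)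
    (measurable_walk X n).stronglyMeasurable
    ((h.memLp_walk n).integrable_mul (h.memLp_step n.succ_pos))
    ((h.memLp_step n.succ_pos).integrable one_le_two)
  calc ∫ ω, walk X n ω * X (n + 1) ω ∂μ
      = ∫ ω, (μ[walk X n * X (n + 1) | history X n]) ω ∂μ :=
        (integral_condExp (h.history_le n)).symm
    _ = ∫ ω, (2 * p - 1) / n * walk X n ω ^ 2 ∂μ := by
        refine integral_congr_ae ?_
        filter_upwards [hpull, h.condExp_step hn] with ω hpull hstep
        rw [hpull, Pi.mul_apply, hstep]
        ring
    _ = (2 * p - 1) / n * ∫ ω, walk X n ω ^ 2 ∂μ := integral_const_mul _ _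

theorem integral_walk_succ_sq (h : IsElephantRandomWalk μ p q X U ξ) {n : ℕ} (hn : 1 ≤ n) :
    ∫ ω, walk X (n + 1) ω ^ 2 ∂μ =
      (1 + 2 * ((2 * p - 1) / n)) * ∫ ω, walk X n ω ^ 2 ∂μ + 1 := by
  have hexpand (ω : Ω) : walk X (n + 1) ω ^ 2 =
      walk X n ω ^ 2 + 2 * (walk X n ω * X (n + 1) ω) + X (n + 1) ω ^ 2 := by
    rw [walk, Finset.sum_Icc_succ_top n.succ_pos, ← walk]
    ring
  have hsq := (h.memLp_walk n).integrable_sq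
  have hcross : Integrable (fun ω => 2 * (walk X n ω * X (n + 1) ω)) μ :=
    ((h.memLp_walk n).integrable_mul (h.memLp_step n.succ_pos)).const_mul 2
  have hsum := integral_add (hsq.add hcross) (h.memLp_step n.succ_pos).integrable_sq
  simp only [Pi.add_apply, ← hexpand] at hsum
  rw [hsum, integral_add hsq hcross, integral_const_mul, h.integral_walk_mul_step hn,
    h.integral_step_sq n.succ_pos]
  ring

theorem integral_walk_sq_le (h : IsElephantRandomWalk μ p q X U ξ) {A : ℝ} (hA : 0 ≤ A)
    (hA' : A < 1) (hpA : 2 * p - 1 ≤ A) {n : ℕ} (hn : 1 ≤ n) :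
    ∫ ω, walk X n ω ^ 2 ∂μ ≤ (n : ℝ) ^ (1 + A) / (1 - A) := by
  induction n, hn using Nat.le_induction with
  | base =>
    simp only [walk, Finset.Icc_self, Finset.sum_singleton, h.integral_step_sq le_rfl,
      Nat.cast_one, Real.one_rpow]
    exact one_le_one_div (sub_pos.2 hA') (sub_le_self 1 hA)
  | succ n hn ih =>
    have : 0 ≤ ∫ ω, walk X n ω ^ 2 ∂μ := integral_nonneg fun ω => sq_nonneg _
    calc ∫ ω, walk X (n + 1) ω ^ 2 ∂μ
        = (1 + 2 * ((2 * p - 1) / n)) * ∫ ω, walk X n ω ^ 2 ∂μ + 1 := h.integral_walk_succ_sq hn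
      _ ≤ (1 + 2 * (A / n)) * ∫ ω, walk X n ω ^ 2 ∂μ + 1 := by gcongr
      _ ≤ (1 + 2 * (A / n)) * ((n : ℝ) ^ (1 + A) / (1 - A)) + 1 := by gcongr
      _ ≤ ((n + 1 : ℕ) : ℝ) ^ (1 + A) / (1 - A) := rpow_recurrence_le hA hA' hn

theorem integral_condExp_step_sq_le_rpow (h : IsElephantRandomWalk μ p q X U ξ) {A : ℝ}
    (hA : 0 ≤ A) (hA' : A < 1) (hpA : 2 * p - 1 ≤ A) {n : ℕ} (hn : 1 ≤ n) :
    ∫ ω, (μ[X (n + 1) | history X n]) ω ^ 2 ∂μ ≤ (n : ℝ) ^ (-(1 - A)) / (1 - A) := by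
  have hn' : (0 : ℝ) < n := by positivity
  have hcongr : (fun ω => (μ[X (n + 1) | history X n]) ω ^ 2) =ᵐ[μ]
      fun ω => ((2 * p - 1) / n) ^ 2 * walk X n ω ^ 2 := by
    filter_upwards [h.condExp_step hn] with ω hω
    rw [hω, mul_pow]
  have hpow : (n : ℝ) ^ (1 + A) = (n : ℝ) ^ 2 * (n : ℝ) ^ (-(1 - A)) := by
    rw [← Real.rpow_two, ← Real.rpow_add hn']
    ring_nf
  have hA'' : 0 < 1 - A := sub_pos.2 hA'
  calc ∫ ω, (μ[X (n + 1) | history X n]) ω ^ 2 ∂μ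
      = ((2 * p - 1) / n) ^ 2 * ∫ ω, walk X n ω ^ 2 ∂μ := by
        rw [integral_congr_ae hcongr, integral_const_mul]
    _ ≤ ((2 * p - 1) / n) ^ 2 * ((n : ℝ) ^ (1 + A) / (1 - A)) := by
        gcongr
        exact h.integral_walk_sq_le hA hA' hpA hn
    _ = (2 * p - 1) ^ 2 * ((n : ℝ) ^ (-(1 - A)) / (1 - A)) := by
        rw [hpow]
        field_simp
    _ ≤ (n : ℝ) ^ (-(1 - A)) / (1 - A) :=
        mul_le_of_le_one_left (by positivity)
          ((sq_le_one_iff_abs_le_one _).2 h.abs_two_mul_sub_one_le)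

theorem one_sub_variance_innovation (h : IsElephantRandomWalk μ p q X U ξ) (n : ℕ) :
    1 - Var[innovation μ X n; μ] = ∫ ω, (μ[X (n + 1) | history X n]) ω ^ 2 ∂μ := by
  have hvar : Var[innovation μ X n; μ] = _ :=
    variance_sub_condExp (h.history_le n) (h.memLp_step n.succ_pos)
  rw [hvar, h.integral_step_sq n.succ_pos, sub_sub_cancel]

theorem exists_one_sub_variance_innovation_le (h : IsElephantRandomWalk μ p q X U ξ)
    (hp : 2 * p - 1 < 1) :
    ∃ C s : ℝ, 0 < C ∧ 0 < s ∧
      ∀ k : ℕ, 1 - Var[innovation μ X k; μ] ≤ C * ((k : ℝ) + 1) ^ (-s) := by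
  obtain ⟨A, hA, hA', hpA⟩ : ∃ A : ℝ, 0 ≤ A ∧ A < 1 ∧ 2 * p - 1 ≤ A :=
    ⟨max (2 * p - 1) 0, le_max_right _ _, max_lt hp one_pos, le_max_left _ _⟩
  have hs : 0 < 1 - A := sub_pos.2 hA'
  refine ⟨2 / (1 - A), 1 - A, by positivity, hs, fun k => ?_⟩
  rcases Nat.eq_zero_or_pos k with rfl | hk
  · have hone : 1 ≤ 2 / (1 - A) := (one_le_div hs).2 (by linarith)
    simpa using hone.trans (le_add_of_nonneg_right (variance_nonneg _ _))
  · have hhalf : (k : ℝ) ^ (-(1 - A)) ≤ 2 * ((k : ℝ) + 1) ^ (-(1 - A)) := by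
      have hk' : (1 : ℝ) ≤ k := by exact_mod_cast hk
      calc (k : ℝ) ^ (-(1 - A)) ≤ (((k : ℝ) + 1) / 2) ^ (-(1 - A)) :=
            Real.rpow_le_rpow_of_nonpos (by positivity) (by linarith) (by linarith)
        _ = 2 ^ (1 - A) * ((k : ℝ) + 1) ^ (-(1 - A)) := by
            rw [Real.div_rpow (by positivity) zero_le_two, Real.rpow_neg zero_le_two,
              div_inv_eq_mul, mul_comm]
        _ ≤ 2 * ((k : ℝ) + 1) ^ (-(1 - A)) := by
            gcongr
            exact Real.rpow_le_self_of_one_le one_le_two (sub_le_self 1 hA)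
    calc 1 - Var[innovation μ X k; μ] = ∫ ω, (μ[X (k + 1) | history X k]) ω ^ 2 ∂μ :=
          h.one_sub_variance_innovation k
      _ ≤ (k : ℝ) ^ (-(1 - A)) / (1 - A) := h.integral_condExp_step_sq_le_rpow hA hA' hpA hk
      _ ≤ 2 * ((k : ℝ) + 1) ^ (-(1 - A)) / (1 - A) := by gcongr
      _ = 2 / (1 - A) * ((k : ℝ) + 1) ^ (-(1 - A)) := by ring

/-- The filtration generated by the steps. -/
def stepFiltration (h : IsElephantRandomWalk μ p q X U ξ) : Filtration ℕ mΩ where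
  seq := history X
  mono' _ _ hij := biSup_mono fun _ hk => Finset.Icc_subset_Icc_right hij hk
  le' := h.history_le

theorem isSubgaussianDifference (h : IsElephantRandomWalk μ p q X U ξ) :
    IsSubgaussianDifference μ h.stepFiltration (innovation μ X) 2 where
  measurable_succ k := (measurable_history X k.succ_pos le_rfl).sub
    (stronglyMeasurable_condExp.measurable.mono (h.stepFiltration.mono k.le_succ) le_rfl)
  ae_abs_le k := by
    have hstep : ∀ᵐ ω ∂μ, |X (k + 1) ω| ≤ 1 :=
      (h.ae_abs_step_eq_one k.succ_pos).mono fun _ hω => hω.le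
    filter_upwards [hstep, ae_bdd_abs_condExp_of_ae_bdd_abs (m := history X k) hstep] with
      ω hω hmean
    exact (abs_sub _ _).trans ((add_le_add hω hmean).trans_eq one_add_one_eq_two)
  condExp_eq_zero k := by
    have hX : Integrable (X (k + 1)) μ := (h.memLp_step k.succ_pos).integrable one_le_two
    filter_upwards [condExp_sub hX integrable_condExp (history X k)] with ω hω
    refine hω.trans ?_
    rw [Pi.sub_apply, condExp_of_stronglyMeasurable (h.history_le k) stronglyMeasurable_condExp
      integrable_condExp, sub_self, Pi.zero_apply]
  condExp_exp_le k := condExp_exp_mul_sub_condExp_le (h.history_le k)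
    (h.measurable_step (k + 1) k.succ_pos) (h.ae_abs_step_eq_one k.succ_pos)

end IsElephantRandomWalk

end ERW

theorem theorem3 {Ω : Type*} [MeasurableSpace Ω] (μ : Measure Ω) [IsProbabilityMeasure μ]
    (p q α γ : ℝ) (hα : α = 2 * p - 1) (hα_mem : α ∈ Set.Ico (-1 : ℝ) 1)
    (hq : q ∈ Set.Icc (0 : ℝ) 1) (hγ : 0 < γ)
    (X : ℕ → Ω → ℝ) (U : ℕ → Ω → ℕ) (ξ : ℕ → Ω → ℝ)
    (hX : ERW.IsElephantRandomWalk μ p q X U ξ) :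
    (γ < 1 / 2 →
      ERW.CLT μ (fun n ω => ERW.martPart μ γ X n ω / (n : ℝ) ^ (1 / 2 - γ)) (1 / (1 - 2 * γ)) ∧
      ∀ᵐ ω ∂μ, ERW.LimsupPM
        (fun n => ERW.martPart μ γ X n ω /
          √(2 * (n : ℝ) ^ (1 - 2 * γ) * Real.log (Real.log n)))
        (1 / √(1 - 2 * γ))) ∧
    (γ = 1 / 2 →
      ERW.CLT μ (fun n ω => ERW.martPart μ γ X n ω / √(Real.log n)) 1 ∧
      ∀ᵐ ω ∂μ, ERW.LimsupPM
        (fun n => ERW.martPart μ γ X n ω /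
          √(2 * Real.log n * Real.log (Real.log (Real.log n))))
        1) ∧
    (1 / 2 < γ →
      ∃ Minf : Ω → ℝ,
        (∀ᵐ ω ∂μ, Tendsto (fun n => ERW.martPart μ γ X n ω) atTop (𝓝 (Minf ω))) ∧
        (∀ n, MemLp (ERW.martPart μ γ X n) 2 μ) ∧ MemLp Minf 2 μ ∧
        Tendsto (fun n => eLpNorm (fun ω => ERW.martPart μ γ X n ω - Minf ω) 2 μ) atTop (𝓝 0) ∧
        0 < variance Minf μ ∧
        ERW.CLT μ (fun n ω => (ERW.martPart μ γ X n ω - Minf ω) / (n : ℝ) ^ (1 / 2 - γ))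
          (1 / (2 * γ - 1)) ∧
        ∀ᵐ ω ∂μ, ERW.LimsupPM
          (fun n => (ERW.martPart μ γ X n ω - Minf ω) /
            √(2 * (n : ℝ) ^ (1 - 2 * γ) * Real.log (Real.log n)))
          (1 / √(2 * γ - 1))) := by
  subst hα
  have hd := hX.isSubgaussianDifference
  have hvar := hX.exists_one_sub_variance_innovation_le hα_mem.2
  rw [ERW.martPart_eq_weightedSum]
  refine ⟨fun hγ' => ⟨?_, ?_⟩, fun hγ' => ⟨?_, ?_⟩, fun hγ' => ?_⟩
  · exact hd.clt_powWeight_of_lt_half (hd.tendsto_one_sub_variance hvar) hγ.le hγ'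
  · exact hd.ae_limsupPM_powWeight_of_lt_half hvar hγ.le hγ'
  · exact hγ' ▸ hd.clt_powWeight_half (hd.tendsto_one_sub_variance hvar)
  · exact hγ' ▸ hd.ae_limsupPM_powWeight_half hvar
  · have hsum := ERW.summable_powWeight_sq hγ'
    obtain ⟨L, hLm, hL⟩ := hd.exists_ae_tendsto_weightedSum hsum
    obtain ⟨k, hk⟩ := ((hd.tendsto_one_sub_variance hvar).eventually_lt_const one_pos).exists
    exact ⟨L, hL, fun n => hd.memLp_weightedSum _ 0 n 2, hd.memLp_limit hsum hLm hL,
      hd.tendsto_eLpNorm_weightedSum_sub hsum hL,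
      hd.variance_limit_pos hsum hLm hL (ERW.powWeight_pos γ k).ne' (by linarith),
      hd.clt_powWeight_of_half_lt (hd.tendsto_one_sub_variance hvar) hγ' hLm hL,
      hd.ae_limsupPM_powWeight_of_half_lt hvar hγ' hL⟩
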